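/- **Setting.** Let $d,n\ge 1$, $\alpha\in\mathbb R$. For $x\in\mathbb Z^d$ let $|x|$ be the Euclidean norm and $\langle x\rangle=\sqrt{1+|x|^2}$. $\mathcal H_\alpha$ is the Hilbert space of pairs $Y=(Y^0,Y^1)=(u,v)$ of functions $u,v:\mathbb Z^d\to\mathbb R^n$ with $\|Y\|_\alpha^2=\sum_x\langle x\rangle^{2\alpha}(|u(x)|^2+|v(x)|^2)<\infty$. Let $V:\mathbb Z^d\to\mathbb R^{n\times n}$, $\hat V(\theta)=\sum_x e^{i(x,\theta)}V(x)$ for $\theta\in\mathbb T^d=\mathbb R^d/(2\pi\mathbb Z)^d$ (hats denote this Fourier transform throughout), and consider the harmonic crystal $$\dot u(x,t)=v(x,t),\qquad \dot v(x,t)=-\sum_{y\in\mathbb Z^d}V(x-y)u(y,t),\qquad Y(0)=Y_0 .$$ Under E1, E2 below it has for each $Y_0\in\mathcal H_\alpha$ a unique solution $Y\in C(\mathbb R,\mathcal H_\alpha)$; put $U(t)Y_0=Y(t)$. **Spectral data.** When $\hat V(\theta)$ is Hermitian and nonnegative definite, put $\Omega(\theta)=\hat V(\theta)^{1/2}\ge0$.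 Let $\omega_1(\theta)<\omega_2(\theta)<\dots$ be the distinct eigenvalues of $\Omega(\theta)$, let $\Pi_\sigma(\theta)$ be the orthogonal projection onto the eigenspace of $\omega_\sigma(\theta)$, and let $s$ be the maximal number of distinct eigenvalues. Let $\mathbb T^d\setminus\mathcal C_*$ be the open set, of full measure, of the points near which the number of distinct eigenvalues is constant and all $\omega_\sigma$ are real-analytic; there that number equals $s$ and the $\Pi_\sigma$ are real-analytic. **Conditions on $V$.** - E1: there are $C,\gamma>0$ with $\|V(x)\|\le Ce^{-\gamma|x|}$ for all $x$. - E2: $V_{lk}(-x)=V_{kl}(x)$. - E3: $\hat V(\theta)$ is nonnegative definite for every $\theta$. - E4: for all $l=1,\dots,d$ and $\sigma=1,\dots,s$, $\partial_{\theta_l}\omega_\sigma$ does not vanish identically on any nonempty open subset of $\mathbb T^d\setminus\mathcal C_*$ (equivalently, on any connected component). - E5: for $\sigma\ne\sigma'$, neither $\omega_\sigma+\omega_{\sigma'}$ nor $\omega_\sigma-\omega_{\sigma'}$ is identically equal to a nonzero constant on any nonempty open subset of $\mathbb T^d\setminus\mathcal C_*$. - E6: $\hat V(\theta)$ is invertible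 for almost all $\theta$ and $\|\hat V^{-1}\|\in L^1(\mathbb T^d)$. **Conditions on the initial measure.** Let $\mu_0$ be a Borel probability measure on $\mathcal H_\alpha$ and $Q_0(x,y)=\int Y(x)\otimes Y(y)\,\mu_0(dY)$ its $2n\times2n$ covariance, with $n\times n$ blocks $Q_0^{ij}$, $i,j\in\{0,1\}$. - S1: $\int Y(x)\,\mu_0(dY)=0$ for all $x$. - S2: the coordinates of $Y(x)$ are in $L^2(\mu_0)$ for all $x$, and $|Q_0^{ij}(x,y)|\le h(|x-y|)$ for a function $h$ with $r^{d-1}h(r)\in L^1(0,\infty)$ and $\sum_{z\in\mathbb Z^d}h(|z|)<\infty$ (the latter is automatic if $h$ is nonincreasing). - S3: for some $k\in\{1,\dots,d\}$, $Q_0(x+h,y+h)=Q_0(x,y)$ for all $x,y$ and all $h\in\mathbb Z^d$ with $h_1=\dots=h_k=0$; and for every ${\bf n}\in\{1,2\}^k$ there is a matrix function $q_{\bf n}$ such that for all $z\in\mathbb Z^d$ and $\varepsilon>0$ there is $N\in\mathbb N$ with $$|Q_0(y+z,y)-q_{\bf n}(z)|<\varepsilon\quad\text{for all }y\in\mathbb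 Z^d\text{ with }(-1)^{n_j}y_j>N,\ j=1,\dots,k ;$$ here $q_{\bf n}(x-y)$ is the covariance of some translation-invariant Borel probability measure on $\mathcal H_\alpha$ with mean zero and finite second moments. **The limit.** Put $$C(\theta)=\begin{pmatrix}0&\Omega(\theta)^{-1}\\-\Omega(\theta)&0\end{pmatrix},\qquad L_1^+(A)=\tfrac12\big(A+CAC^*\big),\qquad L_2^-(A)=\tfrac12\big(CA-AC^*\big),$$ $$S^{\rm even}_{k,{\bf n}}(\omega_\sigma)=\sum_{\substack{P\subset\{1,\dots,k\}\\ |P|\ge 1\text{ even}}}\ \prod_{p\in P}(-1)^{n_p}\,\mathrm{sgn}\frac{\partial\omega_\sigma}{\partial\theta_p},\qquad S^{\rm odd}_{k,{\bf n}}(\omega_\sigma)=\sum_{\substack{P\subset\{1,\dots,k\}\\ |P|\text{ odd}}}\ \prod_{p\in P}(-1)^{n_p}\,\mathrm{sgn}\frac{\partial\omega_\sigma}{\partial\theta_p},$$ $${\bf M}^+_{k,\sigma}=\frac1{2^k}\sum_{{\bf n}\in\{1,2\}^k}L_1^+(\hat q_{\bf n})\big[1+S^{\rm even}_{k,{\bf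 n}}(\omega_\sigma)\big],\qquad {\bf M}^-_{k,\sigma}=\frac1{2^k}\sum_{{\bf n}\in\{1,2\}^k}L_2^-(\hat q_{\bf n})\,S^{\rm odd}_{k,{\bf n}}(\omega_\sigma),$$ $$\hat q_\infty(\theta)=\sum_{\sigma=1}^s\Pi_\sigma(\theta)\big({\bf M}^+_{k,\sigma}(\theta)+i\,{\bf M}^-_{k,\sigma}(\theta)\big)\Pi_\sigma(\theta)\quad\text{for a.a. }\theta,\qquad q_\infty(x)=(2\pi)^{-d}\int_{\mathbb T^d}e^{-i(x,\theta)}\hat q_\infty(\theta)\,d\theta ,$$ where $\Pi_\sigma$ acts on each of the two components. **Theorem 2.6.** Let $d,n\ge1$, $\alpha<-d/2$, and assume E1–E6 and S1–S3. Let $\mu_t$ be the distribution of $U(t)Y_0$ when $Y_0$ has distribution $\mu_0$. Then, for every $t\in\mathbb R$, $\mu_t$ is a probability measure such that the coordinates of $Y(x)$ are in $L^2(\mu_t)$ for all $x$; $\hat q_\infty\in L^1(\mathbb T^d)$; and for all $x,y\in\mathbb Z^d$, $$Q_t(x,y)=\int Y(x)\otimes Y(y)\,\mu_t(dY)\ \longrightarrow\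 q_\infty(x-y)\qquad(t\to+\infty).$$ -/

import Mathlib

noncomputable section

namespace HarmonicCrystal

open MeasureTheory Filter Topology
open scoped Matrix Matrix.Norms.L2Operator MatrixOrder ComplexOrder

/-- The lattice `ℤ^d`. -/
abbrev Lattice (d : ℕ) : Type := Fin d → ℤ

/-- The Euclidean norm `|x|` of a lattice point. -/
def latNorm {d : ℕ} (x : Lattice d) : ℝ := √(∑ i, (x i : ℝ) ^ 2)

/-- The weight `⟨x⟩ = √(1 + |x|²)`. -/
def bracket {d : ℕ} (x : Lattice d) : ℝ := √(1 + latNorm x ^ 2)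

theorem bracket_pos {d : ℕ} (x : Lattice d) : 0 < bracket x := by
  unfold bracket; positivity

/-- The value `(u(x), v(x)) ∈ ℝⁿ × ℝⁿ` of a field at one lattice point: the coordinate `Sum.inl a`
is `u_a`, the coordinate `Sum.inr a` is `v_a`, and `‖(u, v)‖² = |u|² + |v|²`. -/
abbrev Site (n : ℕ) : Type := EuclideanSpace ℝ (Fin n ⊕ Fin n)

/-! ### The phase space -/

/-- The pairs `Y = (u, v)` of sequences with `∑ₓ ⟨x⟩^{2α} (|u(x)|² + |v(x)|²) < ∞`. -/
def phaseSubmodule (d n : ℕ) (α : ℝ) : Submodule ℝ (Lattice d → Site n) where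
  carrier := {Y | Summable fun x => bracket x ^ (2 * α) * ‖Y x‖ ^ 2}
  zero_mem' := by simp [summable_zero]
  add_mem' := by
    intro Y Z hY hZ
    refine Summable.of_nonneg_of_le (fun x => ?_) (fun x => ?_) ((hY.add hZ).mul_left 2)
    · have := bracket_pos x
      positivity
    · have hb : 0 ≤ bracket x ^ (2 * α) := Real.rpow_nonneg (bracket_pos x).le _
      have h1 : ‖(Y + Z) x‖ ^ 2 ≤ 2 * (‖Y x‖ ^ 2 + ‖Z x‖ ^ 2) := by
        have := norm_add_le (Y x) (Z x)
        have h0 := norm_nonneg ((Y + Z) x)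
        simp only [Pi.add_apply] at h0 ⊢
        nlinarith [sq_nonneg (‖Y x‖ - ‖Z x‖)]
      nlinarith [mul_le_mul_of_nonneg_left h1 hb]
  smul_mem' := by
    intro c Y hY
    have := hY.mul_left (c ^ 2)
    refine this.congr fun x => ?_
    simp only [Pi.smul_apply, norm_smul, mul_pow, Real.norm_eq_abs, sq_abs]
    ring

/-- The phase space `H_α`; its topology is that of the weighted norm below, not that of pointwise
convergence. -/
def PhaseSpace (d n : ℕ) (α : ℝ) : Type := ↥(phaseSubmodule d n α)

variable {d n : ℕ} {α : ℝ}

instance : AddCommGroup (PhaseSpace d n α) := inferInstanceAs (AddCommGroup ↥(phaseSubmodule d n α))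

instance : Module ℝ (PhaseSpace d n α) := inferInstanceAs (Module ℝ ↥(phaseSubmodule d n α))

/-- Elements of `H_α` are functions on the lattice. -/
instance : CoeFun (PhaseSpace d n α) (fun _ => Lattice d → Site n) := ⟨Subtype.val⟩

/-- Multiplication by the weight `⟨x⟩^α`, from `H_α` to `ℓ²`. -/
def toEllTwo (d n : ℕ) (α : ℝ) : PhaseSpace d n α →ₗ[ℝ] lp (fun _ : Lattice d => Site n) 2 where
  toFun Y := ⟨fun x => (bracket x ^ α) • Y x, by
    change Memℓp _ _
    rw [memℓp_gen_iff (by norm_num)]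
    refine Summable.congr (Subtype.property Y) fun x => ?_
    have hb := (bracket_pos x).le
    rw [norm_smul, Real.norm_of_nonneg (Real.rpow_nonneg hb _), mul_comm 2 α,
      Real.rpow_mul hb]
    norm_num [mul_pow]⟩
  map_add' Y Z := by
    ext1; funext x
    exact smul_add (bracket x ^ α) (Y x) (Z x)
  map_smul' c Y := by
    ext1; funext x
    exact smul_comm (bracket x ^ α) c (Y x)

theorem toEllTwo_injective (d n : ℕ) (α : ℝ) : Function.Injective (toEllTwo d n α) := by
  intro Y Z h
  apply Subtype.ext
  funext x
  have h1 : (bracket x ^ α) • Y x = (bracket x ^ α) • Z x := congrFun (congrArg Subtype.val h) x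
  exact smul_right_injective _ (Real.rpow_pos_of_pos (bracket_pos x) α).ne' h1

instance : NormedAddCommGroup (PhaseSpace d n α) :=
  NormedAddCommGroup.induced _ _ (toEllTwo d n α) (toEllTwo_injective d n α)

instance : NormedSpace ℝ (PhaseSpace d n α) :=
  NormedSpace.induced ℝ (PhaseSpace d n α) _ (toEllTwo d n α)

/-- The norm of `H_α`: `‖Y‖_α² = ∑ₓ ⟨x⟩^{2α} (|u(x)|² + |v(x)|²)`. -/
theorem norm_sq_eq (Y : PhaseSpace d n α) :
    ‖Y‖ ^ 2 = ∑' x, bracket x ^ (2 * α) * ‖Y x‖ ^ 2 := by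
  have h : ‖Y‖ = ‖toEllTwo d n α Y‖ := rfl
  have h2 := lp.norm_rpow_eq_tsum (p := 2) (by norm_num) (toEllTwo d n α Y)
  norm_num at h2
  rw [h, h2]
  refine tsum_congr fun x => ?_
  have hb := (bracket_pos x).le
  have h3 : (toEllTwo d n α Y : Lattice d → Site n) x = (bracket x ^ α) • Y x := rfl
  rw [h3, norm_smul, Real.norm_of_nonneg (Real.rpow_nonneg hb _), mul_comm 2 α,
      Real.rpow_mul hb]
  norm_num [mul_pow]

instance : MeasurableSpace (PhaseSpace d n α) := borel _

instance : BorelSpace (PhaseSpace d n α) := ⟨rfl⟩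

/-! ### Dynamics -/

/-- An interaction: a real `n × n` matrix `V(x)` for every lattice vector `x`. -/
abbrev Interaction (d n : ℕ) : Type := Lattice d → Matrix (Fin n) (Fin n) ℝ

/-- `Y ∈ C(ℝ, H_α)` solves `u̇ = v`, `v̇(x) = - ∑_y V(x - y) u(y)`. -/
def IsSolution (V : Interaction d n) (Y : ℝ → PhaseSpace d n α) : Prop :=
  Continuous Y ∧ ∀ (t : ℝ) (x : Lattice d) (a : Fin n),
    HasDerivAt (fun s => Y s x (Sum.inl a)) (Y t x (Sum.inr a)) t ∧
    HasDerivAt (fun s => Y s x (Sum.inr a))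
      (-∑' y : Lattice d, ∑ b, V (x - y) a b * Y t y (Sum.inl b)) t

open Classical in
/-- `U(t) Y₀`: the value at time `t` of the solution with initial datum `Y₀` (the solution exists
and is unique for exponentially decaying `V`). -/
def evolution (V : Interaction d n) (t : ℝ) (Y₀ : PhaseSpace d n α) : PhaseSpace d n α :=
  if h : ∃ Y : ℝ → PhaseSpace d n α, IsSolution V Y ∧ Y 0 = Y₀ then h.choose t else Y₀

/-- The distribution `μ_t` of `U(t) Y₀` when `Y₀` has distribution `μ₀`. -/
def evolvedMeasure (V : Interaction d n) (μ₀ : Measure (PhaseSpace d n α)) (t : ℝ) :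
    Measure (PhaseSpace d n α) :=
  μ₀.map (evolution V t)

/-! ### Correlations of measures on the phase space -/

/-- `2n × 2n` matrices, as `2 × 2` blocks `(Q^{ij})_{i,j = 0,1}` of `n × n` matrices: the
indices `Sum.inl a`, `Sum.inr a` belong to the blocks `0`, `1`. -/
abbrev BlockMatrix (n : ℕ) (R : Type) : Type := Matrix (Fin n ⊕ Fin n) (Fin n ⊕ Fin n) R

/-- The values of the field are square integrable, so that the correlations are well defined. -/
def HasSecondMoments (μ : Measure (PhaseSpace d n α)) : Prop :=
  ∀ (x : Lattice d) (p : Fin n ⊕ Fin n), MemLp (fun Y : PhaseSpace d n α => Y x p) 2 μ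

/-- The mean of the field is zero. -/
def ZeroMean (μ : Measure (PhaseSpace d n α)) : Prop :=
  ∀ (x : Lattice d) (p : Fin n ⊕ Fin n),
    Integrable (fun Y : PhaseSpace d n α => Y x p) μ ∧ ∫ Y, Y x p ∂μ = 0

/-- The correlation matrix `∫ Y(x) ⊗ Y(y) μ(dY)`. -/
def correlation (μ : Measure (PhaseSpace d n α)) (x y : Lattice d) : BlockMatrix n ℝ :=
  Matrix.of fun p q => ∫ Y, Y x p * Y y q ∂μ

/-- The set `T_h B`, where `(T_h Y)(x) = Y(x - h)`. -/
def translate (h : Lattice d) (B : Set (PhaseSpace d n α)) : Set (PhaseSpace d n α) :=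
  {Y | ∃ Z ∈ B, ∀ x, Y x = Z (x - h)}

/-- `μ(T_h B) = μ(B)` for all Borel sets `B` and all lattice vectors `h`. -/
def TranslationInvariant (μ : Measure (PhaseSpace d n α)) : Prop :=
  ∀ (h : Lattice d) (B : Set (PhaseSpace d n α)), MeasurableSet B → μ (translate h B) = μ B

/-! ### Fourier transform, dispersion relations, spectral projections

Functions on the torus `ℝ^d / (2πℤ)^d` are represented by periodic functions on `ℝ^d`. -/

/-- The scalar product `(x, θ)`. -/
def pairing (x : Lattice d) (θ : Fin d → ℝ) : ℝ := ∑ i, (x i : ℝ) * θ i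

/-- A fundamental domain of the torus `ℝ^d / (2πℤ)^d`. -/
def torusCell (d : ℕ) : Set (Fin d → ℝ) := Set.univ.pi fun _ => Set.Ioc (-Real.pi) Real.pi

/-- `f̂(θ) = ∑ₓ e^{i(x,θ)} f(x)` for a sequence of real matrices. -/
def fourier {m : Type} (f : Lattice d → Matrix m m ℝ) (θ : Fin d → ℝ) : Matrix m m ℂ :=
  Matrix.of fun a b => ∑' x, Complex.exp (Complex.I * (pairing x θ : ℝ)) * (f x a b : ℂ)

/-- `Ω(θ) = (V̂(θ))^{1/2}`, the nonnegative square root. -/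
def Omega (V : Interaction d n) (θ : Fin d → ℝ) : Matrix (Fin n) (Fin n) ℂ :=
  CFC.sqrt (fourier V θ)

/-- The set of (distinct) eigenvalues of `Ω(θ)`. -/
def eigenvalueSet (V : Interaction d n) (θ : Fin d → ℝ) : Finset ℝ :=
  (Matrix.finite_real_spectrum (A := Omega V θ)).toFinset

/-- The number of distinct eigenvalues of `Ω(θ)`. -/
def eigenvalueCount (V : Interaction d n) (θ : Fin d → ℝ) : ℕ := (eigenvalueSet V θ).card

theorem eigenvalueCount_le (V : Interaction d n) (θ : Fin d → ℝ) : eigenvalueCount V θ ≤ n := by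
  classical
  have hsub : (eigenvalueSet V θ).image ((↑) : ℝ → ℂ) ⊆ (Omega V θ).charpoly.roots.toFinset := by
    intro w hw
    obtain ⟨r, hr, rfl⟩ := Finset.mem_image.1 hw
    have hr' : r ∈ spectrum ℝ (Omega V θ) := by simpa [eigenvalueSet] using hr
    have h2 : (r : ℂ) ∈ spectrum ℂ (Omega V θ) := by
      simpa using (spectrum.algebraMap_mem_iff ℂ).2 hr'
    rw [Multiset.mem_toFinset, Polynomial.mem_roots (Omega V θ).charpoly_monic.ne_zero]
    exact Matrix.mem_spectrum_iff_isRoot_charpoly.1 h2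
  have h1 : ((eigenvalueSet V θ).image ((↑) : ℝ → ℂ)).card = eigenvalueCount V θ :=
    Finset.card_image_of_injective _ Complex.ofReal_injective
  rw [← h1]
  refine (Finset.card_le_card hsub).trans ((Multiset.toFinset_card_le _).trans ?_)
  refine (Polynomial.card_roots' _).trans ?_
  simp [Matrix.charpoly_natDegree_eq_dim]

/-- The number `s` of bands: the maximal number of distinct eigenvalues of `Ω(θ)`, attained
for almost all `θ`. -/
def bandCount (V : Interaction d n) : ℕ := ⨆ θ, eigenvalueCount V θ

theorem eigenvalueCount_le_bandCount (V : Interaction d n) (θ : Fin d → ℝ) :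
    eigenvalueCount V θ ≤ bandCount V :=
  le_ciSup (f := fun θ => eigenvalueCount V θ)
    ⟨n, by rintro _ ⟨θ, rfl⟩; exact eigenvalueCount_le V θ⟩ θ

/-- The dispersion relation `ω_σ(θ)`: the distinct eigenvalues of `Ω(θ)` in increasing order,
numbered from `σ = 0`. -/
def band (V : Interaction d n) (σ : ℕ) (θ : Fin d → ℝ) : ℝ :=
  ((eigenvalueSet V θ).sort (· ≤ ·)).getD σ 0

/-- The spectral projection `Π_σ(θ)`: the orthogonal projection of `ℂⁿ` onto the eigenspace
of `Ω(θ)` for the eigenvalue `ω_σ(θ)`. -/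
def bandProj (V : Interaction d n) (σ : ℕ) (θ : Fin d → ℝ) : Matrix (Fin n) (Fin n) ℂ :=
  (Matrix.toEuclideanCLM (n := Fin n) (𝕜 := ℂ)).symm
    (Module.End.eigenspace (Matrix.toEuclideanLin (Omega V θ)) (band V σ θ : ℂ)).starProjection

/-- The complement of the closed null set `C_*`: the points near which the number of distinct
eigenvalues of `Ω` is constant and the `ω_σ` are real-analytic (then so are the `Π_σ`, and the
multiplicities are locally constant). -/
def regularSet (V : Interaction d n) : Set (Fin d → ℝ) :=
  {θ | (∀ᶠ θ' in 𝓝 θ, eigenvalueCount V θ' = eigenvalueCount V θ) ∧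
    ∀ σ < eigenvalueCount V θ, AnalyticAt ℝ (band V σ) θ}

/-- `∂ω_σ/∂θ_l`. -/
def bandDeriv (V : Interaction d n) (σ : ℕ) (l : Fin d) (θ : Fin d → ℝ) : ℝ :=
  lineDeriv ℝ (band V σ) θ (Pi.single l 1)

/-! ### Conditions on the crystal -/

/-- Exponential decay of the interaction. -/
def CondE1 (V : Interaction d n) : Prop :=
  ∃ C > 0, ∃ γ > 0, ∀ x, ‖V x‖ ≤ C * Real.exp (-γ * latNorm x)

/-- Symmetry `V_{lk}(-x) = V_{kl}(x)`. -/
def CondE2 (V : Interaction d n) : Prop := ∀ x k l, V (-x) l k = V x k l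

/-- `V̂(θ)` is nonnegative definite. -/
def CondE3 (V : Interaction d n) : Prop := ∀ θ, (fourier V θ).PosSemidef

/-- No analytic branch of a derivative `∂ω_σ/∂θ_l` vanishes identically: it does not vanish
identically on a connected component of the complement of `C_*` or, what is the same by
analyticity, on a nonempty open subset of this complement. -/
def CondE4 (V : Interaction d n) : Prop :=
  ∀ (l : Fin d), ∀ σ < bandCount V, ∀ U : Set (Fin d → ℝ), IsOpen U → U.Nonempty →
    U ⊆ regularSet V → ¬ ∀ θ ∈ U, bandDeriv V σ l θ = 0

/-- For `σ ≠ σ'` no analytic branch of `ω_σ ± ω_σ'` is identically equal to a nonzero constant. -/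
def CondE5 (V : Interaction d n) : Prop :=
  ∀ σ < bandCount V, ∀ σ' < bandCount V, σ ≠ σ' → ∀ c : ℝ, c ≠ 0 →
    ∀ U : Set (Fin d → ℝ), IsOpen U → U.Nonempty → U ⊆ regularSet V →
      (¬ ∀ θ ∈ U, band V σ θ + band V σ' θ = c) ∧ (¬ ∀ θ ∈ U, band V σ θ - band V σ' θ = c)

/-- `‖V̂⁻¹‖ ∈ L¹(𝕋^d)`; in particular `V̂(θ)` is invertible for almost all `θ`. -/
def CondE6 (V : Interaction d n) : Prop :=
  (∀ᵐ θ ∂(volume.restrict (torusCell d)), IsUnit (fourier V θ)) ∧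
    IntegrableOn (fun θ => ‖(fourier V θ)⁻¹‖) (torusCell d)

/-! ### Conditions on the initial measure -/

/-- The initial correlations exist and `|Q₀(x, y)| ≤ h(|x - y|)` with an integrable `h`. The values
of `h` matter on the countable set of the lengths `|z|` of lattice vectors only, so that its
integrability is meant to include `∑_z h(|z|) < ∞` (automatic for nonincreasing `h`). -/
def CondS2 (μ : Measure (PhaseSpace d n α)) : Prop :=
  HasSecondMoments μ ∧ ∃ h : ℝ → ℝ,
    IntegrableOn (fun r => r ^ (d - 1) * h r) (Set.Ioi 0) ∧
    Summable (fun z : Lattice d => h (latNorm z)) ∧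
    ∀ x y p q, |correlation μ x y p q| ≤ h (latNorm (x - y))

/-- The number `(-1)^{n_j}`; the label `n_j ∈ {1, 2}` is represented by `n_j - 1 : Fin 2`. -/
def octantSign (i : Fin 2) : ℤ := (-1) ^ ((i : ℕ) + 1)

/-- The initial covariance depends on `x_l - y_l` only for `l > k`, and it is close to `q_𝐧(x - y)`
when all the numbers `(-1)^{n_j} y_j`, `j ≤ k`, are large, where `q_𝐧` is the correlation matrix of a
translation-invariant probability measure with mean zero. -/
def CondS3 {k : ℕ} (hk : k ≤ d) (μ : Measure (PhaseSpace d n α))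
    (q : (Fin k → Fin 2) → Lattice d → BlockMatrix n ℝ) : Prop :=
  (∀ x y h : Lattice d, (∀ l : Fin d, (l : ℕ) < k → h l = 0) →
    correlation μ (x + h) (y + h) = correlation μ x y) ∧
  (∀ (ν : Fin k → Fin 2) (z : Lattice d) (p p' : Fin n ⊕ Fin n), ∀ ε > 0, ∃ N : ℕ,
    ∀ y : Lattice d, (∀ j : Fin k, (N : ℤ) < octantSign (ν j) * y (Fin.castLE hk j)) →
      |correlation μ (y + z) y p p' - q ν z p p'| < ε) ∧
  (∀ ν : Fin k → Fin 2, ∃ μν : Measure (PhaseSpace d n α), IsProbabilityMeasure μν ∧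
    TranslationInvariant μν ∧ ZeroMean μν ∧ HasSecondMoments μν ∧
    ∀ x y, correlation μν x y = q ν (x - y))

/-! ### The limit covariance -/

/-- `C(θ)`. -/
def opC (V : Interaction d n) (θ : Fin d → ℝ) : BlockMatrix n ℂ :=
  Matrix.fromBlocks 0 (Omega V θ)⁻¹ (-Omega V θ) 0

/-- `L₁⁺`, at the point `θ`. -/
def opL1plus (V : Interaction d n) (θ : Fin d → ℝ) (A : BlockMatrix n ℂ) : BlockMatrix n ℂ :=
  (1 / 2 : ℂ) • (A + opC V θ * A * (opC V θ)ᴴ)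

/-- `L₂⁻`, at the point `θ`. -/
def opL2minus (V : Interaction d n) (θ : Fin d → ℝ) (A : BlockMatrix n ℂ) : BlockMatrix n ℂ :=
  (1 / 2 : ℂ) • (opC V θ * A - A * (opC V θ)ᴴ)

/-- The sum of `∏_{p ∈ P} sgn(∂ω_σ/∂θ_p) (-1)^{n_p}` over the `m`-element subsets `P` of
`{1, …, k}`. -/
def signSum {k : ℕ} (hk : k ≤ d) (V : Interaction d n) (σ : ℕ) (θ : Fin d → ℝ)
    (ν : Fin k → Fin 2) (m : ℕ) : ℝ :=
  ∑ P ∈ Finset.powersetCard m (Finset.univ : Finset (Fin k)),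
    ∏ p ∈ P, Real.sign (bandDeriv V σ (Fin.castLE hk p) θ) * (octantSign (ν p) : ℝ)

/-- `S^{even}_{k,𝐧}(ω_σ)`. -/
def signEven {k : ℕ} (hk : k ≤ d) (V : Interaction d n) (σ : ℕ) (θ : Fin d → ℝ)
    (ν : Fin k → Fin 2) : ℝ :=
  ∑ m ∈ (Finset.Icc 1 k).filter Even, signSum hk V σ θ ν m

/-- `S^{odd}_{k,𝐧}(ω_σ)`. -/
def signOdd {k : ℕ} (hk : k ≤ d) (V : Interaction d n) (σ : ℕ) (θ : Fin d → ℝ)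
    (ν : Fin k → Fin 2) : ℝ :=
  ∑ m ∈ (Finset.Icc 1 k).filter Odd, signSum hk V σ θ ν m

/-- `𝐌⁺_{k,σ}(θ)`. -/
def Mplus {k : ℕ} (hk : k ≤ d) (V : Interaction d n)
    (q : (Fin k → Fin 2) → Lattice d → BlockMatrix n ℝ) (σ : ℕ) (θ : Fin d → ℝ) :
    BlockMatrix n ℂ :=
  (1 / 2 ^ k : ℂ) • ∑ ν : Fin k → Fin 2,
    ((1 + signEven hk V σ θ ν : ℝ) : ℂ) • opL1plus V θ (fourier (q ν) θ)

/-- `𝐌⁻_{k,σ}(θ)`. -/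
def Mminus {k : ℕ} (hk : k ≤ d) (V : Interaction d n)
    (q : (Fin k → Fin 2) → Lattice d → BlockMatrix n ℝ) (σ : ℕ) (θ : Fin d → ℝ) :
    BlockMatrix n ℂ :=
  (1 / 2 ^ k : ℂ) • ∑ ν : Fin k → Fin 2,
    (signOdd hk V σ θ ν : ℂ) • opL2minus V θ (fourier (q ν) θ)

/-- `q̂_∞(θ) = ∑_σ Π_σ (𝐌⁺_{k,σ} + i 𝐌⁻_{k,σ}) Π_σ`, with `Π_σ` acting on each of the two
components. -/
def qInfHat {k : ℕ} (hk : k ≤ d) (V : Interaction d n)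
    (q : (Fin k → Fin 2) → Lattice d → BlockMatrix n ℝ) (θ : Fin d → ℝ) : BlockMatrix n ℂ :=
  ∑ σ ∈ Finset.range (bandCount V),
    Matrix.fromBlocks (bandProj V σ θ) 0 0 (bandProj V σ θ) *
      (Mplus hk V q σ θ + Complex.I • Mminus hk V q σ θ) *
      Matrix.fromBlocks (bandProj V σ θ) 0 0 (bandProj V σ θ)

/-- `q_∞(x) = (2π)^{-d} ∫ e^{-i(x,θ)} q̂_∞(θ) dθ`, the integral being over the torus. -/
def qInf {k : ℕ} (hk : k ≤ d) (V : Interaction d n)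
    (q : (Fin k → Fin 2) → Lattice d → BlockMatrix n ℝ) (x : Lattice d) : BlockMatrix n ℂ :=
  Matrix.of fun a b => ((2 * Real.pi : ℝ) : ℂ)⁻¹ ^ d *
    ∫ θ in torusCell d, Complex.exp (-(Complex.I * (pairing x θ : ℝ))) * qInfHat hk V q θ a b

end HarmonicCrystal

end

noncomputable section

namespace HarmonicCrystal

open MeasureTheory Filter Topology
open scoped Matrix Matrix.Norms.L2Operator MatrixOrder ComplexOrder
open scoped ComplexConjugate ENNReal

-- The problem is carried over to waves on the torus. Fix a site and a component of the field at
-- time `t`. The weights with which the initial values at `y` enter there (`greenFunction`) are, as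
-- functions of `y`, the Fourier coefficients of a finite sum of waves `e^{itΦ} a`, one for each
-- mode `(σ, ±)`, with phase `Φ = ±ω_σ` and with an amplitude `a` that does not depend on `t` and is
-- square integrable because of E6 (`CondE1.greenFunction_eq_sum`, `memLp_amplitude`). Hence every
-- entry of `Q_t` is a finite sum of forms `Σ_z Σ_y conj f(y+z) Q₀(y+z,y) g(y)` in such coefficients
-- `f`, `g`. Their `ℓ²` norms are constant in time and S2 bounds `Q₀(y+z,y)` by a summable function
-- of `z`, so the limit may be taken for each `z` separately.
--
-- Transport. By Parseval, the characteristic function of `y_j/t` under the weights `|ĝ(y)|²` is the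
-- correlation of the wave with its translate by `ξ/t`. Since `t(Φ(τ+ξ/t) - Φ(τ)) → ξ ∂_jΦ(τ)`,
-- Lévy's theorem shows that `y_j/t` converges in law to the group velocity `∂_jΦ` under the density
-- `|b|²` given by the amplitude `b` (both up to normalization). A wave whose velocity points
-- strictly into the octant `ν` therefore ends up where `Q₀(y+z,y)` is close to `q_ν(z)`
-- (`tendsto_tsum_halfSpace`, `tendsto_tsum_conj_mul_mul`). E4 makes almost every velocity nonzero
-- in every coordinate, so the weights `octantWeight` split each wave into such pieces.
--
-- Decorrelation. Once `Q₀` is replaced by `q_ν(z)`, the sum over `y` is the integral of `e^{i(z,τ)}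
-- e^{it(Ψ-Φ)} conj(a) b` over the torus. For equal modes it is constant in time. For different
-- modes it tends to zero by a Riemann–Lebesgue lemma, which follows from the same translation by
-- `ξ/t` and needs only that `∇(Ψ-Φ)` vanishes almost nowhere; this is E5 for different bands and E4
-- for the two signs of one band.
--
-- Regularity of the spectral data. The traces of the powers of `V̂` are analytic moments of the
-- squared eigenvalues. Their Hankel determinant is nonzero exactly where the number of distinct
-- eigenvalues is maximal; where moreover `det V̂ ≠ 0`, the eigenvalues are simple zeros of an
-- analytic equation and thus analytic (`analyticAt_band`). A real-analytic function that vanishes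
-- on no open set has a null zero set, so the exceptional points do not matter.
--
-- Algebra. What remains is the sum over the modes and octants of `octantWeight` times `M q̂_ν Mᴴ`,
-- `M` being the matrix of the mode. Adding the two signs gives `q̂_∞`: the even part in the sign
-- produces `L₁⁺` with `S^even`, the odd part `L₂⁻` with `S^odd` (`sum_octantWeight_modeMat`).

local instance unitCircleMeasureSpace : MeasureSpace UnitAddCircle := ⟨AddCircle.haarAddCircle⟩

local instance unitCircleIsAddHaar : Measure.IsAddHaarMeasure (volume : Measure UnitAddCircle) :=
  inferInstanceAs (Measure.IsAddHaarMeasure AddCircle.haarAddCircle)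

local instance unitCircleIsProbability : IsProbabilityMeasure (volume : Measure UnitAddCircle) :=
  inferInstanceAs (IsProbabilityMeasure AddCircle.haarAddCircle)

/-! ### Waves on the torus and the correlation of a wave with its translates -/

section

/-- The torus `(ℝ/ℤ)^d` with its Haar probability measure. -/
abbrev Torus (d : ℕ) : Type := UnitAddTorus (Fin d)

variable {d : ℕ}

theorem hasSum_conj_mFourierCoeff_mul {F G : Torus d → ℂ} (hF : MemLp F 2) (hG : MemLp G 2) :
    HasSum (fun y => conj (UnitAddTorus.mFourierCoeff F y) * UnitAddTorus.mFourierCoeff G y)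
      (∫ τ, conj (F τ) * G τ) := by
  have h := UnitAddTorus.hasSum_prod_mFourierCoeff (hF.toLp F) (hG.toLp G)
  have e1 : ∀ y, UnitAddTorus.mFourierCoeff (hF.toLp F) y = UnitAddTorus.mFourierCoeff F y :=
    fun y => integral_congr_ae <| by
      filter_upwards [hF.coeFn_toLp] with τ hτ
      rw [hτ]
  have e2 : ∀ y, UnitAddTorus.mFourierCoeff (hG.toLp G) y = UnitAddTorus.mFourierCoeff G y :=
    fun y => integral_congr_ae <| by
      filter_upwards [hG.coeFn_toLp] with τ hτ
      rw [hτ]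
  simp only [e1, e2] at h
  convert h using 1
  refine integral_congr_ae ?_
  filter_upwards [hF.coeFn_toLp, hG.coeFn_toLp] with τ h1 h2
  rw [h1, h2]

theorem hasSum_norm_sq_mFourierCoeff {F : Torus d → ℂ} (hF : MemLp F 2) :
    HasSum (fun y => ‖UnitAddTorus.mFourierCoeff F y‖ ^ 2) (∫ τ, ‖F τ‖ ^ 2) := by
  have h := Complex.reCLM.hasSum (hasSum_conj_mFourierCoeff_mul hF hF)
  have e : ∀ z : ℂ, conj z * z = ((‖z‖ ^ 2 : ℝ) : ℂ) := fun z => by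
    rw [Complex.conj_mul']; push_cast; rfl
  simp only [e, integral_complex_ofReal, Complex.reCLM_apply,
    Complex.ofReal_re] at h
  exact h

theorem mFourierCoeff_translate (F : Torus d → ℂ) (h : Torus d) (y : Fin d → ℤ) :
    UnitAddTorus.mFourierCoeff (fun τ => F (τ + h)) y =
      UnitAddTorus.mFourier y h * UnitAddTorus.mFourierCoeff F y := by
  unfold UnitAddTorus.mFourierCoeff
  rw [← integral_const_mul]
  rw [← integral_add_right_eq_self
    (fun τ => UnitAddTorus.mFourier y h * UnitAddTorus.mFourier (-y) τ • F τ) h]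
  refine integral_congr_ae (ae_of_all _ fun τ => ?_)
  have h1 : UnitAddTorus.mFourier (-y) (τ + h) =
      UnitAddTorus.mFourier (-y) τ * UnitAddTorus.mFourier (-y) h := by
    simp only [UnitAddTorus.mFourier, ContinuousMap.coe_mk, Pi.add_apply, ← Finset.prod_mul_distrib]
    refine Finset.prod_congr rfl fun i _ => ?_
    simp [fourier_apply, AddCircle.toCircle_add]
  have h2 : UnitAddTorus.mFourier y h * UnitAddTorus.mFourier (-y) h = 1 := by
    rw [← UnitAddTorus.mFourier_add, add_neg_cancel, UnitAddTorus.mFourier_zero]; rfl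
  simp only [smul_eq_mul, h1]
  linear_combination (-(UnitAddTorus.mFourier (-y) τ * F (τ + h))) * h2

/-- Translation by `h` is composition with a measure-preserving map that depends continuously on
`h`, and such compositions are continuous in `L^p` for finite `p`. -/
theorem tendsto_eLpNorm_translate_sub {p : ℝ≥0∞} [hp1 : Fact (1 ≤ p)] (hp : p ≠ ∞)
    {F : Torus d → ℂ} (hF : MemLp F p) :
    Tendsto (fun h : Torus d => eLpNorm (fun τ => F (τ + h) - F τ) p) (𝓝 0) (𝓝 0) := by
  let g : Torus d → C(Torus d, Torus d) := fun h => ⟨fun τ => τ + h, by fun_prop⟩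
  have hg : Continuous g :=
    (ContinuousMap.mk (fun q : Torus d × Torus d => q.2 + q.1) (by fun_prop)).curry.continuous
  have hm : ∀ h, MeasurePreserving (g h) := fun h => measurePreserving_add_right volume h
  have hT := Tendsto.compMeasurePreservingLp (tendsto_const_nhds (x := hF.toLp F) (f := 𝓝 0))
    (hg.tendsto 0) hm (hm 0) hp
  have h0 : Lp.compMeasurePreserving (g 0) (hm 0) (hF.toLp F) = hF.toLp F := by
    apply Lp.ext
    filter_upwards [Lp.coeFn_compMeasurePreserving (hF.toLp F) (hm 0)] with τ hτ
    rw [hτ]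
    simp [g]
  rw [h0, Lp.tendsto_Lp_iff_tendsto_eLpNorm'] at hT
  refine hT.congr fun h => eLpNorm_congr_ae ?_
  filter_upwards [Lp.coeFn_compMeasurePreserving (hF.toLp F) (hm h), hF.coeFn_toLp,
    (hm h).quasiMeasurePreserving.ae_eq_comp hF.coeFn_toLp] with τ h1 h2 h3
  simp only [Pi.sub_apply, h1, h2]
  congr 1

/-- The displacement of the torus `(ℝ/ℤ)^d` by the angle `r` in the `j`-th direction. -/
def shiftT (j : Fin d) (r : ℝ) : Torus d := Pi.single j ((r / (2 * Real.pi) : ℝ) : UnitAddCircle)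

theorem mFourier_shiftT (y : Fin d → ℤ) (j : Fin d) (r : ℝ) :
    UnitAddTorus.mFourier y (shiftT j r) = Complex.exp (Complex.I * (r * y j : ℝ)) := by
  simp only [UnitAddTorus.mFourier, ContinuousMap.coe_mk, shiftT]
  rw [Finset.prod_eq_single j]
  · rw [Pi.single_eq_same, fourier_coe_apply]
    congr 1
    have := Real.pi_ne_zero
    push_cast
    field_simp
  · intro i _ hij
    rw [Pi.single_eq_of_ne hij]
    simp [fourier_apply]
  · simp

theorem tendsto_shiftT (j : Fin d) {r : ℕ → ℝ} (hr : Tendsto r atTop (𝓝 0)) :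
    Tendsto (fun n => shiftT j (r n)) atTop (𝓝 (0 : Torus d)) := by
  have h : Continuous (fun r : ℝ => (shiftT j r : Torus d)) := by
    unfold shiftT
    refine (continuous_single j).comp ?_
    exact (AddCircle.continuous_mk' (1 : ℝ)).comp (by fun_prop)
  have h0 : (shiftT j 0 : Torus d) = 0 := by simp [shiftT]
  have := (h.tendsto 0).comp hr
  rwa [h0] at this

/-- `D` is the derivative of `Φ` at `τ` in the `j`-th direction, with respect to angles. -/
def HasDirDeriv (Φ : Torus d → ℝ) (j : Fin d) (D : ℝ) (τ : Torus d) : Prop :=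
  Tendsto (fun r : ℝ => (Φ (τ + shiftT j r) - Φ τ) / r) (𝓝[≠] 0) (𝓝 D)

/-- The difference quotient is taken along the steps `r = ξ / t n`; the case `ξ = 0` is separate
because these steps must be nonzero. -/
theorem HasDirDeriv.tendsto_mul {Φ : Torus d → ℝ} {j : Fin d} {D : ℝ} {τ : Torus d}
    (h : HasDirDeriv Φ j D τ) {t : ℕ → ℝ} (ht : Tendsto t atTop atTop) (ξ : ℝ) :
    Tendsto (fun n => t n * (Φ (τ + shiftT j (ξ / t n)) - Φ τ)) atTop (𝓝 (ξ * D)) := by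
  by_cases hξ : ξ = 0
  · simp [hξ, shiftT]
  have h1 : Tendsto (fun n => ξ / t n) atTop (𝓝[≠] 0) := by
    refine tendsto_nhdsWithin_iff.2 ⟨ht.const_div_atTop ξ, ?_⟩
    filter_upwards [ht.eventually_gt_atTop 0] with n hn
    exact div_ne_zero hξ hn.ne'
  refine ((h.comp h1).const_mul ξ).congr' ?_
  filter_upwards [ht.eventually_gt_atTop 0] with n hn
  simp only [Function.comp]
  field_simp

/-- The function `e^{itΦ} F`. -/
def wave (Φ : Torus d → ℝ) (t : ℝ) (F : Torus d → ℂ) (τ : Torus d) : ℂ :=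
  Complex.exp (Complex.I * (t * Φ τ : ℝ)) * F τ

theorem norm_cexp_I_mul (x : ℝ) : ‖Complex.exp (Complex.I * (x : ℂ))‖ = 1 := by
  rw [mul_comm]; exact Complex.norm_exp_ofReal_mul_I x

theorem norm_wave (Φ : Torus d → ℝ) (t : ℝ) (F : Torus d → ℂ) (τ : Torus d) :
    ‖wave Φ t F τ‖ = ‖F τ‖ := by
  rw [wave, norm_mul, norm_cexp_I_mul, one_mul]

theorem aestronglyMeasurable_phase {Φ : Torus d → ℝ} (hΦ : AEStronglyMeasurable Φ volume) (t : ℝ) :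
    AEStronglyMeasurable (fun τ => Complex.exp (Complex.I * (t * Φ τ : ℝ))) volume := by
  have : Continuous fun x : ℝ => Complex.exp (Complex.I * (t * x : ℝ)) := by fun_prop
  exact this.comp_aestronglyMeasurable hΦ

theorem MemLp.wave {p : ℝ≥0∞} {Φ : Torus d → ℝ} (hΦ : AEStronglyMeasurable Φ volume) (t : ℝ)
    {F : Torus d → ℂ} (hF : MemLp F p) : MemLp (wave Φ t F) p :=
  hF.of_le ((aestronglyMeasurable_phase hΦ t).mul hF.1) (ae_of_all _ fun τ => (norm_wave Φ t F τ).le)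

/-- Dominated convergence: the exponentials have modulus one, and a directional derivative almost
everywhere is all the regularity of the phase that is used. -/
theorem tendsto_integral_wave_shift_sub {Φ : Torus d → ℝ} (hΦ : AEStronglyMeasurable Φ volume)
    {j : Fin d} {D : Torus d → ℝ} (hD : ∀ᵐ τ, HasDirDeriv Φ j (D τ) τ) {t : ℕ → ℝ}
    (ht : Tendsto t atTop atTop) (ξ : ℝ) {K : Torus d → ℂ} (hK : Integrable K) :
    Tendsto (fun n => ∫ τ, Complex.exp (Complex.I *
      (t n * (Φ (τ + shiftT j (ξ / t n)) - Φ τ) : ℝ)) * K τ) atTop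
      (𝓝 (∫ τ, Complex.exp (Complex.I * (ξ * D τ : ℝ)) * K τ)) := by
  refine tendsto_integral_of_dominated_convergence (fun τ => ‖K τ‖) (fun n => ?_) hK.norm
    (fun n => ae_of_all _ fun τ => by rw [norm_mul, norm_cexp_I_mul, one_mul]) ?_
  · have hc : Continuous fun x : ℝ => Complex.exp (Complex.I * (t n * x : ℝ)) := by fun_prop
    refine (hc.comp_aestronglyMeasurable (AEStronglyMeasurable.sub ?_ hΦ)).mul hK.1
    exact hΦ.comp_measurePreserving (measurePreserving_add_right volume _)
  · filter_upwards [hD] with τ hτ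
    have hc : Continuous fun x : ℝ => Complex.exp (Complex.I * (x : ℝ)) := by fun_prop
    exact ((hc.tendsto _).comp (hτ.tendsto_mul ht ξ)).mul_const _

/-- The translation acts on the phase and on the amplitude. On the phase it yields `e^{iξD}` in the
limit; on the amplitude it is negligible because translations are continuous in `L²`, so `F` needs
no smoothness. -/
theorem tendsto_integral_conj_wave_mul_shift {Φ : Torus d → ℝ}
    (hΦ : AEStronglyMeasurable Φ volume)
    {j : Fin d} {D : Torus d → ℝ} (hD : ∀ᵐ τ, HasDirDeriv Φ j (D τ) τ) {t : ℕ → ℝ}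
    (ht : Tendsto t atTop atTop) (ξ : ℝ) {F : Torus d → ℂ} (hF : MemLp F 2) :
    Tendsto (fun n => ∫ τ, conj (wave Φ (t n) F τ) * wave Φ (t n) F (τ + shiftT j (ξ / t n)))
      atTop (𝓝 (∫ τ, Complex.exp (Complex.I * (ξ * D τ : ℝ)) * ((‖F τ‖ ^ 2 : ℝ) : ℂ))) := by
  have hFF : Integrable (fun τ => ((‖F τ‖ ^ 2 : ℝ) : ℂ)) (volume : Measure (Torus d)) :=
    ((memLp_two_iff_integrable_sq_norm hF.1).1 hF).ofReal
  have h1 := tendsto_integral_wave_shift_sub hΦ hD ht ξ hFF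
  have hs : Tendsto (fun n => shiftT j (ξ / t n)) atTop (𝓝 (0 : Torus d)) :=
    tendsto_shiftT j (ht.const_div_atTop ξ)
  -- Replacing `F(τ + h)` by `F(τ)` costs at most `‖F‖₂ ‖F(· + h) - F‖₂`, whatever the phase.
  have h2 : Tendsto (fun n => ∫ τ, conj (wave Φ (t n) F τ) *
      (Complex.exp (Complex.I * (t n * Φ (τ + shiftT j (ξ / t n)) : ℝ)) *
        (F (τ + shiftT j (ξ / t n)) - F τ))) atTop (𝓝 0) := by
    have h3 := (tendsto_eLpNorm_translate_sub (p := 2) (by norm_num) hF).comp hs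
    have h4 : Tendsto (fun n => (eLpNorm F 2 volume *
        eLpNorm (fun τ => F (τ + shiftT j (ξ / t n)) - F τ) 2 volume).toReal) atTop (𝓝 0) := by
      have := ENNReal.Tendsto.const_mul h3 (Or.inr hF.2.ne)
      rw [mul_zero] at this
      exact (ENNReal.tendsto_toReal ENNReal.zero_ne_top).comp this
    refine squeeze_zero_norm (fun n => ?_) h4
    have hm : MemLp (fun τ => F (τ + shiftT j (ξ / t n))) 2 volume :=
      hF.comp_measurePreserving (measurePreserving_add_right volume _)
    have hmd : MemLp (fun τ => F (τ + shiftT j (ξ / t n)) - F τ) 2 volume := hm.sub hF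
    have hlt : eLpNorm F 2 volume *
        eLpNorm (fun τ => F (τ + shiftT j (ξ / t n)) - F τ) 2 volume ≠ ∞ :=
      ENNReal.mul_ne_top hF.2.ne hmd.2.ne
    refine (norm_integral_le_lintegral_norm _).trans (ENNReal.toReal_mono hlt ?_)
    have h5 := eLpNorm_smul_le_mul_eLpNorm (p := 2) (q := 2) (r := 1) hmd.1 hF.1
    refine le_trans (le_of_eq ?_) h5
    rw [eLpNorm_one_eq_lintegral_enorm]
    refine lintegral_congr fun τ => ?_
    rw [← ofReal_norm]
    congr 1
    rw [norm_mul, RCLike.norm_conj, norm_wave, norm_mul, norm_cexp_I_mul, one_mul]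
    simp
  have h6 := h2.add h1
  rw [zero_add] at h6
  refine h6.congr fun n => ?_
  have hm : MemLp (fun τ => F (τ + shiftT j (ξ / t n))) 2 volume :=
    hF.comp_measurePreserving (measurePreserving_add_right volume _)
  have hΦm : AEStronglyMeasurable (fun τ => Φ (τ + shiftT j (ξ / t n))) volume :=
      hΦ.comp_measurePreserving (measurePreserving_add_right volume _)
  rw [← integral_add]
  · refine integral_congr_ae (ae_of_all _ fun τ => ?_)
    simp only [wave, map_mul, ← Complex.exp_conj, Complex.conj_I, Complex.conj_ofReal]
    have e1 : Complex.exp (Complex.I * (t n * (Φ (τ + shiftT j (ξ / t n)) - Φ τ) : ℝ)) =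
        Complex.exp (-Complex.I * (t n * Φ τ : ℝ)) *
        Complex.exp (Complex.I * (t n * Φ (τ + shiftT j (ξ / t n)) : ℝ)) := by
      rw [← Complex.exp_add]
      congr 1
      push_cast
      ring
    rw [e1]
    have e2 : ((‖F τ‖ ^ 2 : ℝ) : ℂ) = conj (F τ) * F τ := by
      rw [Complex.conj_mul']; push_cast; rfl
    rw [e2]
    ring
  · refine (MemLp.integrable_mul (p := 2) (q := 2) ((MemLp.wave hΦ (t n) hF).star) ?_)
    refine (hm.sub hF).of_le ((aestronglyMeasurable_phase hΦm (t n)).mul (hm.sub hF).1)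
      (ae_of_all _ fun τ => ?_)
    rw [norm_mul, norm_cexp_I_mul, one_mul]; rfl
  · have hc : Continuous fun x : ℝ => Complex.exp (Complex.I * (t n * x : ℝ)) := by fun_prop
    refine hFF.bdd_mul (hc.comp_aestronglyMeasurable (hΦm.sub hΦ)) (c := 1)
      (ae_of_all _ fun τ => (norm_cexp_I_mul _).le)

/-- Translation by the angle `ξ/t` multiplies the coefficient at `y` by `e^{iξ y_j/t}`, so by
Parseval the sum is the correlation of the wave with its translate. Up to normalization this says
that the characteristic functions of `y_j/t` converge to that of the group velocity. -/
theorem tendsto_tsum_cexp_mul_norm_sq {Φ : Torus d → ℝ} (hΦ : AEStronglyMeasurable Φ volume)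
    {j : Fin d} {D : Torus d → ℝ} (hD : ∀ᵐ τ, HasDirDeriv Φ j (D τ) τ) {t : ℕ → ℝ}
    (ht : Tendsto t atTop atTop) (ξ : ℝ) {F : Torus d → ℂ} (hF : MemLp F 2) :
    Tendsto (fun n => ∑' y : Fin d → ℤ, Complex.exp (Complex.I * (ξ * (y j / t n) : ℝ)) *
      ((‖UnitAddTorus.mFourierCoeff (wave Φ (t n) F) y‖ ^ 2 : ℝ) : ℂ))
      atTop (𝓝 (∫ τ, Complex.exp (Complex.I * (ξ * D τ : ℝ)) * ((‖F τ‖ ^ 2 : ℝ) : ℂ))) := by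
  refine (tendsto_integral_conj_wave_mul_shift hΦ hD ht ξ hF).congr fun n => ?_
  have hw := MemLp.wave hΦ (t n) hF
  have hw' : MemLp (fun τ => wave Φ (t n) F (τ + shiftT j (ξ / t n))) 2 volume :=
    hw.comp_measurePreserving (measurePreserving_add_right volume _)
  rw [← (hasSum_conj_mFourierCoeff_mul hw hw').tsum_eq]
  refine tsum_congr fun y => ?_
  rw [mFourierCoeff_translate, mFourier_shiftT]
  have e2 : ∀ z : ℂ, ((‖z‖ ^ 2 : ℝ) : ℂ) = conj z * z := fun z => by
    rw [Complex.conj_mul']; push_cast; rfl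
  rw [e2, show ξ * (y j / t n) = ξ / t n * y j by ring]
  ring

end

/-! ### Ballistic transport: the law of `y_j / t` tends to the law of the group velocity -/

section

variable {d : ℕ}

/-- Lévy's continuity theorem turns the convergence of characteristic functions into weak
convergence; the portmanteau theorem then bounds the limes superior of the masses of a closed set by
its limit mass. -/
theorem eventually_tsum_indicator_le {ι Ω : Type*} [MeasurableSpace Ω]
    {P : Measure Ω} [IsProbabilityMeasure P] {D : Ω → ℝ} (hD : AEMeasurable D P)
    {w x : ℕ → ι → ℝ} (hw0 : ∀ n i, 0 ≤ w n i) (hw : ∀ n, HasSum (w n) 1)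
    (hchar : ∀ ξ : ℝ, Tendsto (fun n => ∑' i, Complex.exp (Complex.I * (ξ * x n i : ℝ)) * (w n i : ℂ))
      atTop (𝓝 (∫ ω, Complex.exp (Complex.I * (ξ * D ω : ℝ)) ∂P)))
    {B : Set ℝ} (hB : IsClosed B) {ε : ℝ} (hε : P.real (D ⁻¹' B) < ε) :
    ∀ᶠ n in atTop, ∑' i, (x n ⁻¹' B).indicator (w n) i < ε := by
  -- The law of the points `x n i` taken with the probabilities `w n i`.
  let ρ : ℕ → Measure ℝ := fun n =>
    Measure.sum fun i => ENNReal.ofReal (w n i) • Measure.dirac (x n i)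
  have hρ1 : ∀ n, IsProbabilityMeasure (ρ n) := fun n => ⟨by
    simp only [ρ, Measure.sum_apply _ MeasurableSet.univ, Measure.smul_apply, measure_univ,
      smul_eq_mul, mul_one]
    rw [← ENNReal.ofReal_tsum_of_nonneg (hw0 n) (hw n).summable, (hw n).tsum_eq,
      ENNReal.ofReal_one]⟩
  have hPm : IsProbabilityMeasure (P.map D) := Measure.isProbabilityMeasure_map hD
  let M : ℕ → ProbabilityMeasure ℝ := fun n => ⟨ρ n, hρ1 n⟩
  let M₀ : ProbabilityMeasure ℝ := ⟨P.map D, hPm⟩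
  have hT : Tendsto M atTop (𝓝 M₀) := by
    refine ProbabilityMeasure.tendsto_of_tendsto_charFun fun ξ => ?_
    have e0 : charFun (M₀ : Measure ℝ) ξ = ∫ ω, Complex.exp (Complex.I * (ξ * D ω : ℝ)) ∂P := by
      rw [charFun_apply_real]
      change ∫ x, _ ∂(P.map D) = _
      rw [integral_map hD (by fun_prop)]
      refine integral_congr_ae (ae_of_all _ fun ω => ?_)
      simp only
      congr 1
      push_cast
      ring
    rw [e0]
    refine (hchar ξ).congr fun n => ?_
    rw [charFun_apply_real]
    have hc : Continuous fun y : ℝ => Complex.exp (ξ * y * Complex.I) := by fun_prop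
    have hi : Integrable (fun y : ℝ => Complex.exp (ξ * y * Complex.I)) (ρ n) := by
      refine Integrable.of_bound hc.aestronglyMeasurable 1 (ae_of_all _ fun y => ?_)
      rw [← Complex.ofReal_mul, Complex.norm_exp_ofReal_mul_I]
    rw [show (M n : Measure ℝ) = ρ n from rfl, ← (hasSum_integral_measure hi).tsum_eq]
    refine tsum_congr fun i => ?_
    rw [integral_smul_measure, integral_dirac, ENNReal.toReal_ofReal (hw0 n i), Complex.real_smul]
    rw [mul_comm]
    congr 2
    push_cast
    ring
  have hT' : Tendsto (fun n => (M n).toFiniteMeasure) atTop (𝓝 M₀.toFiniteMeasure) :=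
    (ProbabilityMeasure.toFiniteMeasure_continuous.tendsto _).comp hT
  have hlim := FiniteMeasure.limsup_measure_closed_le_of_tendsto hT' hB
  have hlt : (P.map D) B < ENNReal.ofReal ε := by
    rw [Measure.map_apply_of_aemeasurable hD hB.measurableSet]
    rw [ENNReal.lt_ofReal_iff_toReal_lt (measure_ne_top _ _)]
    exact hε
  have hev := eventually_lt_of_limsup_lt (hlim.trans_lt hlt)
  filter_upwards [hev] with n hn
  have hval : ρ n B = ENNReal.ofReal (∑' i, (x n ⁻¹' B).indicator (w n) i) := by
    rw [ENNReal.ofReal_tsum_of_nonneg (fun i => Set.indicator_nonneg (fun _ _ => hw0 n _) _)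
      ((hw n).summable.indicator _)]
    rw [Measure.sum_apply _ hB.measurableSet]
    refine tsum_congr fun i => ?_
    rw [Measure.smul_apply, Measure.dirac_apply' _ hB.measurableSet]
    by_cases h : x n i ∈ B
    · simp [h, Set.indicator]
    · simp [h, Set.indicator]
  have hn' : ρ n B < ENNReal.ofReal ε := hn
  rw [hval] at hn'
  exact (ENNReal.ofReal_lt_ofReal_iff_of_nonneg
    (tsum_nonneg fun i => Set.indicator_nonneg (fun _ _ => hw0 n _) _)).1 hn'

/-- A wave packet leaves the half spaces its group velocity points away from. -/
theorem tendsto_tsum_halfSpace {Φ : Torus d → ℝ} (hΦ : AEStronglyMeasurable Φ volume)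
    {j : Fin d} {D : Torus d → ℝ} (hDm : AEMeasurable D volume)
    (hD : ∀ᵐ τ, HasDirDeriv Φ j (D τ) τ) {t : ℕ → ℝ}
    (ht : Tendsto t atTop atTop) {F : Torus d → ℂ} (hF : MemLp F 2) (o N : ℝ)
    (hsupp : ∀ᵐ τ, F τ ≠ 0 → 0 < o * D τ) :
    Tendsto (fun n => ∑' y : Fin d → ℤ, {y : Fin d → ℤ | o * y j ≤ N}.indicator
      (fun y => ‖UnitAddTorus.mFourierCoeff (wave Φ (t n) F) y‖ ^ 2) y) atTop (𝓝 0) := by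
  set c : ℝ := ∫ τ, ‖F τ‖ ^ 2 with hc
  have hc0 : 0 ≤ c := integral_nonneg fun τ => by positivity
  have hsum : ∀ n, HasSum (fun y => ‖UnitAddTorus.mFourierCoeff (wave Φ (t n) F) y‖ ^ 2) c := by
    intro n
    have := hasSum_norm_sq_mFourierCoeff (MemLp.wave hΦ (t n) hF)
    simpa only [norm_wave] using this
  -- An amplitude of norm zero cannot be normalized to a probability density, but then all its
  -- coefficients vanish.
  rcases hc0.eq_or_lt with h0 | hcpos
  · have : ∀ n y, ‖UnitAddTorus.mFourierCoeff (wave Φ (t n) F) y‖ ^ 2 = 0 := by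
      intro n
      have h1 := hsum n
      rw [← h0] at h1
      exact fun y => congrFun ((hasSum_zero_iff_of_nonneg (fun y => by positivity)).1 h1) y
    simp [this]
  have hFsq : Integrable (fun τ => ‖F τ‖ ^ 2) (volume : Measure (Torus d)) :=
    (memLp_two_iff_integrable_sq_norm hF.1).1 hF
  let P : Measure (Torus d) := volume.withDensity fun τ => ENNReal.ofReal (‖F τ‖ ^ 2 / c)
  have hdm : AEMeasurable (fun τ => ENNReal.ofReal (‖F τ‖ ^ 2 / c)) (volume : Measure (Torus d)) :=
    (hFsq.1.aemeasurable.div_const c).ennreal_ofReal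
  have hP : IsProbabilityMeasure P := ⟨by
    rw [withDensity_apply _ MeasurableSet.univ, Measure.restrict_univ,
      ← ofReal_integral_eq_lintegral_ofReal (hFsq.div_const c)
        (ae_of_all _ fun τ => by positivity), integral_div, div_self hcpos.ne', ENNReal.ofReal_one]⟩
  have hPac : P ≪ volume := withDensity_absolutelyContinuous _ _
  have hPsupp : ∀ᵐ τ ∂P, 0 < o * D τ := by
    rw [ae_withDensity_iff' hdm]
    filter_upwards [hsupp] with τ hτ hne
    apply hτ
    rintro h
    simp [h] at hne
  have hDP : AEMeasurable D P := hDm.mono_ac hPac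
  -- These closed sets decrease to `{o * D ≤ 0}`, which is `P`-null by the support condition.
  -- Thresholds strictly above zero are needed to absorb the error `N / t`.
  have hnull : Tendsto (fun m : ℕ => P.real (D ⁻¹' {x | o * x ≤ 1 / ((m : ℝ) + 1)})) atTop
      (𝓝 0) := by
    have h1 : Tendsto (fun m : ℕ => P (D ⁻¹' {x | o * x ≤ 1 / ((m : ℝ) + 1)})) atTop
        (𝓝 (P (⋂ m : ℕ, D ⁻¹' {x | o * x ≤ 1 / ((m : ℝ) + 1)}))) := by
      refine tendsto_measure_iInter_atTop (fun m => ?_) (fun m m' hm τ hτ => ?_)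
        ⟨0, measure_ne_top _ _⟩
      · exact hDP.nullMeasurableSet_preimage
          (measurableSet_le (measurable_const_mul o) measurable_const)
      · exact le_trans (show o * D τ ≤ _ from hτ) (Nat.one_div_le_one_div hm)
    have h2 : P (⋂ m : ℕ, D ⁻¹' {x | o * x ≤ 1 / ((m : ℝ) + 1)}) = 0 := by
      rw [measure_eq_zero_iff_ae_notMem]
      filter_upwards [hPsupp] with τ hτ hmem
      rw [Set.mem_iInter] at hmem
      obtain ⟨m, hm⟩ := exists_nat_one_div_lt hτ
      exact absurd (hmem m) (not_le.2 hm)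
    rw [h2] at h1
    exact (ENNReal.tendsto_toReal ENNReal.zero_ne_top).comp h1
  rw [Metric.tendsto_atTop']
  intro ε hε
  have hε' : 0 < ε / c := div_pos hε hcpos
  obtain ⟨m, hm⟩ := (hnull.eventually (gt_mem_nhds hε')).exists
  have hev := eventually_tsum_indicator_le (P := P) hDP
    (w := fun n (y : Fin d → ℤ) => ‖UnitAddTorus.mFourierCoeff (wave Φ (t n) F) y‖ ^ 2 / c)
    (x := fun n y => y j / t n) (fun n y => by positivity)
    (fun n => by simpa [div_self hcpos.ne'] using (hsum n).div_const c) (fun ξ => by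
      have h1 := (tendsto_tsum_cexp_mul_norm_sq hΦ hD ht ξ hF).mul_const ((c : ℂ)⁻¹)
      convert h1 using 1
      · funext n
        rw [← tsum_mul_right]
        refine tsum_congr fun y => ?_
        push_cast
        ring
      · congr 1
        change ∫ τ, _ ∂(volume.withDensity _) = _
        rw [integral_withDensity_eq_integral_toReal_smul₀ hdm (ae_of_all _ fun _ => ENNReal.ofReal_lt_top),
          ← integral_mul_const]
        refine integral_congr_ae (ae_of_all _ fun τ => ?_)
        have : 0 ≤ ‖F τ‖ ^ 2 / c := by positivity
        simp only [ENNReal.toReal_ofReal this, Complex.real_smul]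
        push_cast
        ring)
    (isClosed_le (continuous_const_mul o) continuous_const) hm
  -- On the scale of `y / t` the fixed boundary `N` of the half space shrinks to the origin.
  have hev2 : ∀ᶠ n in atTop, N / t n ≤ 1 / ((m : ℝ) + 1) :=
    (ht.const_div_atTop N).eventually (ge_mem_nhds (by positivity))
  have hfin : ∀ᶠ n in atTop, dist (∑' y : Fin d → ℤ, {y : Fin d → ℤ | o * y j ≤ N}.indicator
      (fun y => ‖UnitAddTorus.mFourierCoeff (wave Φ (t n) F) y‖ ^ 2) y) 0 < ε := by
    filter_upwards [hev, hev2, ht.eventually_gt_atTop 0] with n h1 h2 h3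
    have hle : ∑' y : Fin d → ℤ, {y : Fin d → ℤ | o * y j ≤ N}.indicator
        (fun y => ‖UnitAddTorus.mFourierCoeff (wave Φ (t n) F) y‖ ^ 2) y ≤
        c * ∑' y : Fin d → ℤ, ((fun y : Fin d → ℤ => (y j : ℝ) / t n) ⁻¹'
          {x | o * x ≤ 1 / ((m : ℝ) + 1)}).indicator
          (fun y => ‖UnitAddTorus.mFourierCoeff (wave Φ (t n) F) y‖ ^ 2 / c) y := by
      rw [← tsum_mul_left]
      refine Summable.tsum_le_tsum (fun y => ?_) ((hsum n).summable.indicator _)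
        ((((hsum n).summable.div_const c).indicator _).mul_left c)
      by_cases hy : o * y j ≤ N
      · have hy' : o * ((y j : ℝ) / t n) ≤ 1 / ((m : ℝ) + 1) := by
          rw [← mul_div_assoc]
          exact (div_le_div_of_nonneg_right hy h3.le).trans h2
        rw [Set.indicator_of_mem (by exact hy), Set.indicator_of_mem (by exact hy')]
        rw [mul_div_cancel₀ _ hcpos.ne']
      · rw [Set.indicator_of_notMem (by exact hy)]
        exact mul_nonneg hc0 (Set.indicator_nonneg (fun _ _ => by positivity) _)
    have hnn : 0 ≤ ∑' y : Fin d → ℤ, {y : Fin d → ℤ | o * y j ≤ N}.indicator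
        (fun y => ‖UnitAddTorus.mFourierCoeff (wave Φ (t n) F) y‖ ^ 2) y :=
      tsum_nonneg fun y => Set.indicator_nonneg (fun _ _ => by positivity) _
    rw [Real.dist_0_eq_abs, abs_of_nonneg hnn]
    refine hle.trans_lt ?_
    calc c * _ < c * (ε / c) := mul_lt_mul_of_pos_left h1 hcpos
      _ = ε := mul_div_cancel₀ _ hcpos.ne'
  obtain ⟨n₀, h⟩ := eventually_atTop.1 hfin
  exact ⟨n₀, fun n hn => h n hn.le⟩

end

/-! ### The Riemann–Lebesgue lemma -/

section

variable {d : ℕ}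

/-- The integral of `e^{itΦ} F` does not change when its argument is translated by `ξ/t`, while the
translated integrand is `e^{itΦ} e^{iξD} F` up to an error that vanishes in `L¹`. The difference of
the two expressions is the claim. -/
theorem tendsto_integral_wave_one_sub {Φ : Torus d → ℝ} (hΦ : AEStronglyMeasurable Φ volume)
    {j : Fin d} {D : Torus d → ℝ} (hDm : AEMeasurable D volume)
    (hD : ∀ᵐ τ, HasDirDeriv Φ j (D τ) τ) {t : ℕ → ℝ}
    (ht : Tendsto t atTop atTop) (ξ : ℝ) {F : Torus d → ℂ} (hF : Integrable F) :
    Tendsto (fun n => ∫ τ, wave Φ (t n)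
      (fun τ => (1 - Complex.exp (Complex.I * (ξ * D τ : ℝ))) * F τ) τ) atTop (𝓝 0) := by
  have hs : Tendsto (fun n => shiftT j (ξ / t n)) atTop (𝓝 (0 : Torus d)) :=
    tendsto_shiftT j (ht.const_div_atTop ξ)
  have hF1 : MemLp F 1 := memLp_one_iff_integrable.2 hF
  have hc1 : ∀ s : ℝ, Continuous fun x : ℝ => Complex.exp (Complex.I * (s * x : ℝ)) :=
    fun s => by fun_prop
  have hΦm : ∀ h : Torus d, AEStronglyMeasurable (fun τ => Φ (τ + h)) volume := fun h =>
    hΦ.comp_measurePreserving (measurePreserving_add_right volume h)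
  have hFm : ∀ h : Torus d, Integrable (fun τ => F (τ + h)) volume := fun h => hF.comp_add_right h
  have h1 : Tendsto (fun n => ∫ τ, Complex.exp (Complex.I * (t n * Φ (τ + shiftT j (ξ / t n)) : ℝ)) *
      (F (τ + shiftT j (ξ / t n)) - F τ)) atTop (𝓝 0) := by
    have h3 := (tendsto_eLpNorm_translate_sub (p := 1) (by norm_num) hF1).comp hs
    refine squeeze_zero_norm (fun n => ?_) ((ENNReal.tendsto_toReal ENNReal.zero_ne_top).comp h3)
    have hfin : eLpNorm (fun τ => F (τ + shiftT j (ξ / t n)) - F τ) 1 volume ≠ ∞ :=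
      (memLp_one_iff_integrable.2 ((hFm _).sub hF)).2.ne
    refine (norm_integral_le_lintegral_norm _).trans (ENNReal.toReal_mono hfin ?_)
    simp only [Function.comp, eLpNorm_one_eq_lintegral_enorm]
    refine le_of_eq (lintegral_congr fun τ => ?_)
    rw [norm_mul, norm_cexp_I_mul, one_mul, ofReal_norm]
  have h2 : Tendsto (fun n => ∫ τ, wave Φ (t n) (fun τ => (Complex.exp (Complex.I *
      (t n * (Φ (τ + shiftT j (ξ / t n)) - Φ τ) : ℝ)) -
        Complex.exp (Complex.I * (ξ * D τ : ℝ))) * F τ) τ) atTop (𝓝 0) := by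
    have h3 : Tendsto (fun n => ∫ τ, ‖(Complex.exp (Complex.I *
        (t n * (Φ (τ + shiftT j (ξ / t n)) - Φ τ) : ℝ)) -
        Complex.exp (Complex.I * (ξ * D τ : ℝ))) * F τ‖) atTop
        (𝓝 (∫ _ : Torus d, (0 : ℝ))) := by
      refine tendsto_integral_of_dominated_convergence (fun τ => 2 * ‖F τ‖) (fun n => ?_)
        (hF.norm.const_mul 2) (fun n => ae_of_all _ fun τ => ?_) ?_
      · exact ((((hc1 _).comp_aestronglyMeasurable ((hΦm _).sub hΦ)).sub
          ((hc1 ξ).comp_aestronglyMeasurable hDm.aestronglyMeasurable)).mul hF.1).norm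
      · rw [norm_norm, norm_mul]
        refine mul_le_mul_of_nonneg_right ((norm_sub_le _ _).trans ?_) (norm_nonneg _)
        rw [norm_cexp_I_mul, norm_cexp_I_mul]
        norm_num
      · filter_upwards [hD] with τ hτ
        have hc : Continuous fun x : ℝ => ‖(Complex.exp (Complex.I * (x : ℝ)) -
          Complex.exp (Complex.I * (ξ * D τ : ℝ))) * F τ‖ := by fun_prop
        have := (hc.tendsto _).comp (hτ.tendsto_mul ht ξ)
        simp only [sub_self, zero_mul, norm_zero] at this
        exact this
    rw [integral_zero] at h3
    refine squeeze_zero_norm (fun n => (norm_integral_le_integral_norm _).trans (le_of_eq ?_)) h3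
    simp only [norm_wave]
  have h4 := h1.add h2
  rw [zero_add] at h4
  refine h4.congr fun n => ?_
  set h := shiftT j (ξ / t n)
  have i1 : Integrable (fun τ => wave Φ (t n) F (τ + h)) :=
    (memLp_one_iff_integrable.1 (MemLp.wave hΦ (t n) hF1)).comp_add_right h
  have i2 : Integrable (fun τ => Complex.exp (Complex.I * (t n * Φ (τ + h) : ℝ)) * F τ) :=
    hF.bdd_mul ((hc1 _).comp_aestronglyMeasurable (hΦm h)) (c := 1)
      (ae_of_all _ fun τ => (norm_cexp_I_mul _).le)
  have i3 : Integrable (fun τ => Complex.exp (Complex.I * (ξ * D τ : ℝ)) * F τ) :=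
    hF.bdd_mul ((hc1 _).comp_aestronglyMeasurable hDm.aestronglyMeasurable) (c := 1)
      (ae_of_all _ fun τ => (norm_cexp_I_mul _).le)
  have i4 : Integrable (fun τ => wave Φ (t n)
      (fun τ => Complex.exp (Complex.I * (ξ * D τ : ℝ)) * F τ) τ) :=
    memLp_one_iff_integrable.1 (MemLp.wave hΦ (t n) (memLp_one_iff_integrable.2 i3))
  have i5 : Integrable (wave Φ (t n) F) :=
    memLp_one_iff_integrable.1 (MemLp.wave hΦ (t n) hF1)
  have e1 : ∫ τ, Complex.exp (Complex.I * (t n * Φ (τ + h) : ℝ)) * (F (τ + h) - F τ) =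
      (∫ τ, wave Φ (t n) F (τ + h)) -
      ∫ τ, Complex.exp (Complex.I * (t n * Φ (τ + h) : ℝ)) * F τ := by
    rw [← integral_sub i1 i2]
    simp only [wave, mul_sub]
  have e2 : ∫ τ, wave Φ (t n) (fun τ => (Complex.exp (Complex.I *
      (t n * (Φ (τ + h) - Φ τ) : ℝ)) - Complex.exp (Complex.I * (ξ * D τ : ℝ))) * F τ) τ =
      (∫ τ, Complex.exp (Complex.I * (t n * Φ (τ + h) : ℝ)) * F τ) -
      ∫ τ, wave Φ (t n) (fun τ => Complex.exp (Complex.I * (ξ * D τ : ℝ)) * F τ) τ := by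
    rw [← integral_sub i2 i4]
    refine integral_congr_ae (ae_of_all _ fun τ => ?_)
    simp only [wave]
    have : Complex.exp (Complex.I * (t n * Φ (τ + h) : ℝ)) =
        Complex.exp (Complex.I * (t n * Φ τ : ℝ)) *
        Complex.exp (Complex.I * (t n * (Φ (τ + h) - Φ τ) : ℝ)) := by
      rw [← Complex.exp_add]
      congr 1
      push_cast
      ring
    rw [this]
    ring
  have e3 : ∫ τ, wave Φ (t n) (fun τ => (1 - Complex.exp (Complex.I * (ξ * D τ : ℝ))) * F τ) τ =
      (∫ τ, wave Φ (t n) F τ) -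
      ∫ τ, wave Φ (t n) (fun τ => Complex.exp (Complex.I * (ξ * D τ : ℝ)) * F τ) τ := by
    rw [← integral_sub i5 i4]
    refine integral_congr_ae (ae_of_all _ fun τ => ?_)
    simp only [wave]
    ring
  rw [e1, e2, e3, integral_add_right_eq_self (wave Φ (t n) F) h]
  ring

/-- `|1 - e^{ix}| = 2 |sin (x/2)|`, and Jordan's inequality bounds the sine from below. -/
theorem norm_one_sub_cexp_ge {x : ℝ} (hx : |x| ≤ 1) :
    2 / Real.pi * |x| ≤ ‖1 - Complex.exp (Complex.I * (x : ℝ))‖ := by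
  rw [norm_sub_rev, Complex.norm_exp_I_mul_ofReal_sub_one, norm_mul, Real.norm_eq_abs,
    Real.norm_eq_abs, Real.abs_sin_eq_sin_abs_of_abs_le_pi]
  · have h := Real.mul_le_sin (x := |x / 2|) (abs_nonneg _) (by
      rw [abs_div, abs_two]; nlinarith [Real.pi_gt_three])
    rw [abs_div, abs_two] at *
    linarith
  · rw [abs_div, abs_two]; nlinarith [Real.pi_gt_three]

/-- Apply `tendsto_integral_wave_one_sub` to `F / (1 - e^{iξD})`. The division is legitimate where
`|D|` lies between two positive bounds; the rest of `F` is small in `L¹`. -/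
theorem tendsto_integral_wave_of_ne {Φ : Torus d → ℝ} (hΦ : AEStronglyMeasurable Φ volume)
    {j : Fin d} {D : Torus d → ℝ} (hDm : AEMeasurable D volume)
    (hD : ∀ᵐ τ, HasDirDeriv Φ j (D τ) τ) {t : ℕ → ℝ}
    (ht : Tendsto t atTop atTop) {F : Torus d → ℂ} (hF : Integrable F)
    (hsupp : ∀ᵐ τ, F τ ≠ 0 → D τ ≠ 0) :
    Tendsto (fun n => ∫ τ, wave Φ (t n) F τ) atTop (𝓝 0) := by
  let S : ℕ → Set (Torus d) := fun m => D ⁻¹' {x | 1 / ((m : ℝ) + 1) ≤ |x| ∧ |x| ≤ (m : ℝ) + 1}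
  have hSm : ∀ m, NullMeasurableSet (S m) := fun m =>
    hDm.nullMeasurableSet_preimage ((measurableSet_le measurable_const measurable_norm).inter
      (measurableSet_le measurable_norm measurable_const))
  have hFS : ∀ m, Integrable ((S m).indicator F) := fun m => hF.indicator₀ (hSm m)
  have hsmall : Tendsto (fun m => ∫ τ, ‖F τ - (S m).indicator F τ‖) atTop (𝓝 0) := by
    rw [show (0 : ℝ) = ∫ _ : Torus d, (0 : ℝ) by simp]
    refine tendsto_integral_of_dominated_convergence (fun τ => ‖F τ‖)
      (fun m => (hF.1.sub (hFS m).1).norm) hF.norm (fun m => ae_of_all _ fun τ => ?_) ?_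
    · rw [norm_norm]
      by_cases h : τ ∈ S m <;> simp [h]
    · filter_upwards [hsupp] with τ hτ
      refine tendsto_const_nhds.congr' ?_
      by_cases h0 : F τ = 0
      · exact Eventually.of_forall fun m => by simp [Set.indicator, h0]
      have hD0 := abs_pos.2 (hτ h0)
      have ev1 : ∀ᶠ m : ℕ in atTop, 1 / ((m : ℝ) + 1) ≤ |D τ| :=
        tendsto_one_div_add_atTop_nhds_zero_nat.eventually (ge_mem_nhds hD0)
      have ev2 : ∀ᶠ m : ℕ in atTop, |D τ| ≤ (m : ℝ) := tendsto_natCast_atTop_atTop.eventually_ge_atTop _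
      filter_upwards [ev1, ev2] with m h1 h2
      have : τ ∈ S m := ⟨h1, by linarith⟩
      simp [this]
  have happ : ∀ m, Tendsto (fun n => ∫ τ, wave Φ (t n) ((S m).indicator F) τ) atTop (𝓝 0) := by
    intro m
    have hm0 : (0 : ℝ) < (m : ℝ) + 1 := by positivity
    -- The choice `ξ = 1/(m+1)` gives `|ξ D| ≤ 1` on `S m`, so that `norm_one_sub_cexp_ge` applies
    -- and `E` is bounded away from zero there.
    let E : Torus d → ℂ := fun τ => 1 - Complex.exp (Complex.I * (1 / ((m : ℝ) + 1) * D τ : ℝ))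
    have hEge : ∀ τ ∈ S m, 2 / Real.pi * (1 / ((m : ℝ) + 1) * (1 / ((m : ℝ) + 1))) ≤ ‖E τ‖ := by
      rintro τ ⟨h1, h2⟩
      have habs : |1 / ((m : ℝ) + 1) * D τ| = 1 / ((m : ℝ) + 1) * |D τ| := by
        rw [abs_mul, abs_of_pos (by positivity : (0 : ℝ) < 1 / ((m : ℝ) + 1))]
      have := norm_one_sub_cexp_ge (x := 1 / ((m : ℝ) + 1) * D τ) (by
        rw [habs, one_div_mul_eq_div]; exact (div_le_one hm0).2 h2)
      refine le_trans ?_ this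
      rw [habs]
      have := Real.pi_pos
      gcongr
    have hEpos : (0 : ℝ) < 2 / Real.pi * (1 / ((m : ℝ) + 1) * (1 / ((m : ℝ) + 1))) := by
      have := Real.pi_pos
      positivity
    have hEm : AEStronglyMeasurable E volume := by
      have hc : Continuous fun x : ℝ => 1 - Complex.exp (Complex.I * (1 / ((m : ℝ) + 1) * x : ℝ)) := by
        fun_prop
      exact hc.comp_aestronglyMeasurable hDm.aestronglyMeasurable
    let F' : Torus d → ℂ := fun τ => (E τ)⁻¹ * (S m).indicator F τ
    have hF' : Integrable F' := by
      refine ((hFS m).norm.const_mul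
        (2 / Real.pi * (1 / ((m : ℝ) + 1) * (1 / ((m : ℝ) + 1))))⁻¹).mono'
        ((hEm.aemeasurable.inv.aestronglyMeasurable).mul (hFS m).1) (ae_of_all _ fun τ => ?_)
      rw [norm_mul, norm_inv]
      by_cases h : τ ∈ S m
      · gcongr
        exact hEge τ h
      · simp [h]
    refine (tendsto_integral_wave_one_sub hΦ hDm hD ht (1 / ((m : ℝ) + 1)) hF').congr fun n => ?_
    refine integral_congr_ae (ae_of_all _ fun τ => ?_)
    simp only [wave]
    congr 1
    by_cases h : τ ∈ S m
    · have : E τ ≠ 0 := norm_pos_iff.1 (hEpos.trans_le (hEge τ h))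
      change E τ * ((E τ)⁻¹ * _) = _
      rw [mul_inv_cancel_left₀ this]
    · simp [F', h]
  rw [Metric.tendsto_atTop']
  intro ε hε
  obtain ⟨m, hm⟩ := (hsmall.eventually (gt_mem_nhds (half_pos hε))).exists
  obtain ⟨n₀, hn₀⟩ := Metric.tendsto_atTop'.1 (happ m) (ε / 2) (half_pos hε)
  refine ⟨n₀, fun n hn => ?_⟩
  have h1 := hn₀ n hn
  rw [dist_zero_right] at h1 ⊢
  have i5 : ∀ {K : Torus d → ℂ}, Integrable K → Integrable (wave Φ (t n) K) := fun hK =>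
    memLp_one_iff_integrable.1 (MemLp.wave hΦ (t n) (memLp_one_iff_integrable.2 hK))
  have h2 : (∫ τ, wave Φ (t n) F τ) = (∫ τ, wave Φ (t n) ((S m).indicator F) τ) +
      ∫ τ, wave Φ (t n) (fun τ => F τ - (S m).indicator F τ) τ := by
    have i6 : Integrable (fun τ => F τ - (S m).indicator F τ) := hF.sub (hFS m)
    rw [← integral_add (i5 (hFS m)) (i5 i6)]
    refine integral_congr_ae (ae_of_all _ fun τ => ?_)
    simp only [wave]
    ring
  rw [h2]
  have h3 : ‖∫ τ, wave Φ (t n) (fun τ => F τ - (S m).indicator F τ) τ‖ ≤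
      ∫ τ, ‖F τ - (S m).indicator F τ‖ := by
    refine (norm_integral_le_integral_norm _).trans (le_of_eq ?_)
    simp only [norm_wave]
  exact (norm_add_le _ _).trans_lt (by linarith)

/-- A Riemann–Lebesgue lemma for phases whose gradient vanishes almost nowhere. -/
theorem tendsto_integral_wave_zero {Φ : Torus d → ℝ} (hΦ : AEStronglyMeasurable Φ volume)
    {D : Fin d → Torus d → ℝ} (hDm : ∀ j, AEMeasurable (D j) volume)
    (hD : ∀ j, ∀ᵐ τ, HasDirDeriv Φ j (D j τ) τ) {t : ℕ → ℝ}
    (ht : Tendsto t atTop atTop) {F : Torus d → ℂ} (hF : Integrable F)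
    (hne : ∀ᵐ τ, ∃ j, D j τ ≠ 0) :
    Tendsto (fun n => ∫ τ, wave Φ (t n) F τ) atTop (𝓝 0) := by
  -- `A j` collects the points where `j` is the first direction with nonzero derivative. These sets
  -- are disjoint and cover almost everything, and each is settled by a single derivative.
  let A : Fin d → Set (Torus d) := fun j => {τ | D j τ ≠ 0} \ ⋃ i : Fin d, ⋃ _ : i < j, {τ | D i τ ≠ 0}
  have hm0 : ∀ j, NullMeasurableSet {τ | D j τ ≠ 0} volume := fun j =>
    (hDm j).nullMeasurableSet_preimage (measurableSet_singleton 0).compl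
  have hAm : ∀ j, NullMeasurableSet (A j) volume := fun j =>
    (hm0 j).diff (NullMeasurableSet.iUnion fun i => NullMeasurableSet.iUnion fun _ => hm0 i)
  have hsum : ∀ᵐ τ, F τ = ∑ j, (A j).indicator F τ := by
    filter_upwards [hne] with τ hτ
    classical
    obtain ⟨j, hj, hmin⟩ := (Set.toFinite {j | D j τ ≠ 0}).exists_minimal hτ
    rw [Finset.sum_eq_single j]
    · rw [Set.indicator_of_mem]
      refine ⟨hj, ?_⟩
      simp only [Set.mem_iUnion, not_exists]
      intro i hi h
      exact absurd (hmin h hi.le) (not_le.2 hi)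
    · intro i _ hij
      refine Set.indicator_of_notMem ?_ _
      rintro ⟨h1, h2⟩
      rcases lt_or_gt_of_ne hij with h | h
      · exact absurd (hmin h1 h.le) (not_le.2 h)
      · exact h2 (Set.mem_iUnion.2 ⟨j, Set.mem_iUnion.2 ⟨h, hj⟩⟩)
    · simp
  have hA : ∀ j, Tendsto (fun n => ∫ τ, wave Φ (t n) ((A j).indicator F) τ) atTop (𝓝 0) :=
    fun j => tendsto_integral_wave_of_ne hΦ (hDm j) (hD j) ht (hF.indicator₀ (hAm j))
      (ae_of_all _ fun τ h => by
        by_contra h0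
        exact h (Set.indicator_of_notMem (fun hm => hm.1 h0) _))
  have hS := tendsto_finsetSum Finset.univ fun j _ => hA j
  rw [Finset.sum_const_zero] at hS
  refine hS.congr fun n => ?_
  rw [← integral_finsetSum _ fun j _ => memLp_one_iff_integrable.1
    (MemLp.wave hΦ (t n) (memLp_one_iff_integrable.2 (hF.indicator₀ (hAm j))))]
  refine integral_congr_ae ?_
  filter_upwards [hsum] with τ hτ
  simp only [wave]
  rw [← Finset.mul_sum, ← hτ]

end

/-! ### Forms with a kernel that becomes translation invariant in each octant -/

section

variable {d k : ℕ}

/-- The multiplier `r` is small deep inside the octant, and outside it some coordinate lies in a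
half space that the wave leaves. The sequences `f n` need only have a constant `ℓ²` norm. -/
theorem tendsto_tsum_conj_mul_mul (hk : k ≤ d) (ν : Fin k → Fin 2)
    {ψ : Torus d → ℝ} (hψ : AEStronglyMeasurable ψ volume)
    {D : Fin d → Torus d → ℝ} (hDm : ∀ j, AEMeasurable (D j) volume)
    (hD : ∀ j, ∀ᵐ τ, HasDirDeriv ψ j (D j τ) τ) {t : ℕ → ℝ}
    (ht : Tendsto t atTop atTop) {b : Torus d → ℂ} (hb : MemLp b 2)
    (hsupp : ∀ᵐ τ, b τ ≠ 0 → ∀ j : Fin k, 0 < (octantSign (ν j) : ℝ) * D (Fin.castLE hk j) τ)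
    {f : ℕ → Lattice d → ℂ} {A : ℝ} (hf : ∀ n, HasSum (fun y => ‖f n y‖ ^ 2) A)
    {r : Lattice d → ℂ} {C : ℝ} (hrC : ∀ y, ‖r y‖ ≤ C)
    (hr : ∀ ε > 0, ∃ N : ℕ, ∀ y : Lattice d,
      (∀ j : Fin k, (N : ℤ) < octantSign (ν j) * y (Fin.castLE hk j)) → ‖r y‖ < ε) :
    Tendsto (fun n => ∑' y, conj (f n y) * r y * UnitAddTorus.mFourierCoeff (wave ψ (t n) b) y)
      atTop (𝓝 0) := by
  set g : ℕ → Lattice d → ℂ := fun n y => UnitAddTorus.mFourierCoeff (wave ψ (t n) b) y with hg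
  set B : ℝ := ∫ τ, ‖b τ‖ ^ 2 with hB
  have hgs : ∀ n, HasSum (fun y => ‖g n y‖ ^ 2) B := fun n => by
    have := hasSum_norm_sq_mFourierCoeff (MemLp.wave hψ (t n) hb)
    simpa only [norm_wave] using this
  have hA0 : 0 ≤ A := (hf 0).nonneg fun y => by positivity
  have hB0 : 0 ≤ B := (hgs 0).nonneg fun y => by positivity
  rw [Metric.tendsto_atTop']
  intro ε₀ hε₀
  -- `η` is the weight in `uv ≤ η u² + v²/(4η)`. It makes the part with `f` at most `ε₀/3`, the
  -- bound `ε` of `r` below does the same for the part inside the octant, and the half spaces get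
  -- the last third. Adding `1` to `A` and `B` keeps the denominators positive.
  obtain ⟨η, hη, hηA⟩ : ∃ η > 0, η * A ≤ ε₀ / 3 := by
    refine ⟨ε₀ / (3 * (A + 1)), by positivity, ?_⟩
    rw [div_mul_eq_mul_div, div_le_div_iff₀ (by positivity) (by positivity)]
    nlinarith
  obtain ⟨ε, hε, hεB⟩ : ∃ ε > 0, (4 * η)⁻¹ * (ε ^ 2 * B) ≤ ε₀ / 3 := by
    refine ⟨√(ε₀ * (4 * η) / (3 * (B + 1))), by positivity, ?_⟩
    rw [Real.sq_sqrt (by positivity), inv_mul_le_iff₀ (by positivity), div_mul_eq_mul_div,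
      div_le_iff₀ (by positivity)]
    have : 0 ≤ ε₀ * (4 * η) := by positivity
    nlinarith
  obtain ⟨N, hN⟩ := hr ε hε
  let H : ℕ → Fin k → Lattice d → ℝ := fun n j =>
    {y : Fin d → ℤ | (octantSign (ν j) : ℝ) * y (Fin.castLE hk j) ≤ N}.indicator
      (fun y => ‖g n y‖ ^ 2)
  have hHs : ∀ n j, Summable (H n j) := fun n j => (hgs n).summable.indicator _
  have hH0 : ∀ n j y, 0 ≤ H n j y := fun n j y => Set.indicator_nonneg (fun _ _ => by positivity) _
  have hHlim : Tendsto (fun n => (4 * η)⁻¹ * (C ^ 2 * ∑ j, ∑' y, H n j y)) atTop (𝓝 0) := by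
    have h1 : Tendsto (fun n => ∑ j, ∑' y, H n j y) atTop (𝓝 (∑ j : Fin k, 0)) := by
      refine tendsto_finsetSum _ fun j _ => ?_
      refine tendsto_tsum_halfSpace hψ (hDm _) (hD _) ht hb (octantSign (ν j) : ℝ) N ?_
      filter_upwards [hsupp] with τ hτ h0 using hτ h0 j
    have h2 := (h1.const_mul (C ^ 2)).const_mul (4 * η)⁻¹
    simpa using h2
  have hpt : ∀ n y, ‖conj (f n y) * r y * g n y‖ ≤
      η * ‖f n y‖ ^ 2 + (4 * η)⁻¹ * (ε ^ 2 * ‖g n y‖ ^ 2 + C ^ 2 * ∑ j, H n j y) := by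
    intro n y
    rw [norm_mul, norm_mul, RCLike.norm_conj]
    -- Either `y` is deep in the octant, where `‖r y‖ < ε`, or some coordinate is at most `N` in the
    -- direction of the octant and the corresponding `H n j y` carries the full weight.
    have hr2 : (‖r y‖ * ‖g n y‖) ^ 2 ≤ ε ^ 2 * ‖g n y‖ ^ 2 + C ^ 2 * ∑ j, H n j y := by
      rw [mul_pow]
      by_cases hy : ∀ j : Fin k, (N : ℤ) < octantSign (ν j) * y (Fin.castLE hk j)
      · have h1 : ‖r y‖ ^ 2 ≤ ε ^ 2 := pow_le_pow_left₀ (norm_nonneg _) (hN y hy).le 2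
        have h2 : 0 ≤ C ^ 2 * ∑ j, H n j y :=
          mul_nonneg (sq_nonneg _) (Finset.sum_nonneg fun j _ => hH0 n j y)
        nlinarith [mul_le_mul_of_nonneg_right h1 (sq_nonneg ‖g n y‖)]
      · push Not at hy
        obtain ⟨j, hj⟩ := hy
        have h1 : ‖r y‖ ^ 2 ≤ C ^ 2 := pow_le_pow_left₀ (norm_nonneg _) (hrC y) 2
        have h3 : H n j y = ‖g n y‖ ^ 2 := by
          refine Set.indicator_of_mem ?_ _
          change (octantSign (ν j) : ℝ) * y (Fin.castLE hk j) ≤ N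
          exact_mod_cast hj
        have h2 : ‖g n y‖ ^ 2 ≤ ∑ j, H n j y := by
          rw [← h3]
          exact Finset.single_le_sum (f := fun j => H n j y) (fun j _ => hH0 n j y)
            (Finset.mem_univ j)
        have h4 : 0 ≤ ε ^ 2 * ‖g n y‖ ^ 2 := by positivity
        have h5 := mul_le_mul h1 h2 (by positivity) (sq_nonneg C)
        linarith
    have h6 : ‖f n y‖ * (‖r y‖ * ‖g n y‖) ≤
        η * ‖f n y‖ ^ 2 + (4 * η)⁻¹ * (‖r y‖ * ‖g n y‖) ^ 2 := by
      have h7 : 0 ≤ (4 * η)⁻¹ * (2 * η * ‖f n y‖ - ‖r y‖ * ‖g n y‖) ^ 2 := by positivity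
      have h8 : (4 * η)⁻¹ * (2 * η * ‖f n y‖ - ‖r y‖ * ‖g n y‖) ^ 2 =
        η * ‖f n y‖ ^ 2 + (4 * η)⁻¹ * (‖r y‖ * ‖g n y‖) ^ 2 - ‖f n y‖ * (‖r y‖ * ‖g n y‖) := by
        field_simp
        ring
      linarith
    rw [mul_assoc]
    refine h6.trans ?_
    gcongr
  have hbig : ∀ n, HasSum (fun y => η * ‖f n y‖ ^ 2 +
      (4 * η)⁻¹ * (ε ^ 2 * ‖g n y‖ ^ 2 + C ^ 2 * ∑ j, H n j y))
      (η * A + (4 * η)⁻¹ * (ε ^ 2 * B + C ^ 2 * ∑ j, ∑' y, H n j y)) := fun n =>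
    ((hf n).mul_left η).add ((((hgs n).mul_left _).add
      ((hasSum_sum fun j _ => (hHs n j).hasSum).mul_left _)).mul_left _)
  obtain ⟨n₀, hn₀⟩ := Metric.tendsto_atTop'.1 hHlim (ε₀ / 3) (by positivity)
  refine ⟨n₀, fun n hn => ?_⟩
  have h1 := hn₀ n hn
  rw [Real.dist_0_eq_abs] at h1
  have h2 := (abs_lt.1 h1).2
  rw [dist_zero_right]
  refine (tsum_of_norm_bounded (hbig n) (hpt n)).trans_lt ?_
  rw [mul_add]
  linarith

theorem summable_conj_mul_mul {f g : Lattice d → ℂ} (hf : Summable fun y => ‖f y‖ ^ 2)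
    (hg : Summable fun y => ‖g y‖ ^ 2) {m : Lattice d → ℂ} {C : ℝ} (hm : ∀ y, ‖m y‖ ≤ C) :
    Summable fun y => conj (f y) * m y * g y := by
  refine Summable.of_norm_bounded (g := fun y => C * (‖f y‖ ^ 2 + ‖g y‖ ^ 2))
    ((hf.add hg).mul_left C) fun y => ?_
  rw [norm_mul, norm_mul, RCLike.norm_conj]
  have h0 : 0 ≤ C := (norm_nonneg _).trans (hm y)
  have h1 : ‖f y‖ * ‖g y‖ ≤ ‖f y‖ ^ 2 + ‖g y‖ ^ 2 := by
    nlinarith [sq_nonneg (‖f y‖ - ‖g y‖), sq_nonneg ‖f y‖, sq_nonneg ‖g y‖]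
  calc ‖f y‖ * ‖m y‖ * ‖g y‖ = ‖m y‖ * (‖f y‖ * ‖g y‖) := by ring
    _ ≤ C * (‖f y‖ ^ 2 + ‖g y‖ ^ 2) := mul_le_mul (hm y) h1 (by positivity) h0

theorem norm_tsum_conj_mul_mul_le {f g : Lattice d → ℂ} {A B : ℝ}
    (hf : HasSum (fun y => ‖f y‖ ^ 2) A)
    (hg : HasSum (fun y => ‖g y‖ ^ 2) B) {m : Lattice d → ℂ} {C : ℝ} (hm : ∀ y, ‖m y‖ ≤ C) :
    ‖∑' y, conj (f y) * m y * g y‖ ≤ C * (A + B) := by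
  refine tsum_of_norm_bounded ((hf.add hg).mul_left C) fun y => ?_
  rw [norm_mul, norm_mul, RCLike.norm_conj]
  have h0 : 0 ≤ C := (norm_nonneg _).trans (hm y)
  have h1 : ‖f y‖ * ‖g y‖ ≤ ‖f y‖ ^ 2 + ‖g y‖ ^ 2 := by
    nlinarith [sq_nonneg (‖f y‖ - ‖g y‖), sq_nonneg ‖f y‖, sq_nonneg ‖g y‖]
  calc ‖f y‖ * ‖m y‖ * ‖g y‖ = ‖m y‖ * (‖f y‖ * ‖g y‖) := by ring
    _ ≤ C * (‖f y‖ ^ 2 + ‖g y‖ ^ 2) := mul_le_mul (hm y) h1 (by positivity) h0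

/-- The sesquilinear form with kernel `Q`, on sequences. -/
def kernelForm (Q : Lattice d → Lattice d → ℝ) (f g : Lattice d → ℂ) : ℂ :=
  ∑' z, ∑' y, conj (f (y + z)) * (Q (y + z) y : ℂ) * g y

theorem mFourierCoeff_mFourier_neg_mul (F : Torus d → ℂ) (z y : Lattice d) :
    UnitAddTorus.mFourierCoeff (fun τ => UnitAddTorus.mFourier (-z) τ * F τ) y =
      UnitAddTorus.mFourierCoeff F (y + z) := by
  unfold UnitAddTorus.mFourierCoeff
  refine integral_congr_ae (ae_of_all _ fun τ => ?_)
  simp only [smul_eq_mul]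
  rw [← mul_assoc, ← UnitAddTorus.mFourier_add, neg_add]

theorem norm_mFourier_apply (z : Lattice d) (τ : Torus d) : ‖UnitAddTorus.mFourier z τ‖ = 1 := by
  simp only [UnitAddTorus.mFourier, ContinuousMap.coe_mk, norm_prod, fourier_apply, Circle.norm_coe,
    Finset.prod_const_one]

theorem MemLp.mFourier_mul {p : ℝ≥0∞} {F : Torus d → ℂ} (hF : MemLp F p) (z : Lattice d) :
    MemLp (fun τ => UnitAddTorus.mFourier z τ * F τ) p :=
  hF.of_le ((UnitAddTorus.mFourier z).continuous.aestronglyMeasurable.mul hF.1)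
    (ae_of_all _ fun τ => by rw [norm_mul, norm_mFourier_apply, one_mul])

theorem summable_norm_sq_shift {f : Lattice d → ℂ} (hf : Summable fun y => ‖f y‖ ^ 2)
    (z : Lattice d) : Summable fun y => ‖f (y + z)‖ ^ 2 :=
  ((Equiv.addRight z).summable_iff (f := fun y => ‖f y‖ ^ 2)).2 hf

theorem hasSum_norm_sq_shift {f : Lattice d → ℂ} {A : ℝ} (hf : HasSum (fun y => ‖f y‖ ^ 2) A)
    (z : Lattice d) : HasSum (fun y => ‖f (y + z)‖ ^ 2) A :=
  ((Equiv.addRight z).hasSum_iff (f := fun y => ‖f y‖ ^ 2)).2 hf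

/-- For fixed `z` the kernel is split as `q z + (Q(y+z,y) - q z)`. The second part is killed by
transport; the first leaves a sum over `y` that Parseval turns into the integral with limit `ℓ z`.
The bound `H` permits dominated convergence in `z`. Only the second wave needs a velocity in the
octant, since `y` is its position and `z` is fixed. -/
theorem tendsto_kernelForm (hk : k ≤ d) (ν : Fin k → Fin 2)
    {φ ψ : Torus d → ℝ} (hφ : AEStronglyMeasurable φ volume) (hψ : AEStronglyMeasurable ψ volume)
    {D : Fin d → Torus d → ℝ} (hDm : ∀ j, AEMeasurable (D j) volume)
    (hD : ∀ j, ∀ᵐ τ, HasDirDeriv ψ j (D j τ) τ) {t : ℕ → ℝ}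
    (ht : Tendsto t atTop atTop) {a b : Torus d → ℂ} (ha : MemLp a 2) (hb : MemLp b 2)
    (hsupp : ∀ᵐ τ, b τ ≠ 0 → ∀ j : Fin k, 0 < (octantSign (ν j) : ℝ) * D (Fin.castLE hk j) τ)
    {Q : Lattice d → Lattice d → ℝ} {H : Lattice d → ℝ} (hH : Summable H)
    (hQ : ∀ y z, |Q (y + z) y| ≤ H z) {q : Lattice d → ℝ} (hqH : ∀ z, |q z| ≤ H z)
    (hq : ∀ z, ∀ ε > 0, ∃ N : ℕ, ∀ y : Lattice d,
      (∀ j : Fin k, (N : ℤ) < octantSign (ν j) * y (Fin.castLE hk j)) → |Q (y + z) y - q z| < ε)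
    {ℓ : Lattice d → ℂ}
    (hℓ : ∀ z, Tendsto (fun n => ∫ τ, UnitAddTorus.mFourier z τ * (conj (wave φ (t n) a τ) *
      wave ψ (t n) b τ)) atTop (𝓝 (ℓ z))) :
    Tendsto (fun n => kernelForm Q (UnitAddTorus.mFourierCoeff (wave φ (t n) a))
      (UnitAddTorus.mFourierCoeff (wave ψ (t n) b))) atTop (𝓝 (∑' z, (q z : ℂ) * ℓ z)) := by
  have hfs : ∀ n, HasSum (fun y => ‖UnitAddTorus.mFourierCoeff (wave φ (t n) a) y‖ ^ 2)
      (∫ τ, ‖a τ‖ ^ 2) := fun n => by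
    have := hasSum_norm_sq_mFourierCoeff (MemLp.wave hφ (t n) ha)
    simpa only [norm_wave] using this
  have hgs : ∀ n, HasSum (fun y => ‖UnitAddTorus.mFourierCoeff (wave ψ (t n) b) y‖ ^ 2)
      (∫ τ, ‖b τ‖ ^ 2) := fun n => by
    have := hasSum_norm_sq_mFourierCoeff (MemLp.wave hψ (t n) hb)
    simpa only [norm_wave] using this
  let S : ℕ → Lattice d → ℂ := fun n z =>
    ∑' y, conj (UnitAddTorus.mFourierCoeff (wave φ (t n) a) (y + z)) *
      (Q (y + z) y : ℂ) * UnitAddTorus.mFourierCoeff (wave ψ (t n) b) y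
  have hmain : ∀ z, Tendsto (fun n => S n z) atTop (𝓝 ((q z : ℂ) * ℓ z)) := by
    intro z
    have h1 := tendsto_tsum_conj_mul_mul hk ν hψ hDm hD ht hb hsupp
      (f := fun n y => UnitAddTorus.mFourierCoeff (wave φ (t n) a) (y + z))
      (fun n => hasSum_norm_sq_shift (hfs n) z)
      (r := fun y => (Q (y + z) y : ℂ) - q z) (C := 2 * H z)
      (fun y => by
        refine (norm_sub_le _ _).trans ?_
        rw [Complex.norm_real, Complex.norm_real, Real.norm_eq_abs, Real.norm_eq_abs]
        linarith [hQ y z, hqH z])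
      (fun ε hε => by
        obtain ⟨N, hN⟩ := hq z ε hε
        refine ⟨N, fun y hy => ?_⟩
        rw [← Complex.ofReal_sub, Complex.norm_real]
        exact hN y hy)
    have h2 := h1.add ((hℓ z).const_mul (q z : ℂ))
    rw [zero_add] at h2
    refine h2.congr fun n => ?_
    have hsh : HasSum (fun y => conj (UnitAddTorus.mFourierCoeff (wave φ (t n) a) (y + z)) *
        UnitAddTorus.mFourierCoeff (wave ψ (t n) b) y)
        (∫ τ, UnitAddTorus.mFourier z τ * (conj (wave φ (t n) a τ) * wave ψ (t n) b τ)) := by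
      have := hasSum_conj_mFourierCoeff_mul (MemLp.mFourier_mul (MemLp.wave hφ (t n) ha) (-z))
        (MemLp.wave hψ (t n) hb)
      simp only [mFourierCoeff_mFourier_neg_mul] at this
      convert this using 1
      refine integral_congr_ae (ae_of_all _ fun τ => ?_)
      simp only [map_mul, ← UnitAddTorus.mFourier_neg, neg_neg, mul_assoc]
    have hs1 : Summable fun y => conj (UnitAddTorus.mFourierCoeff (wave φ (t n) a) (y + z)) *
        ((Q (y + z) y : ℂ) - q z) * UnitAddTorus.mFourierCoeff (wave ψ (t n) b) y :=
      summable_conj_mul_mul (m := fun y => (Q (y + z) y : ℂ) - q z) (summable_norm_sq_shift (hfs n).summable z) (hgs n).summable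
        (C := 2 * H z) (fun y => by
        refine (norm_sub_le _ _).trans ?_
        rw [Complex.norm_real, Complex.norm_real, Real.norm_eq_abs, Real.norm_eq_abs]
        linarith [hQ y z, hqH z])
    rw [← hsh.tsum_eq, ← tsum_mul_left, ← hs1.tsum_add (hsh.summable.mul_left _)]
    refine tsum_congr fun y => ?_
    ring
  have hbd : ∀ n z, ‖S n z‖ ≤ H z * ((∫ τ, ‖a τ‖ ^ 2) + ∫ τ, ‖b τ‖ ^ 2) := by
    intro n z
    refine norm_tsum_conj_mul_mul_le (hasSum_norm_sq_shift (hfs n) z) (hgs n)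
      (m := fun y => (Q (y + z) y : ℂ)) fun y => ?_
    rw [Complex.norm_real]
    exact hQ y z
  have hB : Summable fun z => H z * ((∫ τ, ‖a τ‖ ^ 2) + ∫ τ, ‖b τ‖ ^ 2) := hH.mul_right _
  have hfin : Tendsto (fun n => ∑' z, S n z) atTop (𝓝 (∑' z, (q z : ℂ) * ℓ z)) :=
    tendsto_tsum_of_dominated_convergence hB hmain (Eventually.of_forall hbd)
  exact hfin

theorem conj_wave_mul_wave (φ ψ : Torus d → ℝ) (t : ℝ) (a b : Torus d → ℂ) (τ : Torus d) :
    conj (wave φ t a τ) * wave ψ t b τ =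
      wave (fun τ => ψ τ - φ τ) t (fun τ => conj (a τ) * b τ) τ := by
  simp only [wave, map_mul, ← Complex.exp_conj, Complex.conj_I, Complex.conj_ofReal]
  have : Complex.exp (Complex.I * (t * (ψ τ - φ τ) : ℝ)) =
      Complex.exp (-Complex.I * (t * φ τ : ℝ)) * Complex.exp (Complex.I * (t * ψ τ : ℝ)) := by
    rw [← Complex.exp_add]
    congr 1
    push_cast
    ring
  rw [this]
  ring

theorem HasDirDeriv.sub {φ ψ : Torus d → ℝ} {j : Fin d} {D D' : ℝ} {τ : Torus d}
    (hψ : HasDirDeriv ψ j D τ) (hφ : HasDirDeriv φ j D' τ) :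
    HasDirDeriv (fun τ => ψ τ - φ τ) j (D - D') τ :=
  (Tendsto.sub hψ hφ).congr fun r => by ring

/-- Waves with different phases decorrelate. -/
theorem tendsto_kernelForm_of_ne (hk : k ≤ d) (ν : Fin k → Fin 2)
    {φ ψ : Torus d → ℝ} (hφ : AEStronglyMeasurable φ volume) (hψ : AEStronglyMeasurable ψ volume)
    {D D' : Fin d → Torus d → ℝ} (hDm : ∀ j, AEMeasurable (D j) volume)
    (hD'm : ∀ j, AEMeasurable (D' j) volume)
    (hD : ∀ j, ∀ᵐ τ, HasDirDeriv ψ j (D j τ) τ) (hD' : ∀ j, ∀ᵐ τ, HasDirDeriv φ j (D' j τ) τ)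
    (hne : ∀ᵐ τ, ∃ j, D j τ ≠ D' j τ) {t : ℕ → ℝ}
    (ht : Tendsto t atTop atTop) {a b : Torus d → ℂ} (ha : MemLp a 2) (hb : MemLp b 2)
    (hsupp : ∀ᵐ τ, b τ ≠ 0 → ∀ j : Fin k, 0 < (octantSign (ν j) : ℝ) * D (Fin.castLE hk j) τ)
    {Q : Lattice d → Lattice d → ℝ} {H : Lattice d → ℝ} (hH : Summable H)
    (hQ : ∀ y z, |Q (y + z) y| ≤ H z) {q : Lattice d → ℝ} (hqH : ∀ z, |q z| ≤ H z)
    (hq : ∀ z, ∀ ε > 0, ∃ N : ℕ, ∀ y : Lattice d,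
      (∀ j : Fin k, (N : ℤ) < octantSign (ν j) * y (Fin.castLE hk j)) → |Q (y + z) y - q z| < ε) :
    Tendsto (fun n => kernelForm Q (UnitAddTorus.mFourierCoeff (wave φ (t n) a))
      (UnitAddTorus.mFourierCoeff (wave ψ (t n) b))) atTop (𝓝 0) := by
  have := tendsto_kernelForm hk ν hφ hψ hDm hD ht ha hb hsupp hH hQ hqH hq (ℓ := fun _ => 0)
    (fun z => by
      have hF : Integrable (fun τ => conj (a τ) * b τ) :=
        MemLp.integrable_mul (p := 2) (q := 2) ha.star hb
      have hF' := memLp_one_iff_integrable.1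
        (MemLp.mFourier_mul (memLp_one_iff_integrable.2 hF) z)
      refine (tendsto_integral_wave_zero (hψ.sub hφ) (fun j => (hDm j).sub (hD'm j))
        (fun j => ?_) ht hF' ?_).congr fun n => ?_
      · filter_upwards [hD j, hD' j] with τ h1 h2 using h1.sub h2
      · filter_upwards [hne] with τ ⟨j, hj⟩ using ⟨j, sub_ne_zero.2 hj⟩
      · refine integral_congr_ae (ae_of_all _ fun τ => ?_)
        simp only [conj_wave_mul_wave]
        simp only [wave, Pi.sub_apply]
        ring)
  simpa using this

/-- The limit of the correlation of two waves with the same phase. -/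
theorem tendsto_kernelForm_self (hk : k ≤ d) (ν : Fin k → Fin 2)
    {ψ : Torus d → ℝ} (hψ : AEStronglyMeasurable ψ volume)
    {D : Fin d → Torus d → ℝ} (hDm : ∀ j, AEMeasurable (D j) volume)
    (hD : ∀ j, ∀ᵐ τ, HasDirDeriv ψ j (D j τ) τ) {t : ℕ → ℝ}
    (ht : Tendsto t atTop atTop) {a b : Torus d → ℂ} (ha : MemLp a 2) (hb : MemLp b 2)
    (hsupp : ∀ᵐ τ, b τ ≠ 0 → ∀ j : Fin k, 0 < (octantSign (ν j) : ℝ) * D (Fin.castLE hk j) τ)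
    {Q : Lattice d → Lattice d → ℝ} {H : Lattice d → ℝ} (hH : Summable H)
    (hQ : ∀ y z, |Q (y + z) y| ≤ H z) {q : Lattice d → ℝ} (hqH : ∀ z, |q z| ≤ H z)
    (hq : ∀ z, ∀ ε > 0, ∃ N : ℕ, ∀ y : Lattice d,
      (∀ j : Fin k, (N : ℤ) < octantSign (ν j) * y (Fin.castLE hk j)) → |Q (y + z) y - q z| < ε) :
    Tendsto (fun n => kernelForm Q (UnitAddTorus.mFourierCoeff (wave ψ (t n) a))
      (UnitAddTorus.mFourierCoeff (wave ψ (t n) b))) atTop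
      (𝓝 (∫ τ, conj (a τ) * (∑' z, UnitAddTorus.mFourier z τ * (q z : ℂ)) * b τ)) := by
  have hF : Integrable (fun τ => conj (a τ) * b τ) :=
    MemLp.integrable_mul (p := 2) (q := 2) ha.star hb
  have := tendsto_kernelForm hk ν hψ hψ hDm hD ht ha hb hsupp hH hQ hqH hq
    (ℓ := fun z => ∫ τ, UnitAddTorus.mFourier z τ * (conj (a τ) * b τ))
    (fun z => by
      refine tendsto_const_nhds.congr fun n => ?_
      simp only [conj_wave_mul_wave]
      refine integral_congr_ae (ae_of_all _ fun τ => ?_)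
      simp [wave])
  convert this using 2
  have hqs : Summable fun z => ‖(q z : ℂ)‖ :=
    Summable.of_nonneg_of_le (fun _ => norm_nonneg _)
      (fun z => by rw [Complex.norm_real]; exact hqH z) hH
  have hi : ∀ z, Integrable (fun τ => (q z : ℂ) * (UnitAddTorus.mFourier z τ * (conj (a τ) * b τ))) :=
    fun z => (memLp_one_iff_integrable.1
      (MemLp.mFourier_mul (memLp_one_iff_integrable.2 hF) z)).const_mul _
  have hsum := hasSum_integral_of_summable_integral_norm hi (by
    simp only [norm_mul, norm_mFourier_apply, one_mul, integral_const_mul]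
    exact hqs.mul_right _)
  simp only [integral_const_mul] at hsum
  rw [hsum.tsum_eq]
  refine integral_congr_ae (ae_of_all _ fun τ => ?_)
  simp only [mul_assoc, ← tsum_mul_right, ← tsum_mul_left]
  refine tsum_congr fun z => ?_
  ring

end

/-! ### Zero sets of real-analytic functions -/

theorem analyticAt_finCons_right {d : ℕ} (x₀ : ℝ) (x : Fin d → ℝ) :
    AnalyticAt ℝ (fun x : Fin d → ℝ => (Fin.cons x₀ x : Fin (d + 1) → ℝ)) x := by
  refine AnalyticAt.pi fun i => ?_
  refine Fin.cases ?_ (fun j => ?_) i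
  · simpa using analyticAt_const
  · simp only [Fin.cons_succ]
    exact (ContinuousLinearMap.proj (R := ℝ) (φ := fun _ : Fin d => ℝ) j).analyticAt x

theorem analyticAt_finCons_left {d : ℕ} (x₀ : ℝ) (x : Fin d → ℝ) :
    AnalyticAt ℝ (fun x₀ : ℝ => (Fin.cons x₀ x : Fin (d + 1) → ℝ)) x₀ := by
  refine AnalyticAt.pi fun i => ?_
  refine Fin.cases ?_ (fun j => ?_) i
  · simp only [Fin.cons_zero]
    exact analyticAt_id
  · simpa using analyticAt_const

theorem measurableSet_zeros {d : ℕ} {W : Set (Fin d → ℝ)} (hW : IsOpen W) {f : (Fin d → ℝ) → ℝ}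
    (hf : ContinuousOn f W) : MeasurableSet {x ∈ W | f x = 0} := by
  have h : {x ∈ W | f x = 0} = W \ (W ∩ f ⁻¹' {0}ᶜ) := by
    ext x
    simp only [Set.mem_sdiff, Set.mem_inter_iff, Set.mem_preimage, Set.mem_compl_iff,
      Set.mem_singleton_iff, not_and, not_not, Set.mem_ofPred_eq]
    tauto
  rw [h]
  exact hW.measurableSet.diff
    (hf.isOpen_inter_preimage hW isOpen_compl_singleton).measurableSet

/-- The zero set of a real analytic function on an open box is a null set, unless the function is
identically zero. -/
theorem volume_zeros_box {d : ℕ} (a b : Fin d → ℝ) (f : (Fin d → ℝ) → ℝ)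
    (hf : AnalyticOnNhd ℝ f (Set.univ.pi fun i => Set.Ioo (a i) (b i)))
    (hne : ∃ x ∈ Set.univ.pi fun i => Set.Ioo (a i) (b i), f x ≠ 0) :
    volume {x ∈ Set.univ.pi fun i => Set.Ioo (a i) (b i) | f x = 0} = 0 := by
  induction d with
  | zero =>
    obtain ⟨x, _, hx⟩ := hne
    have : {x ∈ Set.univ.pi fun i => Set.Ioo (a i) (b i) | f x = 0} = ∅ := by
      ext y
      rw [Subsingleton.elim y x]
      simp [hx]
    rw [this, measure_empty]
  | succ d ih =>
    obtain ⟨p, hp, hpne⟩ := hne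
    set W : Set (Fin (d + 1) → ℝ) := Set.univ.pi fun i => Set.Ioo (a i) (b i) with hWdef
    have hmemW : ∀ x₀ (x : Fin d → ℝ), (Fin.cons x₀ x : Fin (d + 1) → ℝ) ∈ W ↔
        x₀ ∈ Set.Ioo (a 0) (b 0) ∧ x ∈ Set.univ.pi fun i : Fin d => Set.Ioo (a i.succ) (b i.succ) := by
      intro x₀ x
      simp only [hWdef, Set.mem_univ_pi, Fin.forall_fin_succ, Fin.cons_zero, Fin.cons_succ]
    have hpW : (Fin.cons (p 0) (Fin.tail p) : Fin (d + 1) → ℝ) ∈ W := by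
      rw [Fin.cons_self_tail]; exact hp
    obtain ⟨hp0, hp1⟩ := (hmemW _ _).1 hpW
    have hWo : IsOpen W := isOpen_set_pi Set.finite_univ fun i _ => isOpen_Ioo
    have hZm := measurableSet_zeros hWo hf.continuousOn
    have hmp := (volume_preserving_piFinSuccAbove (fun _ : Fin (d + 1) => ℝ) 0).symm
    have hcons : ∀ q : ℝ × (Fin d → ℝ), (MeasurableEquiv.piFinSuccAbove (fun _ => ℝ) 0).symm q =
        (Fin.cons q.1 q.2 : Fin (d + 1) → ℝ) := fun q => Fin.insertNth_zero' q.1 q.2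
    rw [← hmp.measure_preimage hZm.nullMeasurableSet]
    rw [Measure.volume_eq_prod, Measure.measure_prod_null (hmp.measurable hZm)]
    -- On the line through `p` in the first direction `f` is a nonzero analytic function of one
    -- variable. Hence for almost every `x₀` the slice at `x₀` contains a point, `Fin.tail p`, where
    -- `f` does not vanish, and the induction hypothesis applies to the slice.
    have hg : AnalyticOnNhd ℝ (fun x₀ : ℝ => f (Fin.cons x₀ (Fin.tail p))) (Set.Ioo (a 0) (b 0)) :=
      fun x₀ h0 => AnalyticAt.comp (g := f) (f := fun y : ℝ => (Fin.cons y (Fin.tail p) : Fin (d + 1) → ℝ))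
        (hf _ ((hmemW _ _).2 ⟨h0, hp1⟩)) (analyticAt_finCons_left x₀ (Fin.tail p))
    have hcod := hg.preimage_zero_mem_codiscreteWithin (x := p 0)
      (by rw [Fin.cons_self_tail]; exact hpne) hp0
      ⟨⟨p 0, hp0⟩, isPreconnected_Ioo⟩
    have hae : ∀ᵐ x₀ ∂(volume.restrict (Set.Ioo (a 0) (b 0))),
        f (Fin.cons x₀ (Fin.tail p)) ≠ 0 := ae_restrict_le_codiscreteWithin measurableSet_Ioo hcod
    rw [ae_restrict_iff' measurableSet_Ioo] at hae
    filter_upwards [hae] with x₀ hx₀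
    by_cases h0 : x₀ ∈ Set.Ioo (a 0) (b 0)
    · refine measure_mono_null ?_ (ih (fun i => a i.succ) (fun i => b i.succ)
        (fun x => f (Fin.cons x₀ x))
        (fun x hx => (hf _ ((hmemW _ _).2 ⟨h0, hx⟩)).comp (analyticAt_finCons_right x₀ x))
        ⟨Fin.tail p, hp1, hx₀ h0⟩)
      intro x hx
      have hx' : (MeasurableEquiv.piFinSuccAbove (fun _ => ℝ) 0).symm (x₀, x) ∈
        {x ∈ W | f x = 0} := hx
      rw [hcons] at hx'
      exact ⟨((hmemW _ _).1 hx'.1).2, hx'.2⟩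
    · refine measure_mono_null (fun x hx => ?_) measure_empty
      have hx' : (MeasurableEquiv.piFinSuccAbove (fun _ => ℝ) 0).symm (x₀, x) ∈
        {x ∈ W | f x = 0} := hx
      rw [hcons] at hx'
      exact absurd ((hmemW _ _).1 hx'.1).1 h0

/-- Being null is a local property, and balls of the supremum norm are boxes. `W` need not be
connected, so nonvanishing is required on every open subset. -/
theorem volume_zeros_of_analyticOnNhd {d : ℕ} {W : Set (Fin d → ℝ)} (hW : IsOpen W)
    {f : (Fin d → ℝ) → ℝ} (hf : AnalyticOnNhd ℝ f W)
    (hne : ∀ U : Set (Fin d → ℝ), IsOpen U → U.Nonempty → U ⊆ W → ¬ ∀ x ∈ U, f x = 0) :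
    volume {x ∈ W | f x = 0} = 0 := by
  refine measure_null_of_locally_null _ fun x hx => ?_
  obtain ⟨r, hr, hball⟩ := Metric.isOpen_iff.1 hW x hx.1
  have hbox : Metric.ball x r = Set.univ.pi fun i => Set.Ioo (x i - r) (x i + r) := by
    rw [ball_pi x hr]
    simp only [Real.ball_eq_Ioo]
  have hn := hne _ Metric.isOpen_ball ⟨x, Metric.mem_ball_self hr⟩ hball
  push Not at hn
  rw [hbox] at hn hball
  have h := volume_zeros_box _ _ f (hf.mono hball) hn
  refine ⟨_, ?_, h⟩
  rw [← hbox]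
  filter_upwards [self_mem_nhdsWithin, nhdsWithin_le_nhds (Metric.ball_mem_nhds x hr)] with y h1 h2
  exact ⟨h2, h1.2⟩

/-- On the whole space one nonzero value at `p` suffices, because space is exhausted by boxes that
all contain `p`. -/
theorem volume_zeros_of_analytic {d : ℕ} {f : (Fin d → ℝ) → ℝ} (hf : ∀ x, AnalyticAt ℝ f x)
    (hne : ∃ x, f x ≠ 0) : volume {x | f x = 0} = 0 := by
  obtain ⟨p, hp⟩ := hne
  have hcov : {x | f x = 0} ⊆ ⋃ m : ℕ, {x ∈ Set.univ.pi fun i => Set.Ioo (p i - (m + 1 : ℝ)) (p i + (m + 1)) |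
      f x = 0} := by
    intro x hx
    obtain ⟨m, hm⟩ := exists_nat_gt (dist x p)
    refine Set.mem_iUnion.2 ⟨m, ?_, hx⟩
    intro i _
    have := (dist_le_pi_dist x p i).trans_lt hm
    rw [Real.dist_eq, abs_lt] at this
    constructor <;> linarith
  refine measure_mono_null hcov (measure_iUnion_null fun m => ?_)
  refine volume_zeros_box _ _ f (fun x _ => hf x) ⟨p, fun i _ => ?_, hp⟩
  have : (0 : ℝ) < m + 1 := by positivity
  constructor <;> linarith

section

/-! ### Sums over the lattice -/

theorem latNorm_nonneg {d : ℕ} (x : Lattice d) : 0 ≤ latNorm x := Real.sqrt_nonneg _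

theorem abs_coord_le_latNorm {d : ℕ} (x : Lattice d) (i : Fin d) : |(x i : ℝ)| ≤ latNorm x := by
  unfold latNorm
  rw [← Real.sqrt_sq_eq_abs]
  exact Real.sqrt_le_sqrt (Finset.single_le_sum (f := fun i => (x i : ℝ) ^ 2)
    (fun i _ => sq_nonneg _) (Finset.mem_univ i))

theorem latNorm_le_bracket {d : ℕ} (x : Lattice d) : latNorm x ≤ bracket x := by
  unfold bracket
  exact Real.le_sqrt_of_sq_le (by linarith)

theorem bracket_le_one_add {d : ℕ} (x : Lattice d) : bracket x ≤ 1 + latNorm x := by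
  have := latNorm_nonneg x
  unfold bracket
  exact Real.sqrt_le_iff.2 ⟨by linarith, by nlinarith⟩

/-- Comparison with the known sum of powers of the norm over a lattice of rank `d`; the weight
dominates the supremum norm and the exponent is negative. -/
theorem summable_bracket_rpow {d : ℕ} {s : ℝ} (hs : s < -(d : ℝ)) :
    Summable fun x : Lattice d => bracket x ^ s := by
  let L : Submodule ℤ (Fin d → ℝ) := Submodule.span ℤ (Set.range (Pi.basisFun ℝ (Fin d)))
  have hL : Module.finrank ℤ L = d := by
    rw [ZLattice.rank ℝ L, Module.finrank_fin_fun]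
  have hmem : ∀ x : Lattice d, (fun i => (x i : ℝ)) ∈ L := by
    intro x
    have : (fun i => (x i : ℝ)) = ∑ i, x i • Pi.basisFun ℝ (Fin d) i := by
      funext j
      simp [Pi.single_apply]
    rw [this]
    exact Submodule.sum_mem _ fun i _ => Submodule.smul_mem _ _ (Submodule.subset_span ⟨i, rfl⟩)
  have h1 := (ZLattice.summable_norm_rpow L s (by rw [hL]; exact hs)).comp_injective
    (i := fun x : Lattice d => (⟨fun i => (x i : ℝ), hmem x⟩ : L)) (by
      intro x y hxy
      funext i
      have : (x i : ℝ) = (y i : ℝ) := congrFun (congrArg Subtype.val hxy) i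
      exact_mod_cast this)
  have hs0 : s ≤ 0 := hs.le.trans (by simp)
  -- The comparison fails at the origin, where the norm is zero and its negative power is `0` by
  -- convention.
  refine Summable.of_norm_bounded_eventually h1 ?_
  have hfin : ({0} : Set (Lattice d)).Finite := Set.finite_singleton 0
  filter_upwards [hfin.compl_mem_cofinite] with x hx
  rw [Real.norm_of_nonneg (Real.rpow_nonneg (bracket_pos x).le _)]
  have hpos : 0 < ‖(fun i => (x i : ℝ) : Fin d → ℝ)‖ := by
    rw [norm_pos_iff]
    intro h0
    apply hx
    funext i
    have : (x i : ℝ) = 0 := congrFun h0 i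
    exact Int.cast_eq_zero.1 this
  refine Real.rpow_le_rpow_of_nonpos hpos ?_ hs0
  refine le_trans ?_ (latNorm_le_bracket x)
  exact (pi_norm_le_iff_of_nonneg (latNorm_nonneg x)).2 fun i => abs_coord_le_latNorm x i

theorem exp_neg_mul_le_rpow {c : ℝ} (hc : 0 < c) (m : ℕ) :
    ∃ K > 0, ∀ (d : ℕ) (x : Lattice d), Real.exp (-c * latNorm x) ≤ K * bracket x ^ (-(m : ℝ)) := by
  refine ⟨Real.exp c * m.factorial / c ^ m, by positivity, fun d x => ?_⟩
  have hb := bracket_pos x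
  have h1 := Real.pow_div_factorial_le_exp (x := c * bracket x) (by positivity) m
  have h2 : Real.exp (c * bracket x) ≤ Real.exp (c + c * latNorm x) :=
    Real.exp_le_exp.2 (by nlinarith [bracket_le_one_add x])
  rw [Real.exp_add] at h2
  rw [Real.rpow_neg hb.le, Real.rpow_natCast, neg_mul, Real.exp_neg, ← div_eq_mul_inv, div_div,
    le_div_iff₀ (by positivity), inv_mul_le_iff₀ (Real.exp_pos _)]
  have h3 := h1.trans h2
  rw [div_le_iff₀ (by positivity), mul_pow] at h3
  linarith

theorem summable_exp_mul_rpow {d : ℕ} {c : ℝ} (hc : 0 < c) (s : ℝ) :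
    Summable fun x : Lattice d => Real.exp (-c * latNorm x) * bracket x ^ s := by
  obtain ⟨m, hm⟩ := exists_nat_gt (s + d)
  obtain ⟨K, hK, h⟩ := exp_neg_mul_le_rpow hc m
  refine Summable.of_nonneg_of_le (fun x => ?_) (fun x => ?_)
    ((summable_bracket_rpow (d := d) (s := s - m) (by linarith)).mul_left K)
  · have := bracket_pos x
    positivity
  · have hb := bracket_pos x
    calc _ ≤ K * bracket x ^ (-(m : ℝ)) * bracket x ^ s := by gcongr; exact h d x
      _ = K * bracket x ^ (s - m) := by
        rw [mul_assoc, ← Real.rpow_add hb]; ring_nf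

theorem summable_exp_neg {d : ℕ} {c : ℝ} (hc : 0 < c) :
    Summable fun x : Lattice d => Real.exp (-c * latNorm x) := by
  simpa using summable_exp_mul_rpow (d := d) hc 0

/-! ### Analyticity of exponential sums -/

section Analytic

variable {ι E : Type*} [NormedAddCommGroup E] [NormedSpace ℝ E]

/-- Expanding every exponential gives a double series over `ι × ℕ` that converges absolutely for
`‖h‖ ≤ r` by the hypothesis; summing it by degree instead of by `i` yields the power series. -/
theorem hasFPowerSeriesOnBall_tsum_exp {c : ι → ℂ} {l : ι → E →L[ℝ] ℂ} {r : NNReal}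
    (hr : 0 < r) (hs : Summable fun i => ‖c i‖ * Real.exp (‖l i‖ * r)) :
    HasFPowerSeriesOnBall (fun h : E => ∑' i, c i * Complex.exp (l i h))
      (fun m => ∑' i, c i • ((NormedSpace.expSeries ℝ ℂ).compContinuousLinearMap (l i)) m) 0 r := by
  have hnorm : ∀ i m, ‖c i • ((NormedSpace.expSeries ℝ ℂ).compContinuousLinearMap (l i)) m‖ ≤
      ‖c i‖ * (‖l i‖ ^ m / m.factorial) := by
    intro i m
    rw [norm_smul]
    gcongr
    refine (ContinuousMultilinearMap.norm_compContinuousLinearMap_le _ _).trans ?_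
    rw [Finset.prod_const, Finset.card_univ, Fintype.card_fin, NormedSpace.expSeries, norm_smul,
      ContinuousMultilinearMap.norm_mkPiAlgebraFin, mul_one, norm_inv, RCLike.norm_natCast]
    exact le_of_eq (by ring)
  have hterm : ∀ i m, ‖c i‖ * (‖l i‖ ^ m / m.factorial) * (r : ℝ) ^ m ≤
      ‖c i‖ * Real.exp (‖l i‖ * r) := by
    intro i m
    have := Real.pow_div_factorial_le_exp (x := ‖l i‖ * r) (by positivity) m
    calc _ = ‖c i‖ * ((‖l i‖ * r) ^ m / m.factorial) := by rw [mul_pow]; ring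
      _ ≤ _ := by gcongr
  have hr' : (0 : ℝ) < r := hr
  have hsm : ∀ m, Summable fun i => ‖c i‖ * (‖l i‖ ^ m / m.factorial) := by
    intro m
    refine Summable.of_nonneg_of_le (fun i => by positivity) (fun i => ?_)
      (hs.mul_right ((r : ℝ) ^ m)⁻¹)
    rw [← div_eq_mul_inv, le_div_iff₀ (by positivity)]
    exact hterm i m
  have hsm' : ∀ m, Summable fun i =>
      c i • ((NormedSpace.expSeries ℝ ℂ).compContinuousLinearMap (l i)) m := fun m =>
    Summable.of_norm_bounded (hsm m) fun i => hnorm i m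
  refine ⟨?_, by exact_mod_cast hr, fun {y} hy => ?_⟩
  · refine FormalMultilinearSeries.le_radius_of_bound _ (∑' i, ‖c i‖ * Real.exp (‖l i‖ * r))
      fun m => ?_
    have h1 := tsum_of_norm_bounded (hsm m).hasSum fun i => hnorm i m
    calc _ ≤ (∑' i, ‖c i‖ * (‖l i‖ ^ m / m.factorial)) * (r : ℝ) ^ m := by gcongr
      _ = ∑' i, ‖c i‖ * (‖l i‖ ^ m / m.factorial) * (r : ℝ) ^ m := tsum_mul_right.symm
      _ ≤ _ := Summable.tsum_le_tsum (fun i => hterm i m) ((hsm m).mul_right _) hs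
  · have hy' : ‖y‖ ≤ r := by
      rw [Metric.mem_eball, edist_zero_right] at hy
      have := hy.le
      rw [enorm_le_coe] at this
      exact_mod_cast this
    let F : ι × ℕ → ℂ := fun p => c p.1 * ((l p.1 y) ^ p.2 / (p.2.factorial : ℂ))
    have hFn : ∀ p, ‖F p‖ ≤ ‖c p.1‖ * ((‖l p.1‖ * r) ^ p.2 / p.2.factorial) := by
      intro p
      simp only [F, norm_mul, norm_div, norm_pow, RCLike.norm_natCast]
      gcongr
      exact (ContinuousLinearMap.le_opNorm _ _).trans (by gcongr)
    have hexp : ∀ x : ℝ, HasSum (fun m : ℕ => x ^ m / m.factorial) (Real.exp x) := fun x => by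
      rw [Real.exp_eq_exp_ℝ]
      exact NormedSpace.expSeries_div_hasSum_exp x
    have hFs : Summable F := by
      have hG : Summable fun p : ι × ℕ => ‖c p.1‖ * ((‖l p.1‖ * r) ^ p.2 / p.2.factorial) := by
        rw [summable_prod_of_nonneg (fun p => by positivity)]
        refine ⟨fun i => (hexp (‖l i‖ * r)).summable.mul_left ‖c i‖, ?_⟩
        refine hs.congr fun i => ?_
        exact ((hexp (‖l i‖ * r)).mul_left ‖c i‖).tsum_eq.symm
      exact Summable.of_norm_bounded hG hFn
    have h1 : ∀ i, HasSum (fun m => F (i, m)) (c i * Complex.exp (l i y)) := fun i => by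
      refine HasSum.mul_left _ ?_
      rw [Complex.exp_eq_exp_ℂ]
      exact NormedSpace.expSeries_div_hasSum_exp (l i y)
    have h2 : HasSum F (∑' i, c i * Complex.exp (l i y)) := by
      have := hFs.hasSum.prod_fiberwise h1
      rw [this.tsum_eq]
      exact hFs.hasSum
    have h3 : HasSum (fun p : ℕ × ι => F (p.2, p.1)) (∑' i, c i * Complex.exp (l i y)) :=
      ((Equiv.prodComm ℕ ι).hasSum_iff (f := F)).2 h2
    simp only [zero_add]
    refine h3.prod_fiberwise fun m => ?_
    have h4 := ContinuousMultilinearMap.hasSum_eval (hsm' m).hasSum fun _ => y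
    refine h4.congr_fun fun i => ?_
    simp only [F, smul_apply, FormalMultilinearSeries.compContinuousLinearMap_apply,
      smul_eq_mul]
    congr 1
    exact (NormedSpace.expSeries_apply_eq_div (l i y) m).symm

/-- Moving the centre to `x` multiplies `c i` by `e^{l_i(x)}`, of modulus one since the exponents
are imaginary, so the expansion at the origin serves at every point. -/
theorem analyticAt_tsum_exp {c : ι → ℂ} {l : ι → E →L[ℝ] ℂ} {r : ℝ}
    (hr : 0 < r) (hs : Summable fun i => ‖c i‖ * Real.exp (‖l i‖ * r))
    (hl : ∀ i h, (l i h).re = 0) (x : E) :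
    AnalyticAt ℝ (fun h : E => ∑' i, c i * Complex.exp (l i h)) x := by
  have h1 := hasFPowerSeriesOnBall_tsum_exp (c := fun i => c i * Complex.exp (l i x)) (l := l)
    (r := ⟨r, hr.le⟩) hr (by
      refine hs.congr fun i => ?_
      rw [norm_mul, Complex.norm_exp, hl, Real.exp_zero, mul_one]
      rfl)
  have h2 := h1.comp_sub x
  rw [zero_add] at h2
  refine h2.analyticAt.congr (Eventually.of_forall fun h => ?_)
  refine tsum_congr fun i => ?_
  rw [mul_assoc, ← Complex.exp_add, map_sub]
  congr 2
  ring

end Analytic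

/-! ### Analyticity of the symbol -/

/-- `θ ↦ i (x, θ)` as a linear map. -/
def pairingCLM {d : ℕ} (x : Lattice d) : (Fin d → ℝ) →L[ℝ] ℂ :=
  ∑ i, (Complex.I * (x i : ℂ)) • (Complex.ofRealCLM.comp (ContinuousLinearMap.proj i))

theorem pairingCLM_apply {d : ℕ} (x : Lattice d) (θ : Fin d → ℝ) :
    pairingCLM x θ = Complex.I * (pairing x θ : ℝ) := by
  simp only [pairingCLM, pairing, sum_apply, smul_apply,
    ContinuousLinearMap.comp_apply, ContinuousLinearMap.proj_apply, Complex.ofRealCLM_apply,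
    smul_eq_mul, Complex.ofReal_sum, Finset.mul_sum]
  refine Finset.sum_congr rfl fun i _ => ?_
  push_cast
  ring

theorem abs_pairing_le {d : ℕ} (x : Lattice d) (θ : Fin d → ℝ) :
    |pairing x θ| ≤ d * latNorm x * ‖θ‖ := by
  unfold pairing
  refine (Finset.abs_sum_le_sum_abs _ _).trans ?_
  calc ∑ i, |(x i : ℝ) * θ i| ≤ ∑ _i : Fin d, latNorm x * ‖θ‖ := by
        refine Finset.sum_le_sum fun i _ => ?_
        rw [abs_mul]
        exact mul_le_mul (abs_coord_le_latNorm x i) (norm_le_pi_norm θ i) (abs_nonneg _)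
          (latNorm_nonneg x)
    _ = _ := by simp; ring

theorem norm_pairingCLM_le {d : ℕ} (x : Lattice d) : ‖pairingCLM x‖ ≤ d * latNorm x := by
  refine ContinuousLinearMap.opNorm_le_bound _ (mul_nonneg (by positivity) (latNorm_nonneg x))
    fun θ => ?_
  rw [pairingCLM_apply, norm_mul, Complex.norm_I, one_mul, Complex.norm_real]
  exact abs_pairing_le x θ

variable {d n : ℕ}

theorem abs_entry_le_norm {m : ℕ} (A : Matrix (Fin m) (Fin m) ℝ) (a b : Fin m) :
    |A a b| ≤ ‖A‖ := by
  have h := Matrix.l2_opNorm_mulVec A (EuclideanSpace.single b (1 : ℝ))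
  rw [PiLp.norm_single, norm_one, mul_one] at h
  refine le_trans ?_ h
  refine le_trans (le_of_eq ?_) (PiLp.norm_apply_le _ a)
  simp

theorem CondE1.summable_entry {V : Interaction d n} (hE1 : CondE1 V) (a b : Fin n) :
    Summable fun x => |V x a b| := by
  obtain ⟨C, hC, γ, hγ, h⟩ := hE1
  exact Summable.of_nonneg_of_le (fun x => abs_nonneg _)
    (fun x => (abs_entry_le_norm _ a b).trans (h x)) ((summable_exp_neg hγ).mul_left C)

theorem analyticAt_fourier {V : Interaction d n} (hE1 : CondE1 V) (a b : Fin n) (θ : Fin d → ℝ) :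
    AnalyticAt ℝ (fun θ => fourier V θ a b) θ := by
  obtain ⟨C, hC, γ, hγ, h⟩ := hE1
  -- The linear form of `x` has norm at most `d |x|`, so this radius spends at most half of the
  -- decay rate `γ` and leaves the other half for summability; `d + 1` also covers `d = 0`.
  have key := analyticAt_tsum_exp (c := fun x : Lattice d => (V x a b : ℂ)) (l := pairingCLM)
    (r := γ / 2 / (d + 1)) (by positivity)
    (Summable.of_nonneg_of_le (fun x => by positivity) (fun x => ?_)
      ((summable_exp_neg (d := d) (half_pos hγ)).mul_left C))
    (fun x θ => by rw [pairingCLM_apply]; simp) θ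
  · refine key.congr (Eventually.of_forall fun θ' => ?_)
    simp only [fourier, Matrix.of_apply]
    refine tsum_congr fun x => ?_
    rw [pairingCLM_apply, mul_comm]
  · have h1 : ‖(V x a b : ℂ)‖ ≤ C * Real.exp (-γ * latNorm x) := by
      rw [Complex.norm_real]
      exact (abs_entry_le_norm _ a b).trans (h x)
    have h2 : ‖pairingCLM x‖ * (γ / 2 / (d + 1)) ≤ γ / 2 * latNorm x := by
      have hl := latNorm_nonneg x
      have h3 := norm_pairingCLM_le x
      calc ‖pairingCLM x‖ * (γ / 2 / (d + 1)) ≤ (d + 1) * latNorm x * (γ / 2 / (d + 1)) := by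
            gcongr
            nlinarith
        _ = _ := by field_simp
    calc _ ≤ C * Real.exp (-γ * latNorm x) * Real.exp (γ / 2 * latNorm x) := by gcongr
      _ = _ := by rw [mul_assoc, ← Real.exp_add]; ring_nf

end

/-! ### Spectral resolution of a Hermitian matrix -/

section SpectralResolution

variable {n : ℕ} {S : Matrix (Fin n) (Fin n) ℂ}

/-- The spectral projection of the Hermitian matrix `S` at the point `x`. -/
def spectralProj (S : Matrix (Fin n) (Fin n) ℂ) (x : ℝ) : Matrix (Fin n) (Fin n) ℂ :=
  cfc (fun y : ℝ => if y = x then 1 else 0) S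

/-- The real spectrum, as a finite set. -/
def realSpectrum (S : Matrix (Fin n) (Fin n) ℂ) : Finset ℝ :=
  (Matrix.finite_real_spectrum (A := S)).toFinset

theorem mem_realSpectrum {x : ℝ} : x ∈ realSpectrum S ↔ x ∈ spectrum ℝ S := by
  simp [realSpectrum]

theorem continuousOn_spectrum (f : ℝ → ℝ) : ContinuousOn f (spectrum ℝ S) :=
  Matrix.finite_real_spectrum.continuousOn f

theorem cfc_eq_sum (f : ℝ → ℝ) :
    cfc f S = ∑ x ∈ realSpectrum S, (f x : ℂ) • spectralProj S x := by
  have h1 : ∀ x, (f x : ℂ) • spectralProj S x = cfc (fun y => f x * if y = x then 1 else 0) S := by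
    intro x
    rw [cfc_const_mul (f x) _ S (continuousOn_spectrum _), spectralProj]
    rfl
  simp only [h1]
  rw [← cfc_sum _ S _ fun i _ => continuousOn_spectrum _]
  refine cfc_congr fun y hy => ?_
  rw [Finset.sum_apply, Finset.sum_eq_single y]
  · simp
  · intro b _ hb
    simp [hb.symm]
  · intro h
    exact absurd (mem_realSpectrum.2 hy) h

theorem sum_spectralProj (hS : IsSelfAdjoint S) : ∑ x ∈ realSpectrum S, spectralProj S x = 1 := by
  have h := cfc_eq_sum (S := S) fun _ => 1
  rw [cfc_const_one ℝ S] at h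
  simpa using h.symm

theorem spectralProj_mul_self (x : ℝ) : spectralProj S x * spectralProj S x = spectralProj S x := by
  unfold spectralProj
  rw [← cfc_mul _ _ S (continuousOn_spectrum _) (continuousOn_spectrum _)]
  congr 1
  funext y
  by_cases h : y = x <;> simp [h]

theorem conjTranspose_spectralProj (x : ℝ) : (spectralProj S x)ᴴ = spectralProj S x :=
  (cfc_predicate (p := IsSelfAdjoint) (fun y : ℝ => if y = x then (1 : ℝ) else 0) S).star_eq

theorem mul_spectralProj (hS : IsSelfAdjoint S) (x : ℝ) :
    S * spectralProj S x = (x : ℂ) • spectralProj S x := by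
  have h1 : (x : ℂ) • spectralProj S x = cfc (fun y => x * if y = x then 1 else 0) S := by
    rw [cfc_const_mul x _ S (continuousOn_spectrum _), spectralProj]
    rfl
  rw [h1, spectralProj]
  nth_rewrite 1 [← cfc_id' ℝ S]
  rw [← cfc_mul _ _ S (continuousOn_spectrum _) (continuousOn_spectrum _)]
  congr 1
  funext y
  by_cases h : y = x
  · simp [h]
  · simp [h]

theorem spectralProj_mul (hS : IsSelfAdjoint S) (x : ℝ) :
    spectralProj S x * S = (x : ℂ) • spectralProj S x := by
  have h := congrArg Matrix.conjTranspose (mul_spectralProj hS x)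
  rw [Matrix.conjTranspose_mul, conjTranspose_spectralProj, Matrix.conjTranspose_smul,
    conjTranspose_spectralProj, show Sᴴ = S from hS.star_eq] at h
  simpa using h

theorem pow_eq_sum (hS : IsSelfAdjoint S) (k : ℕ) :
    S ^ k = ∑ x ∈ realSpectrum S, (x ^ k : ℂ) • spectralProj S x := by
  have h := cfc_eq_sum (S := S) fun x => x ^ k
  rw [cfc_pow_id S k] at h
  simpa using h

theorem spectralProj_ne_zero (hS : IsSelfAdjoint S) {x : ℝ} (hx : x ∈ realSpectrum S) :
    spectralProj S x ≠ 0 := by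
  intro h0
  rw [mem_realSpectrum] at hx
  have hx2 : ((x : ℂ)) ∈ spectrum ℂ S := by
    simpa using (spectrum.algebraMap_mem_iff ℂ).2 hx
  have hne : (spectrum ℝ (spectralProj S x)) = (fun y : ℝ => if y = x then (1 : ℝ) else 0) ''
    spectrum ℝ S := cfc_map_spectrum _ S hS (continuousOn_spectrum _)
  have h1 : (1 : ℝ) ∈ spectrum ℝ (spectralProj S x) := by
    rw [hne]
    exact ⟨x, hx, by simp⟩
  rw [h0] at h1
  have : Nontrivial (Matrix (Fin n) (Fin n) ℂ) := by
    by_contra hn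
    rw [not_nontrivial_iff_subsingleton] at hn
    rw [spectrum.of_subsingleton] at hx
    exact hx
  rw [spectrum.zero_eq] at h1
  simp at h1

/-- A projection `P = Pᴴ P` has nonnegative trace, which vanishes only for `P = 0`. These traces are
the weights of the moments below. -/
theorem trace_spectralProj_re_pos (hS : IsSelfAdjoint S) {x : ℝ} (hx : x ∈ realSpectrum S) :
    0 < (spectralProj S x).trace.re := by
  have h1 : spectralProj S x = (spectralProj S x)ᴴ * spectralProj S x := by
    rw [conjTranspose_spectralProj, spectralProj_mul_self]
  have h2 : 0 ≤ (spectralProj S x).trace := by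
    rw [h1]
    exact (Matrix.posSemidef_conjTranspose_mul_self _).trace_nonneg
  have h3 : (spectralProj S x).trace ≠ 0 := by
    intro h
    rw [h1, Matrix.trace_conjTranspose_mul_self_eq_zero_iff] at h
    exact spectralProj_ne_zero hS hx h
  rw [Complex.nonneg_iff] at h2
  refine lt_of_le_of_ne h2.1 fun h => h3 ?_
  exact Complex.ext h.symm h2.2.symm

/-- `P v` is an eigenvector, and `v - P v` is orthogonal to every eigenvector `w`, because `P w = w`
and `P` is a selfadjoint idempotent. -/
theorem starProjection_eigenspace (hS : IsSelfAdjoint S) (x : ℝ) :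
    (Matrix.toEuclideanCLM (n := Fin n) (𝕜 := ℂ)).symm
      (Module.End.eigenspace (Matrix.toEuclideanLin S) (x : ℂ)).starProjection =
      spectralProj S x := by
  set Φ := Matrix.toEuclideanCLM (n := Fin n) (𝕜 := ℂ) with hΦ
  have hmem : ∀ w : EuclideanSpace ℂ (Fin n),
      w ∈ Module.End.eigenspace (Matrix.toEuclideanLin S) (x : ℂ) ↔ Φ S w = (x : ℂ) • w :=
    fun w => Module.End.mem_eigenspace_iff
  suffices h : (Module.End.eigenspace (Matrix.toEuclideanLin S) (x : ℂ)).starProjection =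
      Φ (spectralProj S x) by
    rw [h]
    exact Φ.symm_apply_apply _
  ext1 v
  refine Submodule.eq_starProjection_of_mem_of_inner_eq_zero ?_ fun w hw => ?_
  · rw [hmem, ← mul_apply_eq_comp, ← map_mul, mul_spectralProj hS, map_smul]
    rfl
  · rw [hmem] at hw
    -- Evaluating `P_y S w` in two ways gives `x P_y w = y P_y w`.
    have hy : ∀ y ≠ x, Φ (spectralProj S y) w = 0 := by
      intro y hy
      have h1 : Φ (spectralProj S y) (Φ S w) = (y : ℂ) • Φ (spectralProj S y) w := by
        rw [← mul_apply_eq_comp, ← map_mul, spectralProj_mul hS, map_smul]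
        rfl
      rw [hw, map_smul, ← sub_eq_zero, ← sub_smul, smul_eq_zero] at h1
      refine h1.resolve_left fun h => hy ?_
      exact_mod_cast (sub_eq_zero.1 h).symm
    have hsum : w = ∑ y ∈ realSpectrum S, Φ (spectralProj S y) w := by
      have h2 := congrArg (fun M => Φ M w) (sum_spectralProj hS)
      simp only [map_sum, map_one, one_apply_eq_self] at h2
      rw [sum_apply] at h2
      exact h2.symm
    have hPw : Φ (spectralProj S x) w = w := by
      by_cases hx : x ∈ realSpectrum S
      · rw [Finset.sum_eq_single x (fun y _ hyx => hy y hyx) (fun h => absurd hx h)] at hsum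
        exact hsum.symm
      · rw [Finset.sum_eq_zero fun y hyE => hy y (fun h => hx (h ▸ hyE))] at hsum
        rw [hsum, map_zero]
    have hadj : ContinuousLinearMap.adjoint (Φ (spectralProj S x)) = Φ (spectralProj S x) := by
      rw [← ContinuousLinearMap.star_eq_adjoint, ← map_star]
      congr 1
      exact conjTranspose_spectralProj x
    rw [← hPw, ← ContinuousLinearMap.adjoint_inner_left, hadj, map_sub,
      ← mul_apply_eq_comp, ← map_mul, spectralProj_mul_self, sub_self, inner_zero_left]

end SpectralResolution

/-! ### Hankel matrices of moments -/

section Moments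

/-- The Hankel matrix of a measure with `c` atoms is `Wᵀ diag(m) W` with the Vandermonde matrix `W`
of the atoms, so its determinant detects whether they are distinct. -/
theorem det_moments {c : ℕ} (m l : Fin c → ℝ) :
    (Matrix.of fun i j : Fin c => ∑ σ, m σ * l σ ^ ((i : ℕ) + j)).det =
      (Matrix.vandermonde l).det ^ 2 * ∏ σ, m σ := by
  have h : (Matrix.of fun i j : Fin c => ∑ σ, m σ * l σ ^ ((i : ℕ) + j)) =
      (Matrix.vandermonde l)ᵀ * Matrix.diagonal m * Matrix.vandermonde l := by
    ext i j
    rw [Matrix.mul_apply]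
    simp only [Matrix.of_apply]
    refine Finset.sum_congr rfl fun σ _ => ?_
    rw [Matrix.mul_diagonal, Matrix.transpose_apply, Matrix.vandermonde_apply,
      Matrix.vandermonde_apply, pow_add]
    ring
  rw [h, Matrix.det_mul, Matrix.det_mul, Matrix.det_transpose, Matrix.det_diagonal]
  ring

/-- With fewer atoms than rows the matrix factors through a space of dimension `c < s`. -/
theorem det_moments_eq_zero {c s : ℕ} (h : c < s) (m l : Fin c → ℝ) :
    (Matrix.of fun i j : Fin s => ∑ σ, m σ * l σ ^ ((i : ℕ) + j)).det = 0 := by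
  have hmul : (Matrix.of fun i j : Fin s => ∑ σ, m σ * l σ ^ ((i : ℕ) + j)) =
      (Matrix.of fun (i : Fin s) (σ : Fin c) => m σ * l σ ^ (i : ℕ)) *
        (Matrix.of fun (σ : Fin c) (j : Fin s) => l σ ^ (j : ℕ)) := by
    ext i j
    rw [Matrix.mul_apply]
    simp only [Matrix.of_apply]
    refine Finset.sum_congr rfl fun σ _ => ?_
    rw [pow_add]
    ring
  by_contra hne
  have h1 := Matrix.rank_of_isUnit _ ((Matrix.isUnit_iff_isUnit_det _).2 (isUnit_iff_ne_zero.2 hne))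
  rw [hmul] at h1
  have h2 := (Matrix.rank_mul_le_left (Matrix.of fun (i : Fin s) (σ : Fin c) => m σ * l σ ^ (i : ℕ))
    (Matrix.of fun (σ : Fin c) (j : Fin s) => l σ ^ (j : ℕ))).trans (Matrix.rank_le_card_width _)
  simp only [Fintype.card_fin] at h1 h2
  omega

end Moments

/-! ### Bands and spectral projections -/

section Bands

variable {d n : ℕ} {V : Interaction d n}

theorem Omega_nonneg (V : Interaction d n) (θ : Fin d → ℝ) : 0 ≤ Omega V θ :=
  CFC.sqrt_nonneg _

theorem isSelfAdjoint_Omega (V : Interaction d n) (θ : Fin d → ℝ) : IsSelfAdjoint (Omega V θ) :=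
  (Omega_nonneg V θ).isSelfAdjoint

theorem conjTranspose_Omega (V : Interaction d n) (θ : Fin d → ℝ) : (Omega V θ)ᴴ = Omega V θ :=
  (isSelfAdjoint_Omega V θ).star_eq

theorem CondE3.Omega_mul_self (hE3 : CondE3 V) (θ : Fin d → ℝ) :
    Omega V θ * Omega V θ = fourier V θ :=
  CFC.sqrt_mul_sqrt_self _ (Matrix.nonneg_iff_posSemidef.2 (hE3 θ))

theorem bandProj_eq (V : Interaction d n) (σ : ℕ) (θ : Fin d → ℝ) :
    bandProj V σ θ = spectralProj (Omega V θ) (band V σ θ) :=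
  starProjection_eigenspace (isSelfAdjoint_Omega V θ) _

theorem band_eq_orderEmbOfFin {θ : Fin d → ℝ} {c : ℕ} (h : eigenvalueCount V θ = c) (σ : Fin c) :
    band V σ θ = (eigenvalueSet V θ).orderEmbOfFin h σ := by
  have h' : (eigenvalueSet V θ).card = c := h
  change _ = (eigenvalueSet V θ).orderEmbOfFin h' σ
  rw [Finset.orderEmbOfFin_apply, band, List.getD_eq_getElem]
  rfl

theorem band_mem {θ : Fin d → ℝ} {σ : ℕ} (h : σ < eigenvalueCount V θ) :
    band V σ θ ∈ eigenvalueSet V θ := by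
  rw [band_eq_orderEmbOfFin rfl ⟨σ, h⟩]
  exact Finset.orderEmbOfFin_mem _ _ _

theorem band_lt_band {θ : Fin d → ℝ} {σ τ : ℕ} (h : τ < eigenvalueCount V θ) (hστ : σ < τ) :
    band V σ θ < band V τ θ := by
  rw [band_eq_orderEmbOfFin rfl ⟨τ, h⟩, band_eq_orderEmbOfFin rfl ⟨σ, hστ.trans h⟩]
  exact ((eigenvalueSet V θ).orderEmbOfFin rfl).strictMono hστ

theorem band_ne_band {θ : Fin d → ℝ} {σ τ : ℕ} (hσ : σ < eigenvalueCount V θ)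
    (hτ : τ < eigenvalueCount V θ) (hστ : σ ≠ τ) : band V σ θ ≠ band V τ θ := by
  rcases lt_or_gt_of_ne hστ with h | h
  · exact (band_lt_band hτ h).ne
  · exact (band_lt_band hσ h).ne'

theorem sum_eigenvalueSet {M : Type*} [AddCommMonoid M] (V : Interaction d n) (θ : Fin d → ℝ)
    {c : ℕ} (h : eigenvalueCount V θ = c) (f : ℝ → M) :
    ∑ x ∈ eigenvalueSet V θ, f x = ∑ σ ∈ Finset.range c, f (band V σ θ) := by
  rw [← Finset.map_orderEmbOfFin_univ (eigenvalueSet V θ) h, Finset.sum_map,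
    Finset.sum_range fun σ => f (band V σ θ)]
  refine Finset.sum_congr rfl fun σ _ => ?_
  rw [band_eq_orderEmbOfFin h]
  rfl

theorem eigenvalue_nonneg {θ : Fin d → ℝ} {x : ℝ} (hx : x ∈ eigenvalueSet V θ) : 0 ≤ x :=
  spectrum_nonneg_of_nonneg (Omega_nonneg V θ) (mem_realSpectrum.1 hx)

/-- The trace of `V̂(θ)^k`. -/
def moment (V : Interaction d n) (k : ℕ) (θ : Fin d → ℝ) : ℝ := ((fourier V θ) ^ k).trace.re

/-- The traces of the powers of `V̂` are the moments of the squared frequencies, weighted by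
multiplicities. They are analytic in `θ` without any assumption on the bands. -/
theorem CondE3.moment_eq (hE3 : CondE3 V) (θ : Fin d → ℝ) {c : ℕ} (h : eigenvalueCount V θ = c)
    (k : ℕ) : moment V k θ =
      ∑ σ : Fin c, (bandProj V σ θ).trace.re * (band V σ θ ^ 2) ^ k := by
  have h1 : fourier V θ ^ k = ∑ x ∈ eigenvalueSet V θ,
      ((x : ℂ) ^ (2 * k)) • spectralProj (Omega V θ) x := by
    rw [← hE3.Omega_mul_self, ← pow_two, ← pow_mul]
    exact pow_eq_sum (isSelfAdjoint_Omega V θ) _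
  rw [moment, h1, Matrix.trace_sum, Complex.re_sum, sum_eigenvalueSet V θ h, Finset.sum_range]
  refine Finset.sum_congr rfl fun σ _ => ?_
  rw [← bandProj_eq, Matrix.trace_smul, smul_eq_mul, ← Complex.ofReal_pow, Complex.re_ofReal_mul,
    pow_mul, mul_comm]

theorem trace_bandProj_pos {θ : Fin d → ℝ} {σ : ℕ} (h : σ < eigenvalueCount V θ) :
    0 < (bandProj V σ θ).trace.re := by
  rw [bandProj_eq]
  exact trace_spectralProj_re_pos (isSelfAdjoint_Omega V θ) (band_mem h)

/-- The Hankel determinant of the moments. -/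
def hankel (V : Interaction d n) (s : ℕ) (θ : Fin d → ℝ) : ℝ :=
  (Matrix.of fun i j : Fin s => moment V (i + j) θ).det

/-- A multiple of the polynomial with zeros at the squares of the eigenvalues, as a function of `w`
at the square of `w`. -/
def dispersion (V : Interaction d n) (s : ℕ) (θ : Fin d → ℝ) (w : ℝ) : ℝ :=
  (Matrix.of fun i j : Fin s => moment V (i + j + 1) θ - w ^ 2 * moment V (i + j) θ).det

theorem vandermonde_band_ne_zero {θ : Fin d → ℝ} {c : ℕ} (h : eigenvalueCount V θ = c) :
    (Matrix.vandermonde fun σ : Fin c => band V σ θ ^ 2).det ≠ 0 := by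
  rw [Matrix.det_vandermonde_ne_zero_iff]
  intro σ τ hστ
  have h1 := eigenvalue_nonneg (band_mem (V := V) (θ := θ) (σ := σ) (σ.2.trans_eq h.symm))
  have h2 := eigenvalue_nonneg (band_mem (V := V) (θ := θ) (σ := τ) (τ.2.trans_eq h.symm))
  have h3 : band V σ θ = band V τ θ := (pow_left_inj₀ h1 h2 (by norm_num)).1 hστ
  by_contra hne
  exact band_ne_band (σ.2.trans_eq h.symm) (τ.2.trans_eq h.symm) (fun h => hne (Fin.ext h)) h3

/-- This describes the points with the maximal number of eigenvalues as the nonvanishing set of one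
analytic function. -/
theorem CondE3.hankel_ne_zero_iff (hE3 : CondE3 V) (θ : Fin d → ℝ) :
    hankel V (bandCount V) θ ≠ 0 ↔ eigenvalueCount V θ = bandCount V := by
  constructor
  · intro h
    refine (eigenvalueCount_le_bandCount V θ).antisymm ?_
    by_contra hlt
    refine h ?_
    unfold hankel
    simp only [hE3.moment_eq θ rfl]
    exact det_moments_eq_zero (not_le.1 hlt) _ _
  · intro h
    unfold hankel
    simp only [hE3.moment_eq θ h]
    rw [det_moments]
    refine mul_ne_zero (pow_ne_zero _ (vandermonde_band_ne_zero h)) ?_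
    exact Finset.prod_ne_zero_iff.2 fun σ _ => (trace_bandProj_pos (σ.2.trans_eq h.symm)).ne'

/-- The entries are again moments with the atoms `ω_σ²`, but with the weights multiplied by `ω_σ² -
w²`; `det_moments` then yields these factors. -/
theorem CondE3.dispersion_eq (hE3 : CondE3 V) {θ : Fin d → ℝ}
    (h : eigenvalueCount V θ = bandCount V) (w : ℝ) :
    dispersion V (bandCount V) θ w = hankel V (bandCount V) θ *
      ∏ σ : Fin (bandCount V), (band V σ θ ^ 2 - w ^ 2) := by
  have h1 : (Matrix.of fun i j : Fin (bandCount V) =>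
      moment V (i + j + 1) θ - w ^ 2 * moment V (i + j) θ) =
      Matrix.of fun i j : Fin (bandCount V) => ∑ σ : Fin (bandCount V),
        ((bandProj V σ θ).trace.re * (band V σ θ ^ 2 - w ^ 2)) * (band V σ θ ^ 2) ^ ((i : ℕ) + j) := by
    ext i j
    simp only [Matrix.of_apply, hE3.moment_eq θ h, Finset.mul_sum]
    rw [← Finset.sum_sub_distrib]
    refine Finset.sum_congr rfl fun σ _ => ?_
    ring
  unfold dispersion hankel
  rw [h1, det_moments]
  simp only [hE3.moment_eq θ h]
  rw [det_moments, Finset.prod_mul_distrib]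
  ring

theorem exists_eigenvalueCount_eq (V : Interaction d n) :
    ∃ θ, eigenvalueCount V θ = bandCount V :=
  Nat.sSup_mem (s := Set.range fun θ => eigenvalueCount V θ) (Set.range_nonempty _)
    ⟨n, by rintro _ ⟨θ, rfl⟩; exact eigenvalueCount_le V θ⟩

end Bands

/-! ### Analyticity of the bands -/

section AnalyticBands

variable {d n : ℕ} {V : Interaction d n}

theorem analyticAt_det {E : Type*} [NormedAddCommGroup E] [NormedSpace ℝ E] {𝕜 : Type*} [NormedField 𝕜]
    [NormedAlgebra ℝ 𝕜] {m : Type*} [Fintype m] [DecidableEq m] {A : E → Matrix m m 𝕜} {x : E}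
    (h : ∀ i j, AnalyticAt ℝ (fun x => A x i j) x) : AnalyticAt ℝ (fun x => (A x).det) x := by
  simp only [Matrix.det_apply']
  refine Finset.analyticAt_fun_sum _ fun σ _ => ?_
  exact analyticAt_const.mul (Finset.analyticAt_fun_prod _ fun i _ => h _ _)

theorem CondE1.analyticAt_moment (hE1 : CondE1 V) (k : ℕ) (θ : Fin d → ℝ) :
    AnalyticAt ℝ (moment V k) θ := by
  have h : ∀ a b, AnalyticAt ℝ (fun θ => (fourier V θ ^ k) a b) θ := by
    induction k with
    | zero => exact fun a b => by simpa using analyticAt_const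
    | succ k ih =>
      intro a b
      simp only [pow_succ, Matrix.mul_apply]
      exact Finset.analyticAt_fun_sum _ fun c _ => (ih a c).mul (analyticAt_fourier hE1 c b θ)
  have h2 : AnalyticAt ℝ (fun θ => (fourier V θ ^ k).trace) θ := by
    simp only [Matrix.trace, Matrix.diag]
    exact Finset.analyticAt_fun_sum _ fun a _ => h a a
  exact (Complex.reCLM.analyticAt _).comp h2

theorem CondE1.analyticAt_hankel (hE1 : CondE1 V) (s : ℕ) (θ : Fin d → ℝ) :
    AnalyticAt ℝ (hankel V s) θ :=
  analyticAt_det fun _ _ => hE1.analyticAt_moment _ θ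

theorem CondE1.analyticAt_dispersion (hE1 : CondE1 V) (s : ℕ) (p : (Fin d → ℝ) × ℝ) :
    AnalyticAt ℝ (fun p : (Fin d → ℝ) × ℝ => dispersion V s p.1 p.2) p := by
  have h1 : ∀ k, AnalyticAt ℝ (fun p : (Fin d → ℝ) × ℝ => moment V k p.1) p := fun k =>
    (hE1.analyticAt_moment k p.1).comp analyticAt_fst
  exact analyticAt_det fun _ _ => (h1 _).sub ((analyticAt_snd.pow 2).mul (h1 _))

/-- The points where the number of bands is maximal and the interaction is invertible. -/
def goodSet (V : Interaction d n) : Set (Fin d → ℝ) :=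
  {θ | hankel V (bandCount V) θ ≠ 0 ∧ (fourier V θ).det ≠ 0}

theorem CondE1.isOpen_goodSet (hE1 : CondE1 V) : IsOpen (goodSet V) := by
  have h1 : Continuous (hankel V (bandCount V)) :=
    continuous_iff_continuousAt.2 fun θ => (hE1.analyticAt_hankel _ θ).continuousAt
  have h2 : Continuous fun θ => (fourier V θ).det :=
    continuous_iff_continuousAt.2 fun θ =>
      (analyticAt_det fun i j => analyticAt_fourier hE1 i j θ).continuousAt
  exact (isOpen_ne_fun h1 continuous_const).inter (isOpen_ne_fun h2 continuous_const)

theorem CondE3.count_of_mem_goodSet (hE3 : CondE3 V) {θ : Fin d → ℝ} (h : θ ∈ goodSet V) :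
    eigenvalueCount V θ = bandCount V := (hE3.hankel_ne_zero_iff θ).1 h.1

theorem volume_torusCell_ne_zero (d : ℕ) : volume (torusCell d) ≠ 0 := by
  rw [torusCell, volume_pi_pi]
  refine Finset.prod_ne_zero_iff.2 fun i _ => ?_
  simp only [Real.volume_Ioc, ne_eq, ENNReal.ofReal_eq_zero, not_le]
  linarith [Real.pi_pos]

/-- Neither analytic function is identically zero: the maximal number of eigenvalues is attained
somewhere, and E6 makes `V̂` invertible at some point. -/
theorem volume_compl_goodSet (hE1 : CondE1 V) (hE3 : CondE3 V) (hE6 : CondE6 V) :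
    volume (goodSet V)ᶜ = 0 := by
  have h1 : volume {θ | hankel V (bandCount V) θ = 0} = 0 := by
    refine volume_zeros_of_analytic (hE1.analyticAt_hankel _) ?_
    obtain ⟨θ, hθ⟩ := exists_eigenvalueCount_eq V
    exact ⟨θ, (hE3.hankel_ne_zero_iff θ).2 hθ⟩
  -- The squared modulus replaces the determinant because the lemma on zero sets concerns real
  -- functions.
  have h2 : volume {θ | Complex.normSq (fourier V θ).det = 0} = 0 := by
    refine volume_zeros_of_analytic (fun θ => ?_) ?_
    · have h := analyticAt_det fun i j => analyticAt_fourier hE1 i j θ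
      have hre := (Complex.reCLM.analyticAt _).comp h
      have him := (Complex.imCLM.analyticAt _).comp h
      exact (hre.mul hre).add (him.mul him)
    · have hne : (ae (volume.restrict (torusCell d))).NeBot := by
        rw [ae_neBot, Ne, Measure.restrict_eq_zero]
        exact volume_torusCell_ne_zero d
      obtain ⟨θ, hθ⟩ := hE6.1.exists
      exact ⟨θ, by simpa using (Matrix.isUnit_iff_isUnit_det _).1 hθ⟩
  refine measure_mono_null (fun θ hθ => ?_) (measure_union_null h1 h2)
  simp only [goodSet, Set.mem_compl_iff, Set.mem_ofPred_eq, not_and_or, not_not] at hθ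
  refine hθ.imp id fun h => ?_
  simp [h]

theorem CondE3.band_pos (hE3 : CondE3 V) {θ : Fin d → ℝ} (hθ : θ ∈ goodSet V) {σ : ℕ}
    (hσ : σ < bandCount V) : 0 < band V σ θ := by
  have hmem := band_mem (V := V) (θ := θ) (σ := σ) (by rwa [hE3.count_of_mem_goodSet hθ])
  refine lt_of_le_of_ne (eigenvalue_nonneg hmem) fun h => ?_
  rw [← h] at hmem
  have h1 : (0 : ℝ) ∈ spectrum ℝ (Omega V θ) := mem_realSpectrum.1 hmem
  rw [spectrum.zero_mem_iff, Matrix.isUnit_iff_isUnit_det, isUnit_iff_ne_zero, not_not] at h1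
  refine hθ.2 ?_
  rw [← hE3.Omega_mul_self, Matrix.det_mul, h1, zero_mul]

theorem isInvertible_of_deriv_ne_zero (L : ℝ →L[ℝ] ℝ) (h : L 1 ≠ 0) : L.IsInvertible := by
  refine ⟨ContinuousLinearEquiv.unitsEquivAut ℝ (Units.mk0 (L 1) h), ?_⟩
  ext
  simp

/-- The bands are analytic on the good set. -/
theorem analyticAt_band (hE1 : CondE1 V) (hE3 : CondE3 V) {θ₀ : Fin d → ℝ} (hθ : θ₀ ∈ goodSet V)
    {σ : ℕ} (hσ : σ < bandCount V) : AnalyticAt ℝ (band V σ) θ₀ := by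
  have hcount := hE3.count_of_mem_goodSet hθ
  set s := bandCount V with hs
  -- Every frequency at `θ₀` is a simple zero of the dispersion function in `w`, hence extends to an
  -- analytic branch by the implicit function theorem.
  have key : ∀ τ : Fin s, ∃ φ : (Fin d → ℝ) → ℝ, AnalyticAt ℝ φ θ₀ ∧ φ θ₀ = band V τ θ₀ ∧
      ∀ᶠ θ in 𝓝 θ₀, dispersion V s θ (φ θ) = 0 := by
    intro τ
    set u : (Fin d → ℝ) × ℝ := (θ₀, band V τ θ₀) with hu
    have hF := hE1.analyticAt_dispersion s u
    have hzero : dispersion V s θ₀ (band V τ θ₀) = 0 := by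
      rw [hE3.dispersion_eq hcount, Finset.prod_eq_zero (Finset.mem_univ τ) (sub_self _), mul_zero]
    -- The top smoothness class is analyticity, so the implicit function is analytic as well.
    have cdf : ContDiffAt ℝ (⊤ : WithTop ℕ∞) (fun p : (Fin d → ℝ) × ℝ => dispersion V s p.1 p.2) u :=
      hF.contDiffAt
    have hd : HasDerivAt (fun w => dispersion V s θ₀ w)
        (fderiv ℝ (fun p : (Fin d → ℝ) × ℝ => dispersion V s p.1 p.2) u (0, 1)) (band V τ θ₀) := by
      have h1 : HasFDerivAt (fun p : (Fin d → ℝ) × ℝ => dispersion V s p.1 p.2) _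
        (θ₀, band V τ θ₀) := hF.differentiableAt.hasFDerivAt
      exact h1.comp_hasDerivAt (band V τ θ₀)
        ((hasDerivAt_const (band V τ θ₀) θ₀).prodMk (hasDerivAt_id _))
    have hd2 : HasDerivAt (fun w => dispersion V s θ₀ w)
        (hankel V s θ₀ * ((-(2 * band V τ θ₀)) *
          ∏ ρ ∈ Finset.univ.erase τ, (band V ρ θ₀ ^ 2 - band V τ θ₀ ^ 2))) (band V τ θ₀) := by
      have hfun : (fun w => dispersion V s θ₀ w) = fun w => hankel V s θ₀ *
          ((band V τ θ₀ ^ 2 - w ^ 2) * ∏ ρ ∈ Finset.univ.erase τ, (band V ρ θ₀ ^ 2 - w ^ 2)) := by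
        funext w
        rw [hE3.dispersion_eq hcount, ← Finset.mul_prod_erase _ _ (Finset.mem_univ τ)]
      rw [hfun]
      refine HasDerivAt.const_mul _ ?_
      have ha : HasDerivAt (fun w : ℝ => band V τ θ₀ ^ 2 - w ^ 2) (-(2 * band V τ θ₀))
          (band V τ θ₀) := by
        simpa using (hasDerivAt_pow 2 (band V τ θ₀)).const_sub (band V τ θ₀ ^ 2)
      have hb : DifferentiableAt ℝ (fun w : ℝ => ∏ ρ ∈ Finset.univ.erase τ,
          (band V ρ θ₀ ^ 2 - w ^ 2)) (band V τ θ₀) := by fun_prop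
      have hab := ha.fun_mul hb.hasDerivAt
      rw [sub_self, zero_mul, add_zero] at hab
      exact hab
    have hne : fderiv ℝ (fun p : (Fin d → ℝ) × ℝ => dispersion V s p.1 p.2) u (0, 1) ≠ 0 := by
      rw [hd.unique hd2]
      have hpos : ∀ ρ : Fin s, 0 < band V ρ θ₀ := fun ρ => hE3.band_pos hθ ρ.2
      -- The factor `-2 ω_τ` comes from using `w²`; it is nonzero because invertibility of `V̂`
      -- excludes zero frequencies. The other factors are differences of distinct squares.
      refine mul_ne_zero hθ.1 (mul_ne_zero (by linarith [hpos τ]) ?_)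
      refine Finset.prod_ne_zero_iff.2 fun ρ hρ h => ?_
      have h3 : band V ρ θ₀ = band V τ θ₀ :=
        (pow_left_inj₀ (hpos ρ).le (hpos τ).le (by norm_num)).1 (sub_eq_zero.1 h)
      exact band_ne_band (ρ.2.trans_eq hcount.symm) (τ.2.trans_eq hcount.symm)
        (fun h => (Finset.ne_of_mem_erase hρ) (Fin.ext h)) h3
    have hinv : (fderiv ℝ (fun p : (Fin d → ℝ) × ℝ => dispersion V s p.1 p.2) u ∘L
        .inr ℝ (Fin d → ℝ) ℝ).IsInvertible := isInvertible_of_deriv_ne_zero _ (by simpa using hne)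
    have hn : (⊤ : WithTop ℕ∞) ≠ 0 := by simp
    refine ⟨cdf.implicitFunction hn hinv, ?_, cdf.implicitFunction_apply_self hn hinv, ?_⟩
    · exact (cdf.contDiffAt_implicitFunction hn hinv).analyticAt
    · filter_upwards [cdf.eventually_apply_implicitFunction hn hinv] with θ hθ
      exact hθ.trans hzero
  choose φ hφa hφ0 hφd using key
  have hcont : ∀ τ, ContinuousAt (φ τ) θ₀ := fun τ => (hφa τ).continuousAt
  have hpos : ∀ᶠ θ in 𝓝 θ₀, ∀ τ, 0 < φ τ θ := by
    refine Filter.eventually_all.2 fun τ => (hcont τ).eventually_const_lt ?_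
    rw [hφ0]
    exact hE3.band_pos hθ τ.2
  have hmono : ∀ᶠ θ in 𝓝 θ₀, ∀ τ ρ, τ < ρ → φ τ θ < φ ρ θ := by
    refine Filter.eventually_all.2 fun τ => Filter.eventually_all.2 fun ρ => ?_
    by_cases h : τ < ρ
    · have h2 : φ τ θ₀ < φ ρ θ₀ := by
        rw [hφ0, hφ0]
        exact band_lt_band (ρ.2.trans_eq hcount.symm) h
      filter_upwards [(hcont τ).eventually_lt (hcont ρ) h2] with θ h3 _ using h3
    · exact Eventually.of_forall fun θ h' => absurd h' h
  refine (hφa ⟨σ, hσ⟩).congr ?_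
  filter_upwards [hpos, hmono, Filter.eventually_all.2 hφd, hE1.isOpen_goodSet.mem_nhds hθ] with
    θ h1 h2 h3 h4
  have hc := hE3.count_of_mem_goodSet h4
  have hmem : ∀ τ, φ τ θ ∈ eigenvalueSet V θ := by
    intro τ
    have h5 := h3 τ
    rw [hE3.dispersion_eq hc, mul_eq_zero, or_iff_right h4.1, Finset.prod_eq_zero_iff] at h5
    obtain ⟨ρ, _, h6⟩ := h5
    have hm := band_mem (V := V) (θ := θ) (σ := ρ) (ρ.2.trans_eq hc.symm)
    have h7 : band V ρ θ = φ τ θ :=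
      (pow_left_inj₀ (eigenvalue_nonneg hm) (h1 τ).le (by norm_num)).1 (sub_eq_zero.1 h6)
    rwa [← h7]
  -- Near `θ₀` the branches are strictly increasing in their index, consist of eigenvalues, and are
  -- as many as there are eigenvalues. So they are the increasing enumeration, which defines the
  -- bands.
  have h8 := Finset.orderEmbOfFin_unique (s := eigenvalueSet V θ) hc hmem fun τ ρ h => h2 τ ρ h
  rw [band_eq_orderEmbOfFin hc ⟨σ, hσ⟩, ← h8]

/-- This makes E4 and E5, which speak of open subsets of the regular set, available on open subsets
of the good set. -/
theorem goodSet_subset_regularSet (hE1 : CondE1 V) (hE3 : CondE3 V) : goodSet V ⊆ regularSet V := by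
  intro θ hθ
  refine ⟨?_, fun σ hσ => analyticAt_band hE1 hE3 hθ
    (hσ.trans_le (eigenvalueCount_le_bandCount V θ))⟩
  filter_upwards [hE1.isOpen_goodSet.mem_nhds hθ] with θ' h
  rw [hE3.count_of_mem_goodSet h, hE3.count_of_mem_goodSet hθ]

end AnalyticBands

/-! ### Regularity of the spectral data on the good set -/

section SpectralData

variable {d n : ℕ} {V : Interaction d n}

theorem sum_bandProj {θ : Fin d → ℝ} {c : ℕ} (h : eigenvalueCount V θ = c) :
    ∑ σ ∈ Finset.range c, bandProj V σ θ = 1 := by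
  simp only [bandProj_eq]
  rw [← sum_eigenvalueSet V θ h fun x => spectralProj (Omega V θ) x]
  exact sum_spectralProj (isSelfAdjoint_Omega V θ)

theorem bandProj_mul_self (V : Interaction d n) (σ : ℕ) (θ : Fin d → ℝ) :
    bandProj V σ θ * bandProj V σ θ = bandProj V σ θ := by
  rw [bandProj_eq, spectralProj_mul_self]

theorem conjTranspose_bandProj (V : Interaction d n) (σ : ℕ) (θ : Fin d → ℝ) :
    (bandProj V σ θ)ᴴ = bandProj V σ θ := by
  rw [bandProj_eq, conjTranspose_spectralProj]

theorem Omega_mul_bandProj (V : Interaction d n) (σ : ℕ) (θ : Fin d → ℝ) :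
    Omega V θ * bandProj V σ θ = (band V σ θ : ℂ) • bandProj V σ θ := by
  rw [bandProj_eq, mul_spectralProj (isSelfAdjoint_Omega V θ)]

theorem bandProj_mul_Omega (V : Interaction d n) (σ : ℕ) (θ : Fin d → ℝ) :
    bandProj V σ θ * Omega V θ = (band V σ θ : ℂ) • bandProj V σ θ := by
  rw [bandProj_eq, spectralProj_mul (isSelfAdjoint_Omega V θ)]

theorem CondE3.isUnit_Omega (hE3 : CondE3 V) {θ : Fin d → ℝ} (hθ : (fourier V θ).det ≠ 0) :
    IsUnit (Omega V θ).det := by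
  rw [isUnit_iff_ne_zero]
  intro h
  rw [← hE3.Omega_mul_self, Matrix.det_mul, h, zero_mul] at hθ
  exact hθ rfl

theorem Omega_inv_mul_bandProj (hE3 : CondE3 V) {θ : Fin d → ℝ} (hθ : θ ∈ goodSet V) {σ : ℕ}
    (hσ : σ < bandCount V) :
    (Omega V θ)⁻¹ * bandProj V σ θ = ((band V σ θ)⁻¹ : ℂ) • bandProj V σ θ := by
  have h1 : (Omega V θ)⁻¹ * (Omega V θ * bandProj V σ θ) =
      (Omega V θ)⁻¹ * ((band V σ θ : ℂ) • bandProj V σ θ) := by rw [Omega_mul_bandProj]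
  rw [← mul_assoc, Matrix.nonsing_inv_mul _ (hE3.isUnit_Omega hθ.2), one_mul, mul_smul_comm] at h1
  have h2 : (band V σ θ : ℂ) ≠ 0 := by exact_mod_cast (hE3.band_pos hθ hσ).ne'
  nth_rewrite 2 [h1]
  rw [smul_smul, inv_mul_cancel₀ h2, one_smul]

theorem fourier_pow_eq_sum (hE3 : CondE3 V) {θ : Fin d → ℝ} {c : ℕ} (h : eigenvalueCount V θ = c)
    (k : ℕ) : fourier V θ ^ k = ∑ σ : Fin c, ((band V σ θ ^ 2 : ℝ) : ℂ) ^ k • bandProj V σ θ := by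
  have h1 : fourier V θ ^ k = ∑ x ∈ eigenvalueSet V θ,
      ((x : ℂ) ^ (2 * k)) • spectralProj (Omega V θ) x := by
    rw [← hE3.Omega_mul_self, ← pow_two, ← pow_mul]
    exact pow_eq_sum (isSelfAdjoint_Omega V θ) _
  rw [h1, sum_eigenvalueSet V θ h, Finset.sum_range]
  refine Finset.sum_congr rfl fun σ _ => ?_
  rw [← bandProj_eq, pow_mul, Complex.ofReal_pow]

theorem continuous_fourier (hE1 : CondE1 V) : Continuous (fourier V) :=
  continuous_matrix fun a b => continuous_iff_continuousAt.2 fun θ =>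
    (analyticAt_fourier hE1 a b θ).continuousAt

theorem continuousOn_band (hE1 : CondE1 V) (hE3 : CondE3 V) {σ : ℕ} (hσ : σ < bandCount V) :
    ContinuousOn (band V σ) (goodSet V) := fun _ hθ =>
  (analyticAt_band hE1 hE3 hθ hσ).continuousAt.continuousWithinAt

/-- Lagrange interpolation: `V̂^k = Σ_σ ω_σ^{2k} Π_σ` for `k < s` is a Vandermonde system for the
projections, invertible on the good set with continuous coefficients. -/
theorem continuousOn_bandProj (hE1 : CondE1 V) (hE3 : CondE3 V) {σ : ℕ} (hσ : σ < bandCount V) :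
    ContinuousOn (bandProj V σ) (goodSet V) := by
  set s := bandCount V with hs
  let W : (Fin d → ℝ) → Matrix (Fin s) (Fin s) ℂ := fun θ =>
    (Matrix.vandermonde fun τ : Fin s => ((band V τ θ ^ 2 : ℝ) : ℂ))
  have hWc : ContinuousOn W (goodSet V) := by
    rw [continuousOn_iff_continuous_domRestrict]
    refine continuous_matrix fun τ k => ?_
    exact continuousOn_iff_continuous_domRestrict.1 ((Complex.continuous_ofReal.comp_continuousOn
      ((continuousOn_band hE1 hE3 τ.2).pow 2)).pow _)
  have hdet : ∀ θ ∈ goodSet V, (W θ).det ≠ 0 := by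
    intro θ hθ
    have h1 := vandermonde_band_ne_zero (hE3.count_of_mem_goodSet hθ)
    have h2 : W θ = (Matrix.vandermonde fun τ : Fin s => band V τ θ ^ 2).map Complex.ofRealHom := by
      ext i j
      simp [W, Matrix.vandermonde_apply]
    have h3 := (Complex.ofRealHom.map_det (Matrix.vandermonde fun τ : Fin s => band V τ θ ^ 2)).symm
    rw [RingHom.mapMatrix_apply, ← h2] at h3
    rw [h3]
    simpa using h1
  have hinv : ContinuousOn (fun θ => (W θ).det⁻¹ • (W θ).adjugate) (goodSet V) := by
    refine ContinuousOn.smul (ContinuousOn.inv₀ ?_ hdet) ?_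
    · exact (Continuous.matrix_det continuous_id).comp_continuousOn hWc
    · exact (Continuous.matrix_adjugate continuous_id).comp_continuousOn hWc
  have hform : ∀ θ ∈ goodSet V, bandProj V σ θ =
      ∑ k : Fin s, ((W θ).det⁻¹ • (W θ).adjugate) k ⟨σ, hσ⟩ • fourier V θ ^ (k : ℕ) := by
    intro θ hθ
    have hWW : W θ * ((W θ).det⁻¹ • (W θ).adjugate) = 1 := by
      rw [mul_smul_comm, Matrix.mul_adjugate, smul_smul, inv_mul_cancel₀ (hdet θ hθ), one_smul]
    simp only [fourier_pow_eq_sum hE3 (hE3.count_of_mem_goodSet hθ), Finset.smul_sum, smul_smul]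
    rw [Finset.sum_comm]
    simp only [← Finset.sum_smul]
    have h4 : ∀ τ : Fin s, ∑ k : Fin s, ((W θ).det⁻¹ • (W θ).adjugate) k ⟨σ, hσ⟩ *
        ((band V τ θ ^ 2 : ℝ) : ℂ) ^ (k : ℕ) = (1 : Matrix (Fin s) (Fin s) ℂ) τ ⟨σ, hσ⟩ := by
      intro τ
      rw [← hWW, Matrix.mul_apply]
      refine Finset.sum_congr rfl fun k _ => ?_
      simp only [W, Matrix.vandermonde_apply]
      ring
    rw [Finset.sum_eq_single ⟨σ, hσ⟩]
    · exact ((congrArg (· • bandProj V σ θ) (h4 ⟨σ, hσ⟩)).trans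
        (by rw [Matrix.one_apply_eq, one_smul])).symm
    · intro τ _ hτ
      exact (congrArg (· • bandProj V τ θ) (h4 τ)).trans
        (by rw [Matrix.one_apply_ne hτ, zero_smul])
    · simp
  refine ContinuousOn.congr ?_ hform
  refine continuousOn_finsetSum _ fun k _ => ContinuousOn.fun_smul ?_ ?_
  · have hc : Continuous fun A : Matrix (Fin s) (Fin s) ℂ => A k ⟨σ, hσ⟩ :=
      Continuous.matrix_elem continuous_id _ _
    exact hc.comp_continuousOn hinv
  · exact ((continuous_fourier hE1).pow _).continuousOn

theorem bandDeriv_eq_fderiv (hE1 : CondE1 V) (hE3 : CondE3 V) {θ : Fin d → ℝ} (hθ : θ ∈ goodSet V)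
    {σ : ℕ} (hσ : σ < bandCount V) (l : Fin d) :
    bandDeriv V σ l θ = fderiv ℝ (band V σ) θ (Pi.single l 1) :=
  (analyticAt_band hE1 hE3 hθ hσ).differentiableAt.lineDeriv_eq_fderiv

theorem analyticOnNhd_bandDeriv (hE1 : CondE1 V) (hE3 : CondE3 V) {σ : ℕ} (hσ : σ < bandCount V)
    (l : Fin d) : AnalyticOnNhd ℝ (bandDeriv V σ l) (goodSet V) := by
  intro θ hθ
  have h1 : AnalyticAt ℝ (fun θ => fderiv ℝ (band V σ) θ (Pi.single l 1)) θ :=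
    ((ContinuousLinearMap.apply ℝ ℝ (Pi.single l (1 : ℝ) : Fin d → ℝ)).analyticAt _).comp
      (analyticAt_band hE1 hE3 hθ hσ).fderiv
  refine h1.congr ?_
  filter_upwards [hE1.isOpen_goodSet.mem_nhds hθ] with θ' hθ'
  exact (bandDeriv_eq_fderiv hE1 hE3 hθ' hσ l).symm

theorem ae_bandDeriv_ne_zero (hE1 : CondE1 V) (hE3 : CondE3 V) (hE4 : CondE4 V) (hE6 : CondE6 V)
    {σ : ℕ} (hσ : σ < bandCount V) (l : Fin d) : ∀ᵐ θ : Fin d → ℝ, bandDeriv V σ l θ ≠ 0 := by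
  have h1 := volume_zeros_of_analyticOnNhd hE1.isOpen_goodSet
    (analyticOnNhd_bandDeriv hE1 hE3 hσ l) fun U hU hne hsub =>
      hE4 l σ hσ U hU hne (hsub.trans (goodSet_subset_regularSet hE1 hE3))
  rw [ae_iff]
  refine measure_mono_null (fun θ hθ => ?_) (measure_union_null h1 (volume_compl_goodSet hE1 hE3 hE6))
  by_cases h : θ ∈ goodSet V
  · exact Or.inl ⟨h, by simpa using hθ⟩
  · exact Or.inr h

/-- The critical points of an analytic function that is not locally constant form a null set. -/
theorem volume_critical_of_analyticOnNhd {W : Set (Fin d → ℝ)} (hW : IsOpen W)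
    {f : (Fin d → ℝ) → ℝ} (hf : AnalyticOnNhd ℝ f W)
    (hne : ∀ U : Set (Fin d → ℝ), IsOpen U → U.Nonempty → U ⊆ W → ∀ c, ¬ ∀ x ∈ U, f x = c) :
    volume {x ∈ W | ∀ l, fderiv ℝ f x (Pi.single l 1) = 0} = 0 := by
  -- The sum of the squared partial derivatives is one analytic function that vanishes exactly at
  -- the critical points.
  have hg : AnalyticOnNhd ℝ (fun x => ∑ l, (fderiv ℝ f x (Pi.single l 1)) ^ 2) W := by
    intro x hx
    refine Finset.analyticAt_fun_sum _ fun l _ => AnalyticAt.pow ?_ 2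
    exact ((ContinuousLinearMap.apply ℝ ℝ (Pi.single l (1 : ℝ) : Fin d → ℝ)).analyticAt _).comp
      (hf x hx).fderiv
  refine measure_mono_null (fun x hx => ?_) (volume_zeros_of_analyticOnNhd hW hg ?_)
  · exact ⟨hx.1, by simp [hx.2]⟩
  · intro U hU ⟨x, hx⟩ hUW hzero
    obtain ⟨r, hr, hball⟩ := Metric.isOpen_iff.1 hU x hx
    refine hne (Metric.ball x r) Metric.isOpen_ball ⟨x, Metric.mem_ball_self hr⟩ (hball.trans hUW)
      (f x) fun y hy => ?_
    have hdiff : DifferentiableOn ℝ f (Metric.ball x r) := fun z hz =>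
      (hf z (hUW (hball hz))).differentiableAt.differentiableWithinAt
    have hfd : Set.EqOn (fderiv ℝ f) 0 (Metric.ball x r) := by
      intro z hz
      have h0 := hzero z (hball hz)
      rw [Finset.sum_eq_zero_iff_of_nonneg fun l _ => sq_nonneg _] at h0
      refine ContinuousLinearMap.coe_injective (LinearMap.pi_ext' fun l => ?_)
      ext
      simpa using h0 l (Finset.mem_univ l)
    exact Metric.isOpen_ball.is_const_of_fderiv_eq_zero (convex_ball x r).isPreconnected hdiff hfd hy
      (Metric.mem_ball_self hr)

theorem ae_exists_bandDeriv_ne (hE1 : CondE1 V) (hE3 : CondE3 V) (hE5 : CondE5 V) (hE6 : CondE6 V)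
    {σ τ : ℕ} (hσ : σ < bandCount V) (hτ : τ < bandCount V) (hστ : σ ≠ τ) {e : ℝ}
    (he : e = 1 ∨ e = -1) :
    ∀ᵐ θ : Fin d → ℝ, ∃ l, bandDeriv V σ l θ + e * bandDeriv V τ l θ ≠ 0 := by
  have hreg := goodSet_subset_regularSet hE1 hE3
  have hf : AnalyticOnNhd ℝ (fun θ => band V σ θ + e * band V τ θ) (goodSet V) := fun θ hθ =>
    (analyticAt_band hE1 hE3 hθ hσ).add (analyticAt_const.mul (analyticAt_band hE1 hE3 hθ hτ))
  have h1 := volume_critical_of_analyticOnNhd hE1.isOpen_goodSet hf (by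
    rintro U hU ⟨θ, hθ⟩ hUW c hc
    have hg := hUW hθ
    have hcount := hE3.count_of_mem_goodSet hg
    -- E5 excludes nonzero constants only. The constant zero cannot occur on the good set: the
    -- frequencies are positive, which settles the sum, and distinct, which settles the difference.
    have hc0 : c ≠ 0 := by
      rw [← hc θ hθ]
      rcases he with rfl | rfl
      · linarith [hE3.band_pos hg hσ, hE3.band_pos hg hτ]
      · have := band_ne_band (V := V) (θ := θ) (by rwa [hcount]) (by rwa [hcount]) hστ
        intro h
        exact this (by linarith)
    have h5 := hE5 σ hσ τ hτ hστ c hc0 U hU ⟨θ, hθ⟩ (hUW.trans hreg)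
    rcases he with rfl | rfl
    · exact h5.1 fun θ' h' => by rw [← hc θ' h']; ring
    · exact h5.2 fun θ' h' => by rw [← hc θ' h']; ring)
  rw [ae_iff]
  refine measure_mono_null (fun θ hθ => ?_) (measure_union_null h1 (volume_compl_goodSet hE1 hE3 hE6))
  by_cases h : θ ∈ goodSet V
  · refine Or.inl ⟨h, fun l => ?_⟩
    simp only [ne_eq, not_exists, not_not, Set.mem_ofPred_eq] at hθ
    have hd1 := (analyticAt_band hE1 hE3 h hσ).differentiableAt
    have hd2 := (analyticAt_band hE1 hE3 h hτ).differentiableAt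
    rw [fderiv_fun_add hd1 (hd2.const_mul e), fderiv_const_mul hd2, add_apply,
      smul_apply, ← bandDeriv_eq_fderiv hE1 hE3 h hσ, ← bandDeriv_eq_fderiv hE1 hE3 h hτ]
    exact hθ l
  · exact Or.inr h

/-! ### Periodicity -/

theorem exp_pairing_add_period (x : Lattice d) (θ : Fin d → ℝ) (m : Fin d → ℤ) :
    Complex.exp (Complex.I * (pairing x (θ + fun i => 2 * Real.pi * m i) : ℝ)) =
      Complex.exp (Complex.I * (pairing x θ : ℝ)) := by
  rw [Complex.exp_eq_exp_iff_exists_int]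
  refine ⟨∑ i, x i * m i, ?_⟩
  simp only [pairing, Pi.add_apply, mul_add, Finset.sum_add_distrib]
  push_cast
  rw [mul_add, Finset.mul_sum, Finset.mul_sum, Finset.sum_mul]
  congr 1
  refine Finset.sum_congr rfl fun i _ => ?_
  ring

theorem fourier_add_period {m : Type} (f : Lattice d → Matrix m m ℝ) (θ : Fin d → ℝ)
    (p : Fin d → ℤ) : fourier f (θ + fun i => 2 * Real.pi * p i) = fourier f θ := by
  unfold fourier
  simp only [exp_pairing_add_period]

theorem band_add_period (V : Interaction d n) (σ : ℕ) (θ : Fin d → ℝ) (p : Fin d → ℤ) :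
    band V σ (θ + fun i => 2 * Real.pi * p i) = band V σ θ := by
  simp only [band, eigenvalueSet, Omega, fourier_add_period]

end SpectralData

/-! ### The torus as a quotient of the space of angles -/

section Angles

variable {d n : ℕ}

/-- The representative in `(-π, π]^d` of a point of the torus. -/
def angle (τ : Torus d) : Fin d → ℝ := fun i =>
  2 * Real.pi * (UnitAddTorus.measurableEquivPiIoc (fun _ : Fin d => (-(1 / 2) : ℝ)) τ).1 i

theorem coe_angle_div (τ : Torus d) (i : Fin d) :
    ((angle τ i / (2 * Real.pi) : ℝ) : UnitAddCircle) = τ i := by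
  have h := (AddCircle.equivIoc 1 (-(1 / 2) : ℝ)).symm_apply_apply (τ i)
  rw [angle, mul_div_cancel_left₀ _ (by positivity)]
  exact h

theorem measurableEmbedding_angle : MeasurableEmbedding (angle : Torus d → Fin d → ℝ) := by
  have h1 : MeasurableEmbedding (fun x : Fin d → ℝ => (2 * Real.pi) • x) :=
    measurableEmbedding_const_smul₀ (by positivity)
  have h2 : MeasurableSet {x : Fin d → ℝ | ∀ i, x i ∈ Set.Ioc (-(1 / 2) : ℝ) (-(1 / 2) + 1)} :=
    MeasurableSet.univ_pi' fun i => measurableSet_Ioc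
  exact h1.comp ((MeasurableEmbedding.subtype_coe h2).comp
    (UnitAddTorus.measurableEquivPiIoc fun _ : Fin d => (-(1 / 2) : ℝ)).measurableEmbedding)

/-- The Haar measure of the torus is normalized; this is the source of the factor `(2π)^{-d}` in
`q_∞`. -/
theorem map_angle : Measure.map (angle : Torus d → Fin d → ℝ) volume =
    ENNReal.ofReal ((2 * Real.pi)⁻¹ ^ d) • volume.restrict (torusCell d) := by
  have h2 : MeasurableSet {x : Fin d → ℝ | ∀ i, x i ∈ Set.Ioc (-(1 / 2) : ℝ) (-(1 / 2) + 1)} :=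
    MeasurableSet.univ_pi' fun i => measurableSet_Ioc
  have e1 : (angle : Torus d → Fin d → ℝ) = (fun x : Fin d → ℝ => (2 * Real.pi) • x) ∘
      (Subtype.val ∘ UnitAddTorus.measurableEquivPiIoc fun _ : Fin d => (-(1 / 2) : ℝ)) := rfl
  have hm : Measurable (fun x : Fin d → ℝ => (2 * Real.pi) • x) := measurable_const_smul _
  rw [e1, ← Measure.map_map hm
    (measurable_subtype_coe.comp (MeasurableEquiv.measurable _)), ← Measure.map_map
    measurable_subtype_coe (MeasurableEquiv.measurable _),
    (UnitAddTorus.measurePreserving_equivPiIoc fun _ : Fin d => (-(1 / 2) : ℝ)).map_eq]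
  have hsub : Measure.map Subtype.val (Measure.comap Subtype.val
      (volume : Measure (Fin d → ℝ)) :
      Measure {x : Fin d → ℝ // ∀ i, x i ∈ Set.Ioc (-(1 / 2) : ℝ) (-(1 / 2) + 1)}) =
      volume.restrict {x : Fin d → ℝ | ∀ i, x i ∈ Set.Ioc (-(1 / 2) : ℝ) (-(1 / 2) + 1)} :=
    map_comap_subtype_coe h2 volume
  rw [hsub]
  have e3 : {x : Fin d → ℝ | ∀ i, x i ∈ Set.Ioc (-(1 / 2) : ℝ) (-(1 / 2) + 1)} =
      (fun x : Fin d → ℝ => (2 * Real.pi) • x) ⁻¹' torusCell d := by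
    ext x
    simp only [torusCell, Set.mem_ofPred_eq, Set.mem_preimage, Set.mem_univ_pi, Pi.smul_apply,
      smul_eq_mul, Set.mem_Ioc]
    refine forall_congr' fun i => ?_
    have := Real.pi_pos
    constructor
    · rintro ⟨h1, h2⟩
      constructor <;> nlinarith
    · rintro ⟨h1, h2⟩
      constructor <;> nlinarith
  have hcell : MeasurableSet (torusCell d) := MeasurableSet.univ_pi fun i => measurableSet_Ioc
  rw [e3, ← Measure.restrict_map hm hcell, Measure.map_addHaar_smul _ (by positivity),
    Measure.restrict_smul]
  congr 2
  rw [Module.finrank_fin_fun, abs_of_pos (by positivity), inv_pow]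

theorem ae_angle {P : (Fin d → ℝ) → Prop} (h : ∀ᵐ θ, P θ) : ∀ᵐ τ : Torus d, P (angle τ) := by
  refine ae_of_ae_map measurableEmbedding_angle.measurable.aemeasurable ?_
  rw [map_angle]
  exact Measure.ae_smul_measure (ae_restrict_of_ae h) _

theorem integral_angle {E : Type*} [NormedAddCommGroup E] [NormedSpace ℝ E] (F : (Fin d → ℝ) → E) :
    ∫ τ : Torus d, F (angle τ) = ((2 * Real.pi)⁻¹ ^ d : ℝ) • ∫ θ in torusCell d, F θ := by
  rw [← measurableEmbedding_angle.integral_map, map_angle, integral_smul_measure,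
    ENNReal.toReal_ofReal (by positivity)]

theorem integrable_angle_iff {E : Type*} [NormedAddCommGroup E] {F : (Fin d → ℝ) → E} :
    Integrable (fun τ : Torus d => F (angle τ)) ↔ IntegrableOn F (torusCell d) := by
  have h : Integrable F (Measure.map (angle : Torus d → Fin d → ℝ) volume) ↔
      Integrable (fun τ : Torus d => F (angle τ)) := measurableEmbedding_angle.integrable_map_iff
  rw [map_angle] at h
  refine h.symm.trans ?_
  exact integrable_smul_measure (by
    rw [Ne, ENNReal.ofReal_eq_zero, not_le]; positivity) ENNReal.ofReal_ne_top

theorem mFourier_eq_exp (z : Lattice d) (τ : Torus d) :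
    UnitAddTorus.mFourier z τ = Complex.exp (Complex.I * (pairing z (angle τ) : ℝ)) := by
  have h : ∀ i, _root_.fourier (z i) (τ i) = Complex.exp (Complex.I * (z i * angle τ i : ℝ)) := by
    intro i
    rw [← coe_angle_div τ i, fourier_coe_apply]
    congr 1
    have := Real.pi_ne_zero
    push_cast
    field_simp
  simp only [UnitAddTorus.mFourier, ContinuousMap.coe_mk, h]
  rw [← Complex.exp_sum, pairing]
  push_cast
  rw [Finset.mul_sum]

/-- The representative in the cell jumps at the boundary, but only by periods, which periodic
functions do not see. -/
theorem exists_angle_add (τ : Torus d) (j : Fin d) (r : ℝ) :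
    ∃ p : Fin d → ℤ, angle (τ + shiftT j r) =
      (angle τ + r • Pi.single j 1) + fun i => 2 * Real.pi * p i := by
  have h : ∀ i, ∃ p : ℤ, angle (τ + shiftT j r) i =
      (angle τ + r • Pi.single j (1 : ℝ) : Fin d → ℝ) i + 2 * Real.pi * p := by
    intro i
    have h1 := coe_angle_div (τ + shiftT j r) i
    have h2 : (((angle τ + r • Pi.single j (1 : ℝ) : Fin d → ℝ) i / (2 * Real.pi) : ℝ) : UnitAddCircle) =
        (τ + shiftT j r) i := by
      rw [Pi.add_apply, Pi.add_apply, add_div, AddCircle.coe_add, coe_angle_div, shiftT]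
      congr 1
      by_cases hij : i = j
      · subst hij
        simp
      · simp [Pi.single_eq_of_ne hij]
    rw [← h2, ← sub_eq_zero, ← AddCircle.coe_sub, AddCircle.coe_eq_zero_iff] at h1
    obtain ⟨p, hp⟩ := h1
    refine ⟨p, ?_⟩
    have hπ := Real.pi_ne_zero
    rw [zsmul_eq_mul, mul_one] at hp
    field_simp at hp
    linarith
  choose p hp using h
  exact ⟨p, funext hp⟩

theorem hasDirDeriv_angle {f : (Fin d → ℝ) → ℝ}
    (hper : ∀ θ (p : Fin d → ℤ), f (θ + fun i => 2 * Real.pi * p i) = f θ) {τ : Torus d} {j : Fin d}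
    (hf : LineDifferentiableAt ℝ f (angle τ) (Pi.single j 1)) :
    HasDirDeriv (fun τ => f (angle τ)) j (lineDeriv ℝ f (angle τ) (Pi.single j 1)) τ := by
  have h1 := hf.hasLineDerivAt.tendsto_slope_zero
  refine h1.congr fun r => ?_
  obtain ⟨p, hp⟩ := exists_angle_add τ j r
  simp only
  rw [hp, hper, smul_eq_mul, div_eq_inv_mul]

end Angles

/-! ### Functional analysis of the phase space -/

section PhaseSpaceOperators

variable {d n : ℕ} {α : ℝ}

theorem latNorm_sq (x : Lattice d) : latNorm x ^ 2 = ∑ i, (x i : ℝ) ^ 2 :=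
  Real.sq_sqrt (Finset.sum_nonneg fun _ _ => sq_nonneg _)

theorem bracket_sq (x : Lattice d) : bracket x ^ 2 = 1 + latNorm x ^ 2 :=
  Real.sq_sqrt (by positivity)

theorem bracket_neg (x : Lattice d) : bracket (-x) = bracket x := by
  simp [bracket, latNorm]

theorem bracket_le_mul (x z : Lattice d) : bracket x ≤ √2 * bracket z * bracket (x - z) := by
  have h1 : latNorm x ^ 2 ≤ 2 * latNorm z ^ 2 + 2 * latNorm (x - z) ^ 2 := by
    simp only [latNorm_sq, Finset.mul_sum, ← Finset.sum_add_distrib]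
    refine Finset.sum_le_sum fun i _ => ?_
    simp only [Pi.sub_apply, Int.cast_sub]
    nlinarith [sq_nonneg ((x i : ℝ) - 2 * z i)]
  have hz := bracket_pos z
  have hxz := bracket_pos (x - z)
  refine le_of_sq_le_sq ?_ (by positivity)
  rw [mul_pow, mul_pow, Real.sq_sqrt (by norm_num), bracket_sq, bracket_sq, bracket_sq]
  nlinarith [mul_nonneg (sq_nonneg (latNorm z)) (sq_nonneg (latNorm (x - z)))]

/-- Peetre's inequality for the weights. -/
theorem bracket_rpow_le (x z : Lattice d) (α : ℝ) :
    bracket x ^ α ≤ (√2 * bracket z) ^ |α| * bracket (x - z) ^ α := by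
  have hx := bracket_pos x
  have hz := bracket_pos z
  have hxz := bracket_pos (x - z)
  rcases le_total 0 α with hα | hα
  · rw [abs_of_nonneg hα, ← Real.mul_rpow (by positivity) hxz.le]
    exact Real.rpow_le_rpow hx.le (bracket_le_mul x z) hα
  · rw [abs_of_nonpos hα]
    have h1 : bracket (x - z) ≤ √2 * bracket z * bracket x := by
      have := bracket_le_mul (x - z) (-z)
      rwa [bracket_neg, sub_neg_eq_add, sub_add_cancel] at this
    have h2 := Real.rpow_le_rpow hxz.le h1 (neg_nonneg.2 hα)
    rw [Real.mul_rpow (by positivity) hx.le, Real.rpow_neg hxz.le, Real.rpow_neg hx.le,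
      ← div_eq_mul_inv, inv_eq_one_div, div_le_div_iff₀ (by positivity) (by positivity), one_mul] at h2
    exact h2

theorem toEllTwo_surjective (d n : ℕ) (α : ℝ) : Function.Surjective (toEllTwo d n α) := by
  intro f
  have hf := (memℓp_gen_iff (by norm_num)).1 (lp.memℓp f)
  refine ⟨⟨fun x => (bracket x ^ α)⁻¹ • f x, ?_⟩, ?_⟩
  · refine hf.congr fun x => ?_
    have hb := bracket_pos x
    rw [norm_smul, mul_pow, norm_inv, Real.norm_of_nonneg (by positivity), mul_comm 2 α,
      Real.rpow_mul hb.le]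
    norm_num
    rw [← mul_assoc, mul_inv_cancel₀ (by positivity), one_mul]
  · ext1
    funext x
    exact smul_inv_smul₀ (Real.rpow_pos_of_pos (bracket_pos x) α).ne' (f x)

/-- The phase space is isometric to `ℓ²`. -/
def ellTwoEquiv (d n : ℕ) (α : ℝ) : PhaseSpace d n α ≃ₗᵢ[ℝ] lp (fun _ : Lattice d => Site n) 2 :=
  LinearIsometryEquiv.ofSurjective ⟨toEllTwo d n α, fun _ => rfl⟩ (toEllTwo_surjective d n α)

theorem ellTwoEquiv_apply (Y : PhaseSpace d n α) (x : Lattice d) :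
    ellTwoEquiv d n α Y x = (bracket x ^ α) • Y x := rfl

instance : CompleteSpace (PhaseSpace d n α) :=
  ((ellTwoEquiv d n α).isometry.isUniformInducing.completeSpace_congr
    (ellTwoEquiv d n α).surjective).2 inferInstance

theorem phaseSpace_ext {Y Z : PhaseSpace d n α} (h : ∀ x p, Y x p = Z x p) : Y = Z :=
  Subtype.ext (funext fun x => PiLp.ext (h x))

theorem norm_apply_le (Y : PhaseSpace d n α) (x : Lattice d) :
    ‖Y x‖ ≤ (bracket x ^ α)⁻¹ * ‖Y‖ := by
  have h := lp.norm_apply_le_norm (by norm_num) (ellTwoEquiv d n α Y) x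
  have hb := Real.rpow_pos_of_pos (bracket_pos x) α
  rw [LinearIsometryEquiv.norm_map, ellTwoEquiv_apply, norm_smul, Real.norm_of_nonneg hb.le] at h
  rwa [inv_mul_eq_div, le_div_iff₀ hb, mul_comm]

/-- Evaluation of a field at a lattice point. -/
def evalSite (x : Lattice d) : PhaseSpace d n α →L[ℝ] Site n :=
  LinearMap.mkContinuous ⟨⟨fun Y => Y x, fun _ _ => rfl⟩, fun _ _ => rfl⟩ (bracket x ^ α)⁻¹
    fun Y => norm_apply_le Y x

/-- Evaluation of a coordinate of a field at a lattice point. -/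
def evalCoord (x : Lattice d) (p : Fin n ⊕ Fin n) : PhaseSpace d n α →L[ℝ] ℝ :=
  (EuclideanSpace.proj p).comp (evalSite x)

theorem evalCoord_apply (x : Lattice d) (p : Fin n ⊕ Fin n) (Y : PhaseSpace d n α) :
    evalCoord x p Y = Y x p := rfl

theorem weight_shift_le (z : Lattice d) (B : Site n →L[ℝ] Site n) (Y : Lattice d → Site n)
    (x : Lattice d) : bracket x ^ (2 * α) * ‖B (Y (x - z))‖ ^ 2 ≤
      (‖B‖ * (√2 * bracket z) ^ |α|) ^ 2 * (bracket (x - z) ^ (2 * α) * ‖Y (x - z)‖ ^ 2) := by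
  have hx := bracket_pos x
  have hz := bracket_pos z
  have hxz := bracket_pos (x - z)
  have h1 := bracket_rpow_le x z α
  have h2 := B.le_opNorm (Y (x - z))
  have h3 : bracket x ^ α * ‖B (Y (x - z))‖ ≤
      (√2 * bracket z) ^ |α| * bracket (x - z) ^ α * (‖B‖ * ‖Y (x - z)‖) := by gcongr
  have h4 := pow_le_pow_left₀ (by positivity) h3 2
  have e : ∀ y : Lattice d, bracket y ^ (2 * α) = (bracket y ^ α) ^ 2 := fun y => by
    rw [mul_comm, Real.rpow_mul (bracket_pos y).le]
    norm_num
  rw [e, e, ← mul_pow]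
  refine h4.trans (le_of_eq ?_)
  ring

/-- The operator `(T Y)(x) = B Y(x - z)`. -/
def shiftOp (z : Lattice d) (B : Site n →L[ℝ] Site n) : PhaseSpace d n α →L[ℝ] PhaseSpace d n α :=
  LinearMap.mkContinuous
    { toFun := fun Y => ⟨fun x => B (Y (x - z)), by
        have h : Summable fun x => bracket x ^ (2 * α) * ‖Y x‖ ^ 2 := Y.2
        have h2 := ((Equiv.subRight z).summable_iff
          (f := fun x => bracket x ^ (2 * α) * ‖Y x‖ ^ 2)).2 h
        refine Summable.of_nonneg_of_le (fun x => ?_) (fun x => weight_shift_le z B Y x)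
          (h2.mul_left _)
        have := bracket_pos x
        positivity⟩
      map_add' := fun Y Z => Subtype.ext <| funext fun x => B.map_add (Y (x - z)) (Z (x - z))
      map_smul' := fun c Y => Subtype.ext <| funext fun x => B.map_smul c (Y (x - z)) }
    (‖B‖ * (√2 * bracket z) ^ |α|) fun Y => by
      have hz := bracket_pos z
      refine le_of_sq_le_sq ?_ (by positivity)
      have e : (‖B‖ * (√2 * bracket z) ^ |α| * ‖Y‖) ^ 2 = ∑' x,
          (‖B‖ * (√2 * bracket z) ^ |α|) ^ 2 * (bracket x ^ (2 * α) * ‖Y x‖ ^ 2) := by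
        rw [mul_pow _ ‖Y‖, norm_sq_eq, tsum_mul_left]
      have h : Summable fun x => bracket x ^ (2 * α) * ‖Y x‖ ^ 2 := Y.2
      have h2 := ((Equiv.subRight z).summable_iff
        (f := fun x => bracket x ^ (2 * α) * ‖Y x‖ ^ 2)).2 h
      rw [e, norm_sq_eq, ← (Equiv.subRight z).tsum_eq fun x => (‖B‖ * (√2 * bracket z) ^ |α|) ^ 2 *
        (bracket x ^ (2 * α) * ‖Y x‖ ^ 2)]
      refine Summable.tsum_le_tsum (fun x => weight_shift_le z B Y x) ?_ (h2.mul_left _)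
      refine Summable.of_nonneg_of_le (fun x => ?_) (fun x => weight_shift_le z B Y x)
          (h2.mul_left _)
      have := bracket_pos x
      positivity

theorem shiftOp_apply (z : Lattice d) (B : Site n →L[ℝ] Site n) (Y : PhaseSpace d n α)
    (x : Lattice d) : shiftOp z B Y x = B (Y (x - z)) := rfl

theorem norm_shiftOp_le (z : Lattice d) (B : Site n →L[ℝ] Site n) :
    ‖(shiftOp z B : PhaseSpace d n α →L[ℝ] PhaseSpace d n α)‖ ≤ ‖B‖ * (√2 * bracket z) ^ |α| := by
  have hz := bracket_pos z
  exact LinearMap.mkContinuous_norm_le _ (by positivity) _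

/-- The elementary operators on the values at a site. -/
def siteUnit (p p' : Fin n ⊕ Fin n) : Site n →L[ℝ] Site n :=
  (EuclideanSpace.proj p' : Site n →L[ℝ] ℝ).smulRight (EuclideanSpace.single p 1)

theorem siteUnit_apply (p p' r : Fin n ⊕ Fin n) (w : Site n) :
    siteUnit p p' w r = if r = p then w p' else 0 := by
  simp [siteUnit]

/-- The force exerted by a site at distance `z`. -/
def forceKernel (V : Interaction d n) (z : Lattice d) : Site n →L[ℝ] Site n :=
  -∑ a, ∑ b, V z a b • siteUnit (Sum.inr a) (Sum.inl b)

theorem siteSum_apply {ι : Type*} (s : Finset ι) (f : ι → Site n →L[ℝ] Site n) (w : Site n)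
    (r : Fin n ⊕ Fin n) : (∑ i ∈ s, f i) w r = ∑ i ∈ s, f i w r := by
  rw [sum_apply]
  exact map_sum (EuclideanSpace.proj r : Site n →L[ℝ] ℝ) (fun i => f i w) s

theorem forceKernel_inl (V : Interaction d n) (z : Lattice d) (w : Site n) (a : Fin n) :
    forceKernel V z w (Sum.inl a) = 0 := by
  rw [forceKernel, neg_apply, PiLp.neg_apply, siteSum_apply]
  simp only [siteSum_apply, smul_apply, PiLp.smul_apply, siteUnit_apply]
  simp

theorem forceKernel_inr (V : Interaction d n) (z : Lattice d) (w : Site n) (a : Fin n) :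
    forceKernel V z w (Sum.inr a) = -∑ b, V z a b * w (Sum.inl b) := by
  rw [forceKernel, neg_apply, PiLp.neg_apply, siteSum_apply]
  simp only [siteSum_apply, smul_apply, PiLp.smul_apply, siteUnit_apply]
  simp

theorem norm_forceKernel_le (V : Interaction d n) (z : Lattice d) :
    ‖forceKernel V z‖ ≤ ‖V z‖ *
      ∑ a : Fin n, ∑ b : Fin n, ‖(siteUnit (Sum.inr a) (Sum.inl b) : Site n →L[ℝ] Site n)‖ := by
  rw [forceKernel, norm_neg, Finset.mul_sum]
  refine (norm_sum_le _ _).trans (Finset.sum_le_sum fun a _ => ?_)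
  rw [Finset.mul_sum]
  refine (norm_sum_le _ _).trans (Finset.sum_le_sum fun b _ => ?_)
  rw [norm_smul]
  exact mul_le_mul_of_nonneg_right (abs_entry_le_norm (V z) a b) (norm_nonneg _)

/-- The norm of a shift grows polynomially with its length by Peetre's inequality, and the
exponential decay of `V` outweighs this. So the generator is a bounded operator. -/
theorem CondE1.summable_shiftOp {V : Interaction d n} (hE1 : CondE1 V) :
    Summable fun z => (shiftOp z (forceKernel V z) : PhaseSpace d n α →L[ℝ] PhaseSpace d n α) := by
  obtain ⟨C, hC, γ, hγ, h⟩ := hE1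
  set K := ∑ a : Fin n, ∑ b : Fin n, ‖(siteUnit (Sum.inr a) (Sum.inl b) : Site n →L[ℝ] Site n)‖
  refine Summable.of_norm_bounded
    ((summable_exp_mul_rpow (d := d) hγ |α|).mul_left (C * K * √2 ^ |α|)) fun z => ?_
  have hz := bracket_pos z
  refine (norm_shiftOp_le z _).trans ?_
  rw [Real.mul_rpow (by positivity) hz.le]
  calc _ ≤ (C * Real.exp (-γ * latNorm z) * K) * (√2 ^ |α| * bracket z ^ |α|) := by
        gcongr
        refine (norm_forceKernel_le V z).trans ?_
        gcongr
        exact h z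
    _ = _ := by ring

/-- The generator of the dynamics. -/
def generator (V : Interaction d n) : PhaseSpace d n α →L[ℝ] PhaseSpace d n α :=
  shiftOp 0 (∑ a, siteUnit (Sum.inl a) (Sum.inr a)) + ∑' z, shiftOp z (forceKernel V z)

theorem CondE1.hasSum_generator {V : Interaction d n} (hE1 : CondE1 V) (Y : PhaseSpace d n α)
    (x : Lattice d) (p : Fin n ⊕ Fin n) :
    HasSum (fun z => forceKernel V z (Y (x - z)) p)
      (evalCoord x p ((∑' z, shiftOp z (forceKernel V z) :
        PhaseSpace d n α →L[ℝ] PhaseSpace d n α) Y)) :=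
  (hE1.summable_shiftOp.hasSum.mapL (ContinuousLinearMap.apply ℝ _ Y)).mapL (evalCoord x p)

theorem freeKernel_apply (w : Site n) (p : Fin n ⊕ Fin n) :
    (∑ a, siteUnit (Sum.inl a) (Sum.inr a) : Site n →L[ℝ] Site n) w p =
      Sum.elim (fun a => w (Sum.inr a)) (fun _ => 0) p := by
  rw [siteSum_apply]
  simp only [siteUnit_apply]
  cases p <;> simp

theorem CondE1.generator_inl {V : Interaction d n} (hE1 : CondE1 V) (Y : PhaseSpace d n α)
    (x : Lattice d) (a : Fin n) : generator V Y x (Sum.inl a) = Y x (Sum.inr a) := by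
  have h := (hE1.hasSum_generator Y x (Sum.inl a)).tsum_eq
  simp only [forceKernel_inl, tsum_zero] at h
  rw [← evalCoord_apply, generator, add_apply, map_add, ← h, add_zero, evalCoord_apply,
    shiftOp_apply, freeKernel_apply, sub_zero]
  rfl

theorem CondE1.generator_inr {V : Interaction d n} (hE1 : CondE1 V) (Y : PhaseSpace d n α)
    (x : Lattice d) (a : Fin n) : generator V Y x (Sum.inr a) =
      -∑' y : Lattice d, ∑ b, V (x - y) a b * Y y (Sum.inl b) := by
  have h := (hE1.hasSum_generator Y x (Sum.inr a)).tsum_eq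
  simp only [forceKernel_inr] at h
  rw [← evalCoord_apply, generator, add_apply, map_add, ← h, evalCoord_apply,
    shiftOp_apply, freeKernel_apply, tsum_neg, ← (Equiv.subLeft x).tsum_eq]
  simp

/-! ### The group of the dynamics -/

/-- The solution operators. -/
def propagator (V : Interaction d n) (t : ℝ) : PhaseSpace d n α →L[ℝ] PhaseSpace d n α :=
  NormedSpace.exp (t • generator V)

theorem hasDerivAt_propagator (V : Interaction d n) (Y : PhaseSpace d n α) (t : ℝ) :
    HasDerivAt (fun t => propagator V t Y) (generator V (propagator V t Y)) t := by
  have h := hasDerivAt_exp_smul_const' (𝕂 := ℝ)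
    (generator V : PhaseSpace d n α →L[ℝ] PhaseSpace d n α) t
  exact (ContinuousLinearMap.apply ℝ _ Y).hasFDerivAt.comp_hasDerivAt t h

theorem CondE1.isSolution_of_hasDerivAt {V : Interaction d n} (hE1 : CondE1 V)
    {Y : ℝ → PhaseSpace d n α} (h : ∀ t, HasDerivAt Y (generator V (Y t)) t) : IsSolution V Y := by
  refine ⟨continuous_iff_continuousAt.2 fun t => (h t).continuousAt, fun t x a => ⟨?_, ?_⟩⟩
  · rw [← hE1.generator_inl]
    exact (evalCoord x (Sum.inl a)).hasFDerivAt.comp_hasDerivAt t (h t)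
  · rw [← hE1.generator_inr]
    exact (evalCoord x (Sum.inr a)).hasFDerivAt.comp_hasDerivAt t (h t)

/-- A solution is continuous in the phase space but is differentiated only coordinate by coordinate.
The integral `W` of the right side is differentiable in norm and has the same coordinates. -/
theorem CondE1.hasDerivAt_of_isSolution {V : Interaction d n} (hE1 : CondE1 V)
    {Y : ℝ → PhaseSpace d n α} (hY : IsSolution V Y) (t : ℝ) :
    HasDerivAt Y (generator V (Y t)) t := by
  have hcont : Continuous fun t => generator V (Y t) := (generator V).continuous.comp hY.1
  set W : ℝ → PhaseSpace d n α := fun t => Y 0 + ∫ s in (0 : ℝ)..t, generator V (Y s) with hW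
  have hWd : ∀ t, HasDerivAt W (generator V (Y t)) t := fun t =>
    (hcont.integral_hasStrictDerivAt 0 t).hasDerivAt.const_add _
  have hcoord : ∀ t x p, HasDerivAt (fun s => Y s x p) (generator V (Y t) x p) t := by
    intro t x p
    rcases p with a | a
    · rw [hE1.generator_inl]
      exact (hY.2 t x a).1
    · rw [hE1.generator_inr]
      exact (hY.2 t x a).2
  have hYW : Y = W := by
    funext t
    refine phaseSpace_ext fun x p => ?_
    have h1 : ∀ t, HasDerivAt (fun s => Y s x p - W s x p) 0 t := by
      intro t
      have h2 : HasDerivAt (fun s => W s x p) (generator V (Y t) x p) t :=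
        (evalCoord x p).hasFDerivAt.comp_hasDerivAt t (hWd t)
      have h3 := (hcoord t x p).fun_sub h2
      rwa [sub_self] at h3
    have h3 := is_const_of_deriv_eq_zero (fun t => (h1 t).differentiableAt)
      (fun t => (h1 t).deriv) t 0
    have h0 : W 0 = Y 0 := by simp [hW]
    simp only [h0, sub_self] at h3
    linarith
  rw [show HasDerivAt Y (generator V (Y t)) t = HasDerivAt W (generator V (Y t)) t by rw [← hYW]]
  exact hWd t

theorem CondE1.isSolution_unique {V : Interaction d n} (hE1 : CondE1 V)
    {Y Z : ℝ → PhaseSpace d n α} (hY : IsSolution V Y) (hZ : IsSolution V Z) (h : Y 0 = Z 0) :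
    Y = Z := by
  refine ODE_solution_unique_univ (v := fun _ => generator V) (s := fun _ => Set.univ) (t₀ := 0)
    (K := ‖(generator V : PhaseSpace d n α →L[ℝ] PhaseSpace d n α)‖₊)
    (fun t => (generator V).lipschitz.lipschitzOnWith) (fun t => ⟨hE1.hasDerivAt_of_isSolution hY t,
      trivial⟩) (fun t => ⟨hE1.hasDerivAt_of_isSolution hZ t, trivial⟩) h

theorem CondE1.isSolution_propagator {V : Interaction d n} (hE1 : CondE1 V)
    (Y : PhaseSpace d n α) : IsSolution V fun t => propagator V t Y :=
  hE1.isSolution_of_hasDerivAt (hasDerivAt_propagator V Y)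

theorem propagator_zero (V : Interaction d n) (Y : PhaseSpace d n α) : propagator V 0 Y = Y := by
  simp [propagator]

theorem CondE1.eq_propagator {V : Interaction d n} (hE1 : CondE1 V) {Y : ℝ → PhaseSpace d n α}
    (hY : IsSolution V Y) (t : ℝ) : Y t = propagator V t (Y 0) :=
  congrFun (hE1.isSolution_unique hY (hE1.isSolution_propagator (Y 0))
    (propagator_zero V _).symm) t

/-- Existence and uniqueness make the choice of a solution in `evolution` immaterial. -/
theorem CondE1.evolution_eq {V : Interaction d n} (hE1 : CondE1 V) (t : ℝ) :
    (evolution V t : PhaseSpace d n α → PhaseSpace d n α) = propagator V t := by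
  funext Y
  have h : ∃ Z : ℝ → PhaseSpace d n α, IsSolution V Z ∧ Z 0 = Y :=
    ⟨_, hE1.isSolution_propagator Y, propagator_zero V Y⟩
  rw [evolution, dif_pos h, hE1.eq_propagator h.choose_spec.1, h.choose_spec.2]

end PhaseSpaceOperators

/-! ### Kernels of functionals on the phase space -/

section Functionals

variable {d n : ℕ} {α : ℝ}

/-- The field that vanishes except for one coordinate at one point, where it is one. -/
def unitField (x : Lattice d) (p : Fin n ⊕ Fin n) : PhaseSpace d n α :=
  (ellTwoEquiv d n α).symm (lp.single 2 x ((bracket x ^ α) • EuclideanSpace.single p (1 : ℝ)))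

theorem hasSum_functional (ℓ : PhaseSpace d n α →L[ℝ] ℝ) (Y : PhaseSpace d n α) :
    HasSum (fun x => ∑ p, ℓ (unitField x p) * Y x p) (ℓ Y) := by
  let e := (ellTwoEquiv d n α).symm.toContinuousLinearEquiv
  have h1 := ((lp.hasSum_single (p := 2) (by norm_num) (ellTwoEquiv d n α Y)).mapL
    (e : lp (fun _ : Lattice d => Site n) 2 →L[ℝ] PhaseSpace d n α)).mapL ℓ
  have h2 : (e : lp (fun _ : Lattice d => Site n) 2 →L[ℝ] PhaseSpace d n α)
      (ellTwoEquiv d n α Y) = Y := (ellTwoEquiv d n α).symm_apply_apply Y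
  rw [h2] at h1
  refine h1.congr_fun fun x => ?_
  let T : Site n →ₗ[ℝ] ℝ := (ℓ : PhaseSpace d n α →ₗ[ℝ] ℝ) ∘ₗ
    (e : lp (fun _ : Lattice d => Site n) 2 →ₗ[ℝ] PhaseSpace d n α) ∘ₗ
      (lp.lsingle (𝕜 := ℝ) (E := fun _ : Lattice d => Site n) 2 x)
  have h3 : ∀ w, T w = ℓ ((ellTwoEquiv d n α).symm (lp.single 2 x w)) := fun w => rfl
  have h4 : ℓ ((e : lp (fun _ : Lattice d => Site n) 2 →L[ℝ] PhaseSpace d n α)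
      (lp.single 2 x (ellTwoEquiv d n α Y x))) = T ((bracket x ^ α) • Y x) := rfl
  have h5 : Y x = ∑ p, Y x p • EuclideanSpace.single p (1 : ℝ) := by
    refine PiLp.ext fun q => ?_
    cases q <;> simp [Pi.single_apply]
  rw [h4, h5, map_smul, map_sum, Finset.smul_sum]
  refine Finset.sum_congr rfl fun p _ => ?_
  rw [unitField, ← h3, map_smul, map_smul, smul_eq_mul, smul_eq_mul, smul_eq_mul]
  rw [← h5]
  ring

/-- Bounded fields belong to the phase space. -/
def boundedField (hα : α < -(d : ℝ) / 2) (Y : Lattice d → Site n) (C : ℝ) (hY : ∀ x, ‖Y x‖ ≤ C) :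
    PhaseSpace d n α :=
  ⟨Y, by
    have hs : Summable fun x : Lattice d => bracket x ^ (2 * α) :=
      summable_bracket_rpow (by linarith)
    refine Summable.of_nonneg_of_le (fun x => ?_) (fun x => ?_) (hs.mul_right (C ^ 2))
    · have := bracket_pos x
      positivity
    · have := bracket_pos x
      gcongr
      exact hY x⟩

theorem boundedField_apply (hα : α < -(d : ℝ) / 2) (Y : Lattice d → Site n) (C : ℝ)
    (hY : ∀ x, ‖Y x‖ ≤ C) (x : Lattice d) : boundedField hα Y C hY x = Y x := rfl

/-- For `α < -d/2` bounded fields belong to the phase space, so the functional may be tested on the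
field of signs of its own coefficients. -/
theorem summable_functional (hα : α < -(d : ℝ) / 2) (ℓ : PhaseSpace d n α →L[ℝ] ℝ)
    (p : Fin n ⊕ Fin n) : Summable fun x : Lattice d => |ℓ (unitField x p)| := by
  have hb : ∀ x : Lattice d, ‖(EuclideanSpace.single p (SignType.sign (ℓ (unitField x p)) : ℝ) :
      Site n)‖ ≤ 1 := by
    intro x
    rw [PiLp.norm_single]
    rcases lt_trichotomy (ℓ (unitField x p)) 0 with h | h | h <;> simp [h]
  have h := (hasSum_functional ℓ (boundedField hα _ 1 hb)).summable
  refine h.congr fun x => ?_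
  simp only [boundedField_apply]
  rw [Finset.sum_eq_single p]
  · simp only [PiLp.single_apply, ite_true]
    rw [self_mul_sign]
  · intro q _ hq
    simp [hq]
  · simp

end Functionals

/-! ### Plane waves -/

section PlaneWaves

variable {d n : ℕ} {α : ℝ}

/-- The field `Re (e^{-i(x,θ)} w)`, as a linear function of `w`. -/
def planeWave (hα : α < -(d : ℝ) / 2) (θ : Fin d → ℝ) :
    (Fin n ⊕ Fin n → ℂ) →ₗ[ℝ] PhaseSpace d n α where
  toFun w := boundedField hα
    (fun x => WithLp.toLp 2 fun p => (Complex.exp (-(Complex.I * (pairing x θ : ℝ))) * w p).re)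
    √(∑ p, ‖w p‖ ^ 2) fun x => by
      rw [EuclideanSpace.norm_eq]
      refine Real.sqrt_le_sqrt (Finset.sum_le_sum fun p _ => ?_)
      refine pow_le_pow_left₀ (norm_nonneg _) ?_ 2
      refine (Complex.abs_re_le_norm _).trans (le_of_eq ?_)
      rw [norm_mul, ← mul_neg, ← Complex.ofReal_neg, norm_cexp_I_mul, one_mul]
  map_add' w w' := phaseSpace_ext fun x p => by
    change (_ * (w p + w' p)).re = (_ * w p).re + (_ * w' p).re
    rw [mul_add, Complex.add_re]
  map_smul' c w := phaseSpace_ext fun x p => by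
    change (_ * ((c : ℂ) * w p)).re = c * (_ * w p).re
    rw [mul_left_comm, Complex.re_ofReal_mul]

theorem planeWave_apply (hα : α < -(d : ℝ) / 2) (θ : Fin d → ℝ) (w : Fin n ⊕ Fin n → ℂ)
    (x : Lattice d) (p : Fin n ⊕ Fin n) : planeWave hα θ w x p =
      (Complex.exp (-(Complex.I * (pairing x θ : ℝ))) * w p).re := rfl

/-- The Fourier transform of the generator. -/
def symbol (V : Interaction d n) (θ : Fin d → ℝ) : BlockMatrix n ℂ :=
  Matrix.fromBlocks 0 1 (-fourier V θ) 0

theorem symbol_mulVec_inl (V : Interaction d n) (θ : Fin d → ℝ) (w : Fin n ⊕ Fin n → ℂ) (a : Fin n) :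
    (symbol V θ *ᵥ w) (Sum.inl a) = w (Sum.inr a) := by
  simp [symbol, Matrix.mulVec, dotProduct, Matrix.one_apply]

theorem symbol_mulVec_inr (V : Interaction d n) (θ : Fin d → ℝ) (w : Fin n ⊕ Fin n → ℂ) (a : Fin n) :
    (symbol V θ *ᵥ w) (Sum.inr a) = -∑ b, fourier V θ a b * w (Sum.inl b) := by
  simp [symbol, Matrix.mulVec, dotProduct]

theorem CondE1.hasSum_fourier {V : Interaction d n} (hE1 : CondE1 V) (a b : Fin n)
    (θ : Fin d → ℝ) :
    HasSum (fun z => Complex.exp (Complex.I * (pairing z θ : ℝ)) * (V z a b : ℂ))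
      (fourier V θ a b) := by
  have h : Summable fun z => Complex.exp (Complex.I * (pairing z θ : ℝ)) * (V z a b : ℂ) := by
    refine Summable.of_norm_bounded (hE1.summable_entry a b) fun z => ?_
    rw [norm_mul, norm_cexp_I_mul, one_mul, Complex.norm_real, Real.norm_eq_abs]
  exact h.hasSum

theorem pairing_sub (x y : Lattice d) (θ : Fin d → ℝ) :
    pairing (x - y) θ = pairing x θ - pairing y θ := by
  simp [pairing, sub_mul]

/-- Convolution with `V` multiplies `e^{-i(x,θ)}` by `V̂(θ)`, as the substitution `y = x - z` shows.
-/
theorem CondE1.generator_planeWave {V : Interaction d n} (hE1 : CondE1 V) (hα : α < -(d : ℝ) / 2)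
    (θ : Fin d → ℝ) (w : Fin n ⊕ Fin n → ℂ) :
    generator V (planeWave hα θ w) = planeWave hα θ (symbol V θ *ᵥ w) := by
  refine phaseSpace_ext fun x p => ?_
  rcases p with a | a
  · rw [hE1.generator_inl, planeWave_apply, planeWave_apply, symbol_mulVec_inl]
  · rw [hE1.generator_inr, planeWave_apply, symbol_mulVec_inr]
    have h1 : HasSum (fun z => ∑ b, Complex.exp (Complex.I * (pairing z θ : ℝ)) * (V z a b : ℂ) *
        (Complex.exp (-(Complex.I * (pairing x θ : ℝ))) * w (Sum.inl b)))
        (∑ b, fourier V θ a b * (Complex.exp (-(Complex.I * (pairing x θ : ℝ))) * w (Sum.inl b))) :=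
      hasSum_sum fun b _ => (hE1.hasSum_fourier a b θ).mul_right _
    have h2 := (Complex.hasSum_re h1).tsum_eq
    rw [← (Equiv.subLeft x).tsum_eq]
    simp only [Equiv.subLeft_apply, sub_sub_cancel, planeWave_apply]
    rw [mul_neg, Complex.neg_re, Finset.mul_sum]
    congr 1
    refine Eq.trans (tsum_congr fun z => ?_) (h2.trans (congrArg Complex.re ?_))
    · rw [Complex.re_sum]
      refine Finset.sum_congr rfl fun b _ => ?_
      rw [pairing_sub, ← Complex.re_ofReal_mul]
      congr 1
      have : Complex.exp (-(Complex.I * ((pairing x θ - pairing z θ : ℝ) : ℂ))) =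
          Complex.exp (Complex.I * (pairing z θ : ℝ)) *
            Complex.exp (-(Complex.I * (pairing x θ : ℝ))) := by
        rw [← Complex.exp_add]
        congr 1
        push_cast
        ring
      rw [this]
      ring
    · refine Finset.sum_congr rfl fun b _ => ?_
      ring

/-- Plane waves evolve by the exponential of the symbol. -/
theorem CondE1.propagator_planeWave {V : Interaction d n} (hE1 : CondE1 V)
    (hα : α < -(d : ℝ) / 2) (θ : Fin d → ℝ) {M : ℝ → BlockMatrix n ℂ} (hM0 : M 0 = 1)
    (hM : ∀ t p q, HasDerivAt (fun t => M t p q) ((symbol V θ * M t) p q) t) (t : ℝ)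
    (w : Fin n ⊕ Fin n → ℂ) :
    propagator V t (planeWave hα θ w) = planeWave hα θ (M t *ᵥ w) := by
  let P : (Fin n ⊕ Fin n → ℂ) →L[ℝ] PhaseSpace d n α := LinearMap.toContinuousLinearMap (planeWave hα θ)
  have h1 : ∀ t, HasDerivAt (fun t => M t *ᵥ w) (symbol V θ *ᵥ (M t *ᵥ w)) t := by
    intro t
    rw [Matrix.mulVec_mulVec, hasDerivAt_pi]
    intro p
    simp only [Matrix.mulVec, dotProduct]
    exact HasDerivAt.fun_sum fun q _ => (hM t p q).mul_const (w q)
  have h2 : IsSolution V fun t => P (M t *ᵥ w) := by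
    refine hE1.isSolution_of_hasDerivAt fun t => ?_
    have h3 := P.hasFDerivAt.comp_hasDerivAt t (h1 t)
    rw [show P (M t *ᵥ w) = planeWave hα θ (M t *ᵥ w) from rfl, hE1.generator_planeWave]
    exact h3
  have h4 := hE1.eq_propagator h2 t
  rw [hM0, Matrix.one_mulVec] at h4
  exact h4.symm

/-- The matrix elements of the solution operators. -/
def greenFunction (V : Interaction d n) (α t : ℝ) (x : Lattice d) (p : Fin n ⊕ Fin n)
    (x' : Lattice d) (p' : Fin n ⊕ Fin n) : ℝ :=
  propagator V t (unitField x' p' : PhaseSpace d n α) x p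

theorem hasSum_greenFunction (V : Interaction d n) (t : ℝ) (x : Lattice d) (p : Fin n ⊕ Fin n)
    (Y : PhaseSpace d n α) :
    HasSum (fun x' => ∑ p', greenFunction V α t x p x' p' * Y x' p') (propagator V t Y x p) :=
  hasSum_functional ((evalCoord x p).comp (propagator V t)) Y

theorem summable_greenFunction (hα : α < -(d : ℝ) / 2) (V : Interaction d n) (t : ℝ)
    (x : Lattice d) (p p' : Fin n ⊕ Fin n) : Summable fun x' => |greenFunction V α t x p x' p'| :=
  summable_functional hα ((evalCoord x p).comp (propagator V t)) p'

/-- The functional `Y ↦ (U(t)Y)(x)_p` is evaluated at a plane wave in two ways: through its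
coefficients and through the evolution of plane waves. -/
theorem CondE1.hasSum_fourier_greenFunction {V : Interaction d n} (hE1 : CondE1 V)
    (hα : α < -(d : ℝ) / 2) {θ : Fin d → ℝ} {M : ℝ → BlockMatrix n ℂ} (hM0 : M 0 = 1)
    (hM : ∀ t p q, HasDerivAt (fun t => M t p q) ((symbol V θ * M t) p q) t) (t : ℝ)
    (x : Lattice d) (p p' : Fin n ⊕ Fin n) :
    HasSum (fun x' => Complex.exp (-(Complex.I * (pairing x' θ : ℝ))) *
      (greenFunction V α t x p x' p' : ℂ))
      (Complex.exp (-(Complex.I * (pairing x θ : ℝ))) * M t p p') := by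
  -- The fields are real, so only real parts are accessible; `c = 1` gives the real part of the
  -- claim and `c = -i` the imaginary part.
  have h : ∀ c : ℂ, HasSum (fun x' => (Complex.exp (-(Complex.I * (pairing x' θ : ℝ))) *
      (greenFunction V α t x p x' p' : ℂ) * c).re)
      (Complex.exp (-(Complex.I * (pairing x θ : ℝ))) * M t p p' * c).re := by
    intro c
    have h1 := hasSum_greenFunction V t x p (planeWave hα θ (Pi.single p' c))
    rw [hE1.propagator_planeWave hα θ hM0 hM, planeWave_apply, Matrix.mulVec_single] at h1
    have e : (Complex.exp (-(Complex.I * (pairing x θ : ℝ))) * M t p p' * c).re =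
        (Complex.exp (-(Complex.I * (pairing x θ : ℝ))) * (MulOpposite.op c • (M t).col p') p).re := by
      simp [mul_assoc]
    rw [e]
    refine h1.congr_fun fun x' => ?_
    rw [Finset.sum_eq_single p']
    · rw [planeWave_apply, Pi.single_eq_same, ← Complex.re_ofReal_mul]
      congr 1
      ring
    · intro q _ hq
      rw [planeWave_apply, Pi.single_eq_of_ne hq]
      simp
    · simp
  rw [Complex.hasSum_iff]
  constructor
  · simpa using h 1
  · have h2 := h (-Complex.I)
    simpa only [mul_neg, Complex.neg_re, Complex.mul_I_re, neg_neg] using h2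

end PlaneWaves

/-! ### Fourier coefficients of absolutely convergent series -/

section FourierCoefficients

variable {d : ℕ}

theorem integral_mFourier_mul (y z : Lattice d) :
    ∫ τ : Torus d, UnitAddTorus.mFourier (-y) τ * UnitAddTorus.mFourier z τ =
      if y = z then 1 else 0 := by
  have h := orthonormal_iff_ite.1 (UnitAddTorus.orthonormal_mFourier (d := Fin d)) y z
  rw [UnitAddTorus.mFourierLp, UnitAddTorus.mFourierLp, ContinuousMap.inner_toLp] at h
  rw [← h]
  refine integral_congr_ae (ae_of_all _ fun τ => ?_)
  simp only [UnitAddTorus.mFourier_neg]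
  ring

/-- An absolutely convergent Fourier series is the Fourier series of its sum. -/
theorem mFourierCoeff_of_hasSum {g : Lattice d → ℂ} (hg : Summable fun y => ‖g y‖)
    {G : Torus d → ℂ} (hG : ∀ᵐ τ, HasSum (fun y => UnitAddTorus.mFourier y τ * g y) (G τ))
    (y : Lattice d) : UnitAddTorus.mFourierCoeff G y = g y := by
  have hi : ∀ z, Integrable fun τ : Torus d =>
      UnitAddTorus.mFourier (-y) τ * (UnitAddTorus.mFourier z τ * g z) := fun z =>
    (Continuous.integrable_of_hasCompactSupport (by fun_prop) (HasCompactSupport.of_compactSpace _))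
  have h1 := hasSum_integral_of_summable_integral_norm hi (by
    simpa only [norm_mul, norm_mFourier_apply, one_mul, integral_const, probReal_univ, one_smul]
      using hg)
  have h2 : ∀ z, ∫ τ : Torus d, UnitAddTorus.mFourier (-y) τ * (UnitAddTorus.mFourier z τ * g z) =
      if z = y then g z else 0 := by
    intro z
    simp only [← mul_assoc]
    rw [integral_mul_const, integral_mFourier_mul]
    by_cases h : y = z
    · simp [h]
    · simp [h, Ne.symm h]
  simp only [h2] at h1
  have h3 := h1.unique (hasSum_ite_eq y (g y) |>.congr_fun fun z => by
    by_cases h : z = y <;> simp [h])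
  rw [← h3, UnitAddTorus.mFourierCoeff]
  refine integral_congr_ae ?_
  filter_upwards [hG] with τ hτ
  rw [smul_eq_mul, tsum_mul_left, hτ.tsum_eq]

end FourierCoefficients

/-! ### Second moments of series of random variables -/

section Series

variable {Ω ι κ : Type*} [MeasurableSpace Ω] {μ : Measure Ω}

/-- The partial sums converge in `L²`, hence almost everywhere along a sequence of finite sets,
where their limit must be the pointwise sum. -/
theorem ae_eq_tsum_toLp [Countable ι] {X : ι → Ω → ℝ} (hX : ∀ i, MemLp (X i) 2 μ)
    (hs : Summable fun i => ‖(hX i).toLp (X i)‖) {S : Ω → ℝ}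
    (hS : ∀ ω, HasSum (fun i => X i ω) (S ω)) : ⇑(∑' i, (hX i).toLp (X i)) =ᵐ[μ] S := by
  have h1 : HasSum (fun i => (hX i).toLp (X i)) (∑' i, (hX i).toLp (X i)) := hs.of_norm.hasSum
  have h2 := tendstoInMeasure_of_tendsto_Lp h1
  obtain ⟨s, hs1, hs2⟩ := h2.exists_seq_tendsto_ae'
  have h3 : ∀ u : Finset ι, ∀ᵐ ω ∂μ, (∑ i ∈ u, (hX i).toLp (X i) : Lp ℝ 2 μ) ω = ∑ i ∈ u, X i ω := by
    classical
    intro u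
    induction u using Finset.induction_on with
    | empty => filter_upwards [Lp.coeFn_zero ℝ 2 μ] with ω hω using by simpa using hω
    | insert i u hi ih =>
      rw [Finset.sum_insert hi]
      filter_upwards [ih, Lp.coeFn_add ((hX i).toLp (X i)) (∑ i ∈ u, (hX i).toLp (X i)),
        (hX i).coeFn_toLp] with ω a1 a2 a3
      rw [a2, Pi.add_apply, a1, a3, Finset.sum_insert hi]
  have h4 : ∀ᵐ ω ∂μ, ∀ m : ℕ, (∑ i ∈ s m, (hX i).toLp (X i) : Lp ℝ 2 μ) ω = ∑ i ∈ s m, X i ω :=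
    ae_all_iff.2 fun m => h3 (s m)
  filter_upwards [hs2, h4] with ω a1 a2
  simp only [a2] at a1
  exact tendsto_nhds_unique a1 ((hS ω).comp hs1)

theorem memLp_of_hasSum [Countable ι] {X : ι → Ω → ℝ} (hX : ∀ i, MemLp (X i) 2 μ)
    (hs : Summable fun i => ‖(hX i).toLp (X i)‖) {S : Ω → ℝ}
    (hS : ∀ ω, HasSum (fun i => X i ω) (S ω)) : MemLp S 2 μ :=
  (memLp_congr_ae (ae_eq_tsum_toLp hX hs hS)).1 (Lp.memLp _)

/-- The integral is an inner product in `L²`, which is continuous in each argument and so passes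
through both series. -/
theorem integral_mul_of_hasSum [Countable ι] [Countable κ] {X : ι → Ω → ℝ}
    (hX : ∀ i, MemLp (X i) 2 μ) (hs : Summable fun i => ‖(hX i).toLp (X i)‖) {S : Ω → ℝ}
    (hS : ∀ ω, HasSum (fun i => X i ω) (S ω)) {Z : κ → Ω → ℝ} (hZ : ∀ i, MemLp (Z i) 2 μ)
    (hs' : Summable fun i => ‖(hZ i).toLp (Z i)‖) {R : Ω → ℝ}
    (hR : ∀ ω, HasSum (fun i => Z i ω) (R ω)) :
    ∫ ω, S ω * R ω ∂μ = ∑' i, ∑' j, ∫ ω, X i ω * Z j ω ∂μ := by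
  have h1 := ae_eq_tsum_toLp hX hs hS
  have h2 := ae_eq_tsum_toLp hZ hs' hR
  have e1 : ∫ ω, S ω * R ω ∂μ = inner ℝ (∑' i, (hX i).toLp (X i)) (∑' j, (hZ j).toLp (Z j)) := by
    rw [L2.inner_def]
    refine integral_congr_ae ?_
    filter_upwards [h1, h2] with ω a1 a2
    rw [a1, a2]
    simp [mul_comm]
  have e2 : ∀ i j, inner ℝ ((hX i).toLp (X i)) ((hZ j).toLp (Z j)) = ∫ ω, X i ω * Z j ω ∂μ := by
    intro i j
    rw [L2.inner_def]
    refine integral_congr_ae ?_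
    filter_upwards [(hX i).coeFn_toLp, (hZ j).coeFn_toLp] with ω a1 a2
    rw [a1, a2]
    simp [mul_comm]
  have h3 := hs.of_norm.hasSum.mapL (innerSLFlip ℝ (∑' j, (hZ j).toLp (Z j)))
  rw [e1]
  refine h3.tsum_eq.symm.trans (tsum_congr fun i => ?_)
  have h4 := hs'.of_norm.hasSum.mapL (innerSL ℝ ((hX i).toLp (X i)))
  refine h4.tsum_eq.symm.trans (tsum_congr fun j => ?_)
  exact e2 i j

theorem norm_toLp_le {X : Ω → ℝ} (hX : MemLp X 2 μ) {B : ℝ} (hB : 0 ≤ B)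
    (h : ∫ ω, X ω * X ω ∂μ ≤ B ^ 2) : ‖hX.toLp X‖ ≤ B := by
  refine le_of_sq_le_sq ?_ hB
  rw [← real_inner_self_eq_norm_sq, L2.inner_def]
  refine le_trans (le_of_eq (integral_congr_ae ?_)) h
  filter_upwards [hX.coeFn_toLp] with ω a1
  rw [a1]
  simp [pow_two]

end Series

/-! ### The evolved correlations -/

section EvolvedCorrelations

variable {d n : ℕ} {α : ℝ} {V : Interaction d n} {μ₀ : Measure (PhaseSpace d n α)}

/-- Uniform bound of the initial correlations. -/
theorem CondS2.exists_bound (hS2 : CondS2 μ₀) : ∃ B : ℝ, 0 ≤ B ∧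
    ∀ x y p q, |correlation μ₀ x y p q| ≤ B := by
  obtain ⟨-, h, -, hs, hb⟩ := hS2
  have h0 : ∀ z : Lattice d, |h (latNorm z)| ≤ ∑' z : Lattice d, |h (latNorm z)| := fun z =>
    hs.abs.le_tsum z fun _ _ => abs_nonneg _
  exact ⟨∑' z : Lattice d, |h (latNorm z)|, tsum_nonneg fun _ => abs_nonneg _,
    fun x y p q => (hb x y p q).trans ((le_abs_self _).trans (h0 _))⟩

/-- The contribution of the initial values at `x'` to the value at `x`. -/
def contribution (V : Interaction d n) (t : ℝ) (x : Lattice d) (p : Fin n ⊕ Fin n)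
    (x' : Lattice d) (Y : PhaseSpace d n α) : ℝ :=
  ∑ p', greenFunction V α t x p x' p' * Y x' p'

theorem CondS2.memLp_contribution (hS2 : CondS2 μ₀) (t : ℝ) (x : Lattice d) (p : Fin n ⊕ Fin n)
    (x' : Lattice d) : MemLp (contribution V t x p x') 2 μ₀ :=
  memLp_finsetSum _ fun p' _ => (hS2.1 x' p').const_mul _

theorem CondS2.integral_contribution_mul (hS2 : CondS2 μ₀) (t : ℝ) (x y : Lattice d)
    (p q : Fin n ⊕ Fin n) (x' y' : Lattice d) :
    ∫ Y, contribution V t x p x' Y * contribution V t y q y' Y ∂μ₀ = ∑ p', ∑ q',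
      greenFunction V α t x p x' p' * correlation μ₀ x' y' p' q' * greenFunction V α t y q y' q' := by
  have hi : ∀ p' q', Integrable (fun Y : PhaseSpace d n α => greenFunction V α t x p x' p' *
      greenFunction V α t y q y' q' * (Y x' p' * Y y' q')) μ₀ := fun p' q' =>
    (MemLp.integrable_mul (p := 2) (q := 2) (hS2.1 x' p') (hS2.1 y' q')).const_mul _
  have e : ∀ Y : PhaseSpace d n α, contribution V t x p x' Y * contribution V t y q y' Y = ∑ p', ∑ q',
      greenFunction V α t x p x' p' * greenFunction V α t y q y' q' * (Y x' p' * Y y' q') := by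
    intro Y
    rw [contribution, contribution, Finset.sum_mul_sum]
    refine Finset.sum_congr rfl fun p' _ => Finset.sum_congr rfl fun q' _ => ?_
    ring
  simp only [e]
  rw [integral_finsetSum _ fun p' _ => integrable_finsetSum _ fun q' _ => hi p' q']
  refine Finset.sum_congr rfl fun p' _ => ?_
  rw [integral_finsetSum _ fun q' _ => hi p' q']
  refine Finset.sum_congr rfl fun q' _ => ?_
  rw [integral_const_mul, correlation, Matrix.of_apply]
  ring

/-- The initial variances are bounded by `B`, so a contribution has `L²` norm at most `√B` times the
absolute values of the Green function, which are summable. -/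
theorem CondS2.summable_norm_contribution (hS2 : CondS2 μ₀) (hα : α < -(d : ℝ) / 2) (t : ℝ)
    (x : Lattice d) (p : Fin n ⊕ Fin n) :
    Summable fun x' => ‖(hS2.memLp_contribution (V := V) t x p x').toLp _‖ := by
  obtain ⟨B, hB0, hB⟩ := hS2.exists_bound
  have hs : Summable fun x' => √B * ∑ p', |greenFunction V α t x p x' p'| :=
    (summable_sum fun p' _ => summable_greenFunction hα V t x p p').mul_left _
  refine Summable.of_nonneg_of_le (fun _ => norm_nonneg _) (fun x' => ?_) hs
  refine norm_toLp_le _ (by positivity) ?_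
  rw [hS2.integral_contribution_mul, mul_pow, Real.sq_sqrt hB0, pow_two, Finset.sum_mul_sum,
    Finset.mul_sum]
  refine Finset.sum_le_sum fun p' _ => ?_
  rw [Finset.mul_sum]
  refine Finset.sum_le_sum fun q' _ => (le_abs_self _).trans ?_
  rw [abs_mul, abs_mul]
  nlinarith [hB x' x' p' q', mul_nonneg (abs_nonneg (greenFunction V α t x p x' p'))
    (abs_nonneg (greenFunction V α t x p x' q'))]

theorem CondE1.measurable_evolution (hE1 : CondE1 V) (t : ℝ) :
    Measurable (evolution V t : PhaseSpace d n α → PhaseSpace d n α) := by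
  rw [hE1.evolution_eq]
  exact (propagator V t).continuous.measurable

theorem measurable_coord (x : Lattice d) (p : Fin n ⊕ Fin n) :
    Measurable fun Y : PhaseSpace d n α => Y x p :=
  (evalCoord x p).continuous.measurable

theorem hasSecondMoments_evolvedMeasure (hE1 : CondE1 V) (hα : α < -(d : ℝ) / 2)
    (hS2 : CondS2 μ₀) (t : ℝ) : HasSecondMoments (evolvedMeasure V μ₀ t) := by
  intro x p
  rw [evolvedMeasure, memLp_map_measure_iff (measurable_coord x p).aestronglyMeasurable
    (hE1.measurable_evolution t).aemeasurable, hE1.evolution_eq]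
  exact memLp_of_hasSum (fun x' => hS2.memLp_contribution t x p x')
    (hS2.summable_norm_contribution hα t x p) (hasSum_greenFunction V t x p)

theorem correlation_evolvedMeasure (hE1 : CondE1 V) (hα : α < -(d : ℝ) / 2)
    (hS2 : CondS2 μ₀) (t : ℝ) (x y : Lattice d) (p q : Fin n ⊕ Fin n) :
    correlation (evolvedMeasure V μ₀ t) x y p q = ∑' x', ∑' y', ∑ p', ∑ q',
      greenFunction V α t x p x' p' * correlation μ₀ x' y' p' q' * greenFunction V α t y q y' q' := by
  rw [correlation, Matrix.of_apply, evolvedMeasure, integral_map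
    (hE1.measurable_evolution t).aemeasurable
    ((measurable_coord x p).fun_mul (measurable_coord y q)).aestronglyMeasurable, hE1.evolution_eq,
    integral_mul_of_hasSum (fun x' => hS2.memLp_contribution t x p x')
    (hS2.summable_norm_contribution hα t x p) (hasSum_greenFunction V t x p)
    (fun y' => hS2.memLp_contribution t y q y')
    (hS2.summable_norm_contribution hα t y q) (hasSum_greenFunction V t y q)]
  simp only [hS2.integral_contribution_mul]

theorem summable_kernel {Q : Lattice d → Lattice d → ℝ} {B : ℝ} (hQ : ∀ x y, |Q x y| ≤ B)
    {f g : Lattice d → ℂ} (hf : Summable fun x => ‖f x‖) (hg : Summable fun y => ‖g y‖) :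
    Summable fun w : Lattice d × Lattice d => conj (f w.1) * (Q w.1 w.2 : ℂ) * g w.2 := by
  refine Summable.of_norm_bounded ((hf.mul_of_nonneg hg (fun _ => norm_nonneg _)
    (fun _ => norm_nonneg _)).mul_left B) fun w => ?_
  rw [norm_mul, norm_mul, RCLike.norm_conj, Complex.norm_real, Real.norm_eq_abs]
  nlinarith [hQ w.1 w.2, mul_nonneg (norm_nonneg (f w.1)) (norm_nonneg (g w.2))]

theorem kernelForm_eq_tsum {Q : Lattice d → Lattice d → ℝ} {B : ℝ} (hQ : ∀ x y, |Q x y| ≤ B)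
    {f g : Lattice d → ℂ} (hf : Summable fun x => ‖f x‖) (hg : Summable fun y => ‖g y‖) :
    HasSum (fun w : Lattice d × Lattice d => conj (f w.1) * (Q w.1 w.2 : ℂ) * g w.2)
      (kernelForm Q f g) := by
  have hs := summable_kernel hQ hf hg
  -- `kernelForm` sums over the difference `z` and the second point `y`; this is the change to the
  -- pair of points `(y + z, y)`.
  let e : Lattice d × Lattice d ≃ Lattice d × Lattice d :=
    { toFun := fun w => (w.2 + w.1, w.2)
      invFun := fun w => (w.1 - w.2, w.2)
      left_inv := fun w => by simp
      right_inv := fun w => by simp }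
  have hs2 := (e.summable_iff (f := fun w : Lattice d × Lattice d =>
    conj (f w.1) * (Q w.1 w.2 : ℂ) * g w.2)).2 hs
  have h2 : kernelForm Q f g = ∑' w : Lattice d × Lattice d,
      conj (f w.1) * (Q w.1 w.2 : ℂ) * g w.2 := by
    rw [← e.tsum_eq]
    exact hs2.tsum_prod.symm
  rw [h2]
  exact hs.hasSum

/-- The evolved correlations as forms with the kernel of the initial correlations. -/
theorem correlation_eq_sum_kernelForm (hE1 : CondE1 V) (hα : α < -(d : ℝ) / 2)
    (hS2 : CondS2 μ₀) (t : ℝ) (x y : Lattice d) (p q : Fin n ⊕ Fin n) :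
    (correlation (evolvedMeasure V μ₀ t) x y p q : ℂ) = ∑ p', ∑ q',
      kernelForm (fun x' y' => correlation μ₀ x' y' p' q')
        (fun x' => (greenFunction V α t x p x' p' : ℂ))
        (fun y' => (greenFunction V α t y q y' q' : ℂ)) := by
  obtain ⟨B, hB0, hB⟩ := hS2.exists_bound
  have hg : ∀ x p p', Summable fun x' => ‖(greenFunction V α t x p x' p' : ℂ)‖ := by
    intro x p p'
    simpa only [Complex.norm_real, Real.norm_eq_abs] using summable_greenFunction hα V t x p p'
  have h1 := hasSum_sum (s := Finset.univ) fun p' _ => hasSum_sum (s := Finset.univ) fun q' _ =>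
    kernelForm_eq_tsum (fun x' y' => hB x' y' p' q') (hg x p p') (hg y q q')
  rw [correlation_evolvedMeasure hE1 hα hS2, ← h1.tsum_eq, h1.summable.tsum_prod]
  push_cast
  simp only [Complex.conj_ofReal]

end EvolvedCorrelations

/-! ### Modes of the symbol -/

section Modes

variable {d n : ℕ} {V : Interaction d n}

/-- The spectral projection, acting on each of the two components. -/
def blockProj (V : Interaction d n) (σ : ℕ) (θ : Fin d → ℝ) : BlockMatrix n ℂ :=
  Matrix.fromBlocks (bandProj V σ θ) 0 0 (bandProj V σ θ)

/-- The component of the symbol that oscillates with frequency `-ε ω_σ`. -/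
def modeMat (V : Interaction d n) (σ : ℕ) (ε : ℝ) (θ : Fin d → ℝ) : BlockMatrix n ℂ :=
  (1 / 2 : ℂ) • ((1 + (Complex.I * ε) • opC V θ) * blockProj V σ θ)

theorem opC_mul_blockProj (hE3 : CondE3 V) {θ : Fin d → ℝ} (hθ : θ ∈ goodSet V) {σ : ℕ}
    (hσ : σ < bandCount V) : opC V θ * blockProj V σ θ =
      Matrix.fromBlocks 0 (((band V σ θ)⁻¹ : ℂ) • bandProj V σ θ)
        (-((band V σ θ : ℂ) • bandProj V σ θ)) 0 := by
  rw [opC, blockProj, Matrix.fromBlocks_multiply]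
  simp [Omega_inv_mul_bandProj hE3 hθ hσ, Omega_mul_bandProj]

theorem blockProj_mul_opC (hE3 : CondE3 V) {θ : Fin d → ℝ} (hθ : θ ∈ goodSet V) {σ : ℕ}
    (hσ : σ < bandCount V) : blockProj V σ θ * opC V θ = opC V θ * blockProj V σ θ := by
  have h1 : bandProj V σ θ * (Omega V θ)⁻¹ = ((band V σ θ)⁻¹ : ℂ) • bandProj V σ θ := by
    have h := congrArg Matrix.conjTranspose (Omega_inv_mul_bandProj hE3 hθ hσ)
    rw [Matrix.conjTranspose_mul, conjTranspose_bandProj, Matrix.conjTranspose_smul,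
      conjTranspose_bandProj, Matrix.conjTranspose_nonsing_inv, conjTranspose_Omega] at h
    simpa using h
  rw [opC_mul_blockProj hE3 hθ hσ, opC, blockProj, Matrix.fromBlocks_multiply]
  simp [h1, bandProj_mul_Omega]

theorem modeMat_eq_fromBlocks (hE3 : CondE3 V) {θ : Fin d → ℝ} (hθ : θ ∈ goodSet V) {σ : ℕ}
    (hσ : σ < bandCount V) (ε : ℝ) : modeMat V σ ε θ = (1 / 2 : ℂ) • Matrix.fromBlocks
      (bandProj V σ θ) ((Complex.I * ε * (band V σ θ : ℂ)⁻¹) • bandProj V σ θ)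
      (-((Complex.I * ε * band V σ θ) • bandProj V σ θ)) (bandProj V σ θ) := by
  rw [modeMat, add_mul, one_mul, smul_mul_assoc, opC_mul_blockProj hE3 hθ hσ, blockProj,
    Matrix.fromBlocks_smul, Matrix.fromBlocks_add]
  simp only [smul_zero, add_zero, zero_add, smul_neg, smul_smul]

theorem fourier_mul_bandProj (hE3 : CondE3 V) (θ : Fin d → ℝ) (σ : ℕ) :
    fourier V θ * bandProj V σ θ = ((band V σ θ : ℂ) ^ 2) • bandProj V σ θ := by
  rw [← hE3.Omega_mul_self, mul_assoc, Omega_mul_bandProj, mul_smul_comm, Omega_mul_bandProj,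
    smul_smul, pow_two]

/-- On the range of `Π_σ` the symbol acts as `ω_σ C`, where `C² = -1`; hence `(1 + iεC)/2` with `ε =
±1` projects onto its eigenvectors for `-iεω_σ`. -/
theorem symbol_mul_modeMat (hE3 : CondE3 V) {θ : Fin d → ℝ} (hθ : θ ∈ goodSet V) {σ : ℕ}
    (hσ : σ < bandCount V) {ε : ℝ} (hε : ε * ε = 1) :
    symbol V θ * modeMat V σ ε θ = (-(Complex.I * ε * band V σ θ)) • modeMat V σ ε θ := by
  have hω : (band V σ θ : ℂ) ≠ 0 := by exact_mod_cast (hE3.band_pos hθ hσ).ne'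
  have hε' : (ε : ℂ) * ε = 1 := by exact_mod_cast hε
  have e1 : Complex.I * ε * band V σ θ * (Complex.I * ε * (band V σ θ : ℂ)⁻¹) = -1 := by
    calc _ = (Complex.I * Complex.I) * (ε * ε) * (band V σ θ * (band V σ θ : ℂ)⁻¹) := by ring
      _ = -1 := by rw [Complex.I_mul_I, hε', mul_inv_cancel₀ hω]; ring
  have e2 : Complex.I * ε * band V σ θ * (Complex.I * ε * band V σ θ) = -(band V σ θ : ℂ) ^ 2 := by
    calc _ = (Complex.I * Complex.I) * (ε * ε) * (band V σ θ : ℂ) ^ 2 := by ring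
      _ = _ := by rw [Complex.I_mul_I, hε']; ring
  rw [modeMat_eq_fromBlocks hE3 hθ hσ, mul_smul_comm, smul_comm]
  congr 1
  rw [symbol, Matrix.fromBlocks_multiply, Matrix.fromBlocks_smul, Matrix.fromBlocks_inj]
  have h3 : (band V σ θ : ℂ) ^ 2 * (band V σ θ : ℂ)⁻¹ = band V σ θ := by
    field_simp
  refine ⟨?_, ?_, ?_, ?_⟩
  · simp only [zero_mul, one_mul, zero_add, neg_smul]
  · simp only [zero_mul, one_mul, zero_add, smul_smul, neg_mul, e1, neg_neg, one_smul]
  · simp only [neg_mul, fourier_mul_bandProj hE3, zero_mul, add_zero, smul_neg, smul_smul,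
      e2, neg_neg]
  · simp only [neg_mul, mul_smul_comm, fourier_mul_bandProj hE3, zero_mul, add_zero, smul_neg,
      neg_smul, smul_smul]
    rw [mul_assoc, mul_comm (band V σ θ : ℂ)⁻¹, h3]

/-- The exponential of the symbol. -/
def modePropagator (V : Interaction d n) (θ : Fin d → ℝ) (t : ℝ) : BlockMatrix n ℂ :=
  ∑ σ : Fin (bandCount V), ∑ e : Fin 2,
    Complex.exp (-(Complex.I * (t * (octantSign e * band V σ θ) : ℝ))) •
      modeMat V σ (octantSign e) θ

theorem octantSign_mul_self (e : Fin 2) : (octantSign e : ℝ) * octantSign e = 1 := by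
  fin_cases e <;> simp [octantSign]

theorem sum_modeMat (V : Interaction d n) (σ : ℕ) (θ : Fin d → ℝ) :
    ∑ e : Fin 2, modeMat V σ (octantSign e) θ = blockProj V σ θ := by
  simp only [modeMat]
  rw [← Finset.smul_sum, ← Finset.sum_mul, Fin.sum_univ_two]
  have h : (1 + (Complex.I * ((octantSign 0 : ℤ) : ℝ)) • opC V θ) +
      (1 + (Complex.I * ((octantSign 1 : ℤ) : ℝ)) • opC V θ) = (2 : ℂ) • (1 : BlockMatrix n ℂ) := by
    rw [two_smul]
    simp [octantSign]
    abel
  rw [h, smul_mul_assoc, one_mul, smul_smul]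
  norm_num

theorem modePropagator_zero (hE3 : CondE3 V) {θ : Fin d → ℝ} (hθ : θ ∈ goodSet V) :
    modePropagator V θ 0 = 1 := by
  simp only [modePropagator, zero_mul, Complex.ofReal_zero, mul_zero, neg_zero, Complex.exp_zero,
    one_smul, sum_modeMat]
  have h := sum_bandProj (hE3.count_of_mem_goodSet hθ)
  rw [Finset.sum_range] at h
  rw [← Matrix.fromBlocks_one, ← h]
  ext p q
  rw [Matrix.sum_apply]
  rcases p with a | a <;> rcases q with b | b <;>
    simp [blockProj, Matrix.sum_apply]

theorem hasDerivAt_modePropagator (hE3 : CondE3 V) {θ : Fin d → ℝ} (hθ : θ ∈ goodSet V) (t : ℝ)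
    (p q : Fin n ⊕ Fin n) : HasDerivAt (fun t => modePropagator V θ t p q)
      ((symbol V θ * modePropagator V θ t) p q) t := by
  have h1 : symbol V θ * modePropagator V θ t = ∑ σ : Fin (bandCount V), ∑ e : Fin 2,
      (Complex.exp (-(Complex.I * (t * (octantSign e * band V σ θ) : ℝ))) *
        (-(Complex.I * (octantSign e : ℝ) * band V σ θ))) • modeMat V σ (octantSign e) θ := by
    rw [modePropagator, Finset.mul_sum]
    refine Finset.sum_congr rfl fun σ _ => ?_
    rw [Finset.mul_sum]
    refine Finset.sum_congr rfl fun e _ => ?_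
    rw [mul_smul_comm, symbol_mul_modeMat hE3 hθ σ.2 (octantSign_mul_self e), smul_smul]
  rw [h1]
  simp only [modePropagator, Matrix.sum_apply, Matrix.smul_apply, smul_eq_mul]
  refine HasDerivAt.fun_sum fun σ _ => HasDerivAt.fun_sum fun e _ => HasDerivAt.mul_const ?_ _
  refine HasDerivAt.cexp ?_
  have h2 : HasDerivAt (fun t : ℝ => ((t * (octantSign e * band V σ θ) : ℝ) : ℂ))
      (((octantSign e : ℝ) * band V σ θ : ℝ) : ℂ) t := by
    have := ((hasDerivAt_id t).mul_const ((octantSign e : ℝ) * band V σ θ)).ofReal_comp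
    simpa using this
  have h3 := (h2.const_mul Complex.I).neg
  refine h3.congr_deriv ?_
  push_cast
  ring

/-! ### Weights of the octants -/

/-- The weight `2^{-k} ∏ⱼ (1 + (-1)^{n_j} ε sgn ∂ⱼω_σ)`, the indicator of the octant into which the
group velocity of a mode points. -/
def octantWeight {k : ℕ} (hk : k ≤ d) (V : Interaction d n) (σ : ℕ) (e : Fin 2)
    (ν : Fin k → Fin 2) (θ : Fin d → ℝ) : ℝ :=
  (1 / 2) ^ k * ∏ j, (1 + (octantSign e : ℝ) *
    (Real.sign (bandDeriv V σ (Fin.castLE hk j) θ) * octantSign (ν j)))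

/-- The sum over the octants factorizes, and in each coordinate the two signs contribute `(1 + s) +
(1 - s) = 2`, even where `s = 0`. -/
theorem sum_octantWeight {k : ℕ} (hk : k ≤ d) (V : Interaction d n) (σ : ℕ) (e : Fin 2)
    (θ : Fin d → ℝ) : ∑ ν, octantWeight hk V σ e ν θ = 1 := by
  simp only [octantWeight]
  rw [← Finset.mul_sum]
  have h := Finset.prod_univ_sum (fun _ : Fin k => (Finset.univ : Finset (Fin 2)))
    fun j i => 1 + (octantSign e : ℝ) *
      (Real.sign (bandDeriv V σ (Fin.castLE hk j) θ) * octantSign i)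
  rw [Fintype.piFinset_univ] at h
  rw [← h]
  have h2 : ∀ j : Fin k, ∑ i : Fin 2, (1 + (octantSign e : ℝ) *
      (Real.sign (bandDeriv V σ (Fin.castLE hk j) θ) * octantSign i)) = 2 := by
    intro j
    rw [Fin.sum_univ_two]
    simp [octantSign]
    ring
  simp only [h2, Finset.prod_const, Finset.card_univ, Fintype.card_fin, ← mul_pow]
  norm_num

theorem abs_one_add_sign_le (e : Fin 2) (i : Fin 2) (x : ℝ) :
    |1 + (octantSign e : ℝ) * (Real.sign x * octantSign i)| ≤ 2 := by
  rcases Real.sign_apply_eq x with h | h | h <;> fin_cases e <;> fin_cases i <;>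
    norm_num [h, octantSign]

theorem abs_octantWeight_le {k : ℕ} (hk : k ≤ d) (V : Interaction d n) (σ : ℕ) (e : Fin 2)
    (ν : Fin k → Fin 2) (θ : Fin d → ℝ) : |octantWeight hk V σ e ν θ| ≤ 1 := by
  rw [octantWeight, abs_mul, Finset.abs_prod, abs_of_pos (by positivity)]
  calc _ ≤ (1 / 2 : ℝ) ^ k * ∏ _j : Fin k, (2 : ℝ) := by
        gcongr with j _
        exact abs_one_add_sign_le _ _ _
    _ = 1 := by simp

theorem pos_of_octantWeight_ne_zero {k : ℕ} (hk : k ≤ d) {σ : ℕ} {e : Fin 2}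
    {ν : Fin k → Fin 2} {θ : Fin d → ℝ} (hD : ∀ l, bandDeriv V σ l θ ≠ 0)
    (h : octantWeight hk V σ e ν θ ≠ 0) (j : Fin k) :
    0 < (octantSign (ν j) : ℝ) * (octantSign e * bandDeriv V σ (Fin.castLE hk j) θ) := by
  have h1 := Finset.prod_ne_zero_iff.1 (right_ne_zero_of_mul h) j (Finset.mem_univ j)
  have hD' := hD (Fin.castLE hk j)
  generalize bandDeriv V σ (Fin.castLE hk j) θ = D at h1 hD' ⊢
  generalize ν j = i at h1 ⊢
  rcases lt_or_gt_of_ne hD' with hneg | hpos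
  · rw [Real.sign_of_neg hneg] at h1
    fin_cases e <;> fin_cases i <;> simp [octantSign] at h1 ⊢ <;> exact hneg
  · rw [Real.sign_of_pos hpos] at h1
    fin_cases e <;> fin_cases i <;> simp [octantSign] at h1 ⊢ <;> exact hpos

/-- Expanding the product over subsets `P` gives each term the factor `ε^{|P|}`, which is `1` or `ε`
according to the parity of `|P|`. This is the origin of the even and odd sums of signs. -/
theorem octantWeight_eq {k : ℕ} (hk : k ≤ d) (V : Interaction d n) (σ : ℕ) (e : Fin 2)
    (ν : Fin k → Fin 2) (θ : Fin d → ℝ) : octantWeight hk V σ e ν θ =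
      (1 / 2) ^ k * (1 + signEven hk V σ θ ν + octantSign e * signOdd hk V σ θ ν) := by
  rw [octantWeight, Finset.prod_one_add, Finset.sum_powerset]
  congr 1
  have h1 : ∀ m, ∑ P ∈ Finset.powersetCard m (Finset.univ : Finset (Fin k)), ∏ j ∈ P,
      ((octantSign e : ℝ) * (Real.sign (bandDeriv V σ (Fin.castLE hk j) θ) * octantSign (ν j))) =
      (octantSign e : ℝ) ^ m * signSum hk V σ θ ν m := by
    intro m
    rw [signSum, Finset.mul_sum]
    refine Finset.sum_congr rfl fun P hP => ?_
    rw [Finset.prod_mul_distrib, Finset.prod_const, (Finset.mem_powersetCard.1 hP).2]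
  simp only [h1]
  rw [Finset.card_univ, Fintype.card_fin, Finset.range_eq_Ico, Finset.sum_eq_sum_Ico_succ_bot (by omega)]
  have h2 : signSum hk V σ θ ν 0 = 1 := by simp [signSum]
  have h3 : Finset.Ico (0 + 1) (k + 1) = Finset.Icc 1 k := by
    ext m
    simp only [Finset.mem_Ico, Finset.mem_Icc]
    omega
  rw [pow_zero, one_mul, h2, h3, ← Finset.sum_filter_add_sum_filter_not (Finset.Icc 1 k) Even,
    signEven, signOdd, add_assoc, Finset.mul_sum]
  have hsq : (octantSign e : ℝ) ^ 2 = 1 := by rw [pow_two, octantSign_mul_self]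
  congr 2
  · refine Finset.sum_congr rfl fun m hm => ?_
    obtain ⟨r, rfl⟩ := (Finset.mem_filter.1 hm).2
    rw [← two_mul, pow_mul, hsq, one_pow, one_mul]
  · simp only [Nat.not_even_iff_odd]
    refine Finset.sum_congr rfl fun m hm => ?_
    obtain ⟨r, rfl⟩ := (Finset.mem_filter.1 hm).2
    rw [pow_succ, pow_mul, hsq, one_pow, one_mul]

theorem conjTranspose_blockProj (V : Interaction d n) (σ : ℕ) (θ : Fin d → ℝ) :
    (blockProj V σ θ)ᴴ = blockProj V σ θ := by
  simp [blockProj, Matrix.fromBlocks_conjTranspose, conjTranspose_bandProj]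

/-- Two modes with opposite frequencies together give the two parts of the limit. -/
theorem sum_octantWeight_modeMat {k : ℕ} (hk : k ≤ d) (hE3 : CondE3 V) {θ : Fin d → ℝ}
    (hθ : θ ∈ goodSet V) {σ : ℕ} (hσ : σ < bandCount V) (ν : Fin k → Fin 2) (A : BlockMatrix n ℂ) :
    ∑ e, (octantWeight hk V σ e ν θ : ℂ) •
        (modeMat V σ (octantSign e) θ * A * (modeMat V σ (octantSign e) θ)ᴴ) =
      blockProj V σ θ * ((1 / 2 ^ k : ℂ) • ((1 + signEven hk V σ θ ν : ℝ) : ℂ) • opL1plus V θ A +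
        Complex.I • (1 / 2 ^ k : ℂ) • (signOdd hk V σ θ ν : ℂ) • opL2minus V θ A) *
          blockProj V σ θ := by
  -- `(1 + iεC) A (1 + iεC)ᴴ = A + ε² CACᴴ + iε(CA - ACᴴ)`. Summed over `ε = ±1` against the octant
  -- weights, the even part of this pairs with the even part of the weights, and odd with odd.
  have hmode : ∀ ε : ℝ, modeMat V σ ε θ * A * (modeMat V σ ε θ)ᴴ = blockProj V σ θ *
      ((1 / 4 : ℂ) • (A + (Complex.I * ε) • (opC V θ * A - A * (opC V θ)ᴴ) +
        ((ε : ℂ) * ε) • (opC V θ * A * (opC V θ)ᴴ))) * blockProj V σ θ := by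
    intro ε
    have e1 : modeMat V σ ε θ = (1 / 2 : ℂ) • (blockProj V σ θ * (1 + (Complex.I * ε) • opC V θ)) := by
      rw [modeMat, add_mul, mul_add, one_mul, mul_one, smul_mul_assoc, mul_smul_comm,
        blockProj_mul_opC hE3 hθ hσ]
    have e2 : (modeMat V σ ε θ)ᴴ = (1 / 2 : ℂ) • ((1 - (Complex.I * ε) • (opC V θ)ᴴ) *
        blockProj V σ θ) := by
      rw [e1, Matrix.conjTranspose_smul, Matrix.conjTranspose_mul, conjTranspose_blockProj,
        Matrix.conjTranspose_add, Matrix.conjTranspose_one, Matrix.conjTranspose_smul]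
      simp [sub_eq_add_neg]
    rw [e2, e1]
    have e3 : (1 + (Complex.I * ε) • opC V θ) * A * (1 - (Complex.I * ε) • (opC V θ)ᴴ) =
        A + (Complex.I * ε) • (opC V θ * A - A * (opC V θ)ᴴ) +
        ((ε : ℂ) * ε) • (opC V θ * A * (opC V θ)ᴴ) := by
      have h4 : (Complex.I * ε) * (Complex.I * ε) = -((ε : ℂ) * ε) := by
        calc _ = (Complex.I * Complex.I) * (ε * ε) := by ring
          _ = _ := by rw [Complex.I_mul_I]; ring
      simp only [add_mul, mul_sub, one_mul, mul_one, smul_mul_assoc, mul_smul_comm, smul_smul, h4,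
        smul_sub, smul_add, neg_smul]
      abel
    rw [← e3]
    simp only [smul_mul_assoc, mul_smul_comm, smul_smul, mul_assoc]
    norm_num
  have hpull : ∀ (c : ℂ) (X : BlockMatrix n ℂ), c • (blockProj V σ θ * X * blockProj V σ θ) =
      blockProj V σ θ * (c • X) * blockProj V σ θ := fun c X => by
    simp only [mul_smul_comm, smul_mul_assoc]
  simp only [hmode, hpull]
  rw [← Finset.sum_mul, ← Finset.mul_sum]
  congr 2
  simp only [Fin.sum_univ_two, octantWeight_eq, opL1plus, opL2minus]
  ext p q
  simp only [Matrix.add_apply, Matrix.smul_apply, Matrix.sub_apply, smul_eq_mul]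
  simp [octantSign]
  ring

end Modes

/-! ### Square integrability of the modes -/

section ModeAmplitudes

variable {d n : ℕ} {V : Interaction d n}

theorem aestronglyMeasurable_angle {E : Type*} [TopologicalSpace E]
    [TopologicalSpace.PseudoMetrizableSpace E]
    {W : Set (Fin d → ℝ)} (hW : IsOpen W) (hc : volume Wᶜ = 0) {F : (Fin d → ℝ) → E}
    (hF : ContinuousOn F W) : AEStronglyMeasurable (fun τ : Torus d => F (angle τ)) volume := by
  have h1 : AEStronglyMeasurable F volume := by
    have := hF.aestronglyMeasurable (μ := volume) hW.measurableSet
    rwa [Measure.restrict_eq_self_of_ae_mem (show ∀ᵐ x, x ∈ W from hc)] at this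
  refine AEStronglyMeasurable.comp_aemeasurable ?_ measurableEmbedding_angle.measurable.aemeasurable
  rw [map_angle]
  exact h1.restrict.smul_measure _

theorem norm_entry_le {m : ℕ} (A : Matrix (Fin m) (Fin m) ℂ) (a b : Fin m) : ‖A a b‖ ≤ ‖A‖ := by
  have h := Matrix.l2_opNorm_mulVec A (EuclideanSpace.single b (1 : ℂ))
  rw [PiLp.norm_single, norm_one, mul_one] at h
  refine le_trans ?_ h
  refine le_trans (le_of_eq ?_) (PiLp.norm_apply_le _ a)
  simp

theorem norm_bandProj_le (V : Interaction d n) (σ : ℕ) (θ : Fin d → ℝ) : ‖bandProj V σ θ‖ ≤ 1 := by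
  have h := CStarRing.norm_star_mul_self (x := bandProj V σ θ)
  rw [Matrix.star_eq_conjTranspose, conjTranspose_bandProj, bandProj_mul_self] at h
  nlinarith [norm_nonneg (bandProj V σ θ), sq_nonneg (‖bandProj V σ θ‖ - 1)]

theorem CondE3.bandProj_ne_zero (hE3 : CondE3 V) {θ : Fin d → ℝ} (hθ : θ ∈ goodSet V) {σ : ℕ}
    (hσ : σ < bandCount V) : bandProj V σ θ ≠ 0 := fun h => by
  have := trace_bandProj_pos (V := V) (θ := θ) (σ := σ) (by rwa [hE3.count_of_mem_goodSet hθ])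
  rw [h, Matrix.trace_zero, Complex.zero_re] at this
  exact lt_irrefl _ this

theorem norm_le_of_mul_eq_smul {A P : Matrix (Fin n) (Fin n) ℂ} {c : ℂ} (hP : P ≠ 0)
    (h : A * P = c • P) : ‖c‖ ≤ ‖A‖ := by
  have h1 := norm_mul_le A P
  rw [h, norm_smul] at h1
  exact le_of_mul_le_mul_right h1 (norm_pos_iff.2 hP)

theorem CondE3.band_sq_le (hE3 : CondE3 V) {θ : Fin d → ℝ} (hθ : θ ∈ goodSet V) {σ : ℕ}
    (hσ : σ < bandCount V) : band V σ θ ^ 2 ≤ ‖fourier V θ‖ := by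
  have h := norm_le_of_mul_eq_smul (hE3.bandProj_ne_zero hθ hσ) (fourier_mul_bandProj hE3 θ σ)
  rwa [norm_pow, Complex.norm_real, Real.norm_eq_abs, sq_abs] at h

theorem CondE3.inv_band_sq_le (hE3 : CondE3 V) {θ : Fin d → ℝ} (hθ : θ ∈ goodSet V) {σ : ℕ}
    (hσ : σ < bandCount V) : (band V σ θ)⁻¹ ^ 2 ≤ ‖(fourier V θ)⁻¹‖ := by
  have h2 : (fourier V θ)⁻¹ * bandProj V σ θ = ((band V σ θ : ℂ)⁻¹ ^ 2) • bandProj V σ θ := by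
    rw [← hE3.Omega_mul_self, Matrix.mul_inv_rev, mul_assoc, Omega_inv_mul_bandProj hE3 hθ hσ,
      mul_smul_comm, Omega_inv_mul_bandProj hE3 hθ hσ, smul_smul, pow_two]
  have h := norm_le_of_mul_eq_smul (hE3.bandProj_ne_zero hθ hσ) h2
  rwa [norm_pow, norm_inv, Complex.norm_real, Real.norm_eq_abs, inv_pow, sq_abs, ← inv_pow] at h

/-- Apart from the projection the blocks contain only `1`, `ω_σ` and `ω_σ⁻¹`. The squares of the
latter two are eigenvalues of `V̂` and `V̂⁻¹`, so E6 is exactly what makes the amplitudes square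
integrable. -/
theorem CondE3.norm_modeMat_sq_le (hE3 : CondE3 V) {θ : Fin d → ℝ} (hθ : θ ∈ goodSet V) {σ : ℕ}
    (hσ : σ < bandCount V) (e : Fin 2) (p q : Fin n ⊕ Fin n) :
    ‖modeMat V σ (octantSign e) θ p q‖ ^ 2 ≤ 1 + ‖fourier V θ‖ + ‖(fourier V θ)⁻¹‖ := by
  have h1 := hE3.band_sq_le hθ hσ
  have h2 := hE3.inv_band_sq_le hθ hσ
  have hP : ∀ a b, ‖bandProj V σ θ a b‖ ≤ 1 := fun a b =>
    (norm_entry_le _ a b).trans (norm_bandProj_le V σ θ)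
  have he : ‖(((octantSign e : ℤ) : ℝ) : ℂ)‖ = 1 := by
    fin_cases e <;> simp [octantSign]
  have key : ∀ (c : ℂ) (a b : Fin n) (X : ℝ), ‖c‖ ^ 2 ≤ X →
      ‖(1 / 2 : ℂ) * (c * bandProj V σ θ a b)‖ ^ 2 ≤ X := by
    intro c a b X hX
    refine le_trans (pow_le_pow_left₀ (norm_nonneg _) ?_ 2) hX
    rw [norm_mul, norm_mul]
    have h3 := hP a b
    have h4 : ‖(1 / 2 : ℂ)‖ = 1 / 2 := by norm_num
    rw [h4]
    nlinarith [norm_nonneg c, norm_nonneg (bandProj V σ θ a b),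
      mul_le_mul_of_nonneg_left h3 (norm_nonneg c)]
  have hn1 := norm_nonneg (fourier V θ)
  have hn2 := norm_nonneg (fourier V θ)⁻¹
  rw [modeMat_eq_fromBlocks hE3 hθ hσ]
  rcases p with a | a <;> rcases q with b | b
  · have := key 1 a b 1 (by simp)
    simp only [Matrix.smul_apply, Matrix.fromBlocks_apply₁₁, smul_eq_mul]
    rw [one_mul] at this
    linarith
  · have := key (Complex.I * (octantSign e : ℝ) * (band V σ θ : ℂ)⁻¹) a b ‖(fourier V θ)⁻¹‖ (by
      rw [norm_mul, norm_mul, Complex.norm_I, he, one_mul, one_mul, norm_inv, Complex.norm_real,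
        Real.norm_eq_abs, inv_pow, sq_abs, ← inv_pow]
      exact h2)
    simp only [Matrix.smul_apply, Matrix.fromBlocks_apply₁₂, smul_eq_mul]
    linarith
  · have := key (-(Complex.I * (octantSign e : ℝ) * band V σ θ)) a b ‖fourier V θ‖ (by
      rw [norm_neg, norm_mul, norm_mul, Complex.norm_I, he, one_mul, one_mul, Complex.norm_real,
        Real.norm_eq_abs, sq_abs]
      exact h1)
    simp only [Matrix.smul_apply, Matrix.neg_apply, Matrix.fromBlocks_apply₂₁, smul_eq_mul]
    rw [neg_mul] at this
    linarith
  · have := key 1 a b 1 (by simp)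
    simp only [Matrix.smul_apply, Matrix.fromBlocks_apply₂₂, smul_eq_mul]
    rw [one_mul] at this
    linarith

theorem ae_angle_mem_goodSet (hE1 : CondE1 V) (hE3 : CondE3 V) (hE6 : CondE6 V) :
    ∀ᵐ τ : Torus d, angle τ ∈ goodSet V :=
  ae_angle (P := fun θ => θ ∈ goodSet V) (volume_compl_goodSet hE1 hE3 hE6)

theorem aestronglyMeasurable_band (hE1 : CondE1 V) (hE3 : CondE3 V) (hE6 : CondE6 V) {σ : ℕ}
    (hσ : σ < bandCount V) :
    AEStronglyMeasurable (fun τ : Torus d => band V σ (angle τ)) volume :=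
  aestronglyMeasurable_angle hE1.isOpen_goodSet (volume_compl_goodSet hE1 hE3 hE6)
    (continuousOn_band hE1 hE3 hσ)

theorem aestronglyMeasurable_bandDeriv (hE1 : CondE1 V) (hE3 : CondE3 V) (hE6 : CondE6 V) {σ : ℕ}
    (hσ : σ < bandCount V) (l : Fin d) :
    AEStronglyMeasurable (fun τ : Torus d => bandDeriv V σ l (angle τ)) volume :=
  aestronglyMeasurable_angle hE1.isOpen_goodSet (volume_compl_goodSet hE1 hE3 hE6)
    (analyticOnNhd_bandDeriv hE1 hE3 hσ l).continuousOn

theorem aestronglyMeasurable_modeMat (hE1 : CondE1 V) (hE3 : CondE3 V) (hE6 : CondE6 V) {σ : ℕ}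
    (hσ : σ < bandCount V) (ε : ℝ) (p q : Fin n ⊕ Fin n) :
    AEStronglyMeasurable (fun τ : Torus d => modeMat V σ ε (angle τ) p q) volume := by
  refine aestronglyMeasurable_angle (F := fun θ => modeMat V σ ε θ p q) hE1.isOpen_goodSet
    (volume_compl_goodSet hE1 hE3 hE6) ?_
  have hP : ∀ a b, ContinuousOn (fun θ => bandProj V σ θ a b) (goodSet V) := fun a b =>
    (Continuous.matrix_elem continuous_id a b).comp_continuousOn (continuousOn_bandProj hE1 hE3 hσ)
  have hω : ContinuousOn (fun θ => (band V σ θ : ℂ)) (goodSet V) :=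
    Complex.continuous_ofReal.comp_continuousOn (continuousOn_band hE1 hE3 hσ)
  have hω' : ContinuousOn (fun θ => (band V σ θ : ℂ)⁻¹) (goodSet V) :=
    hω.inv₀ fun θ hθ => by exact_mod_cast (hE3.band_pos hθ hσ).ne'
  refine ContinuousOn.congr (f := fun θ => ((1 / 2 : ℂ) • Matrix.fromBlocks
      (bandProj V σ θ) ((Complex.I * ε * (band V σ θ : ℂ)⁻¹) • bandProj V σ θ)
      (-((Complex.I * ε * band V σ θ) • bandProj V σ θ)) (bandProj V σ θ)) p q) ?_
    fun θ hθ => by simp only [modeMat_eq_fromBlocks hE3 hθ hσ]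
  rcases p with a | a <;> rcases q with b | b <;>
    simp only [Matrix.smul_apply, Matrix.neg_apply, Matrix.fromBlocks_apply₁₁,
      Matrix.fromBlocks_apply₁₂, Matrix.fromBlocks_apply₂₁, Matrix.fromBlocks_apply₂₂,
      smul_eq_mul] <;>
    fun_prop

theorem measurable_realSign : Measurable Real.sign := by
  unfold Real.sign
  exact Measurable.ite measurableSet_Iio measurable_const
    (Measurable.ite measurableSet_Ioi measurable_const measurable_const)

theorem aemeasurable_octantWeight (hE1 : CondE1 V) (hE3 : CondE3 V) (hE6 : CondE6 V) {k : ℕ}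
    (hk : k ≤ d) {σ : ℕ} (hσ : σ < bandCount V) (e : Fin 2) (ν : Fin k → Fin 2) :
    AEMeasurable (fun τ : Torus d => octantWeight hk V σ e ν (angle τ)) volume := by
  unfold octantWeight
  refine AEMeasurable.const_mul (Finset.aemeasurable_fun_prod _ fun j _ => ?_) _
  have := measurable_realSign.comp_aemeasurable
    (aestronglyMeasurable_bandDeriv hE1 hE3 hE6 hσ (Fin.castLE hk j)).aemeasurable
  exact ((this.mul_const _).const_mul _).const_add _

theorem CondE1.integrable_norm_fourier (hE1 : CondE1 V) :
    IntegrableOn (fun θ => ‖fourier V θ‖) (torusCell d) := by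
  have hK : IsCompact (Set.univ.pi fun _ : Fin d => Set.Icc (-Real.pi) Real.pi) :=
    isCompact_univ_pi fun _ => isCompact_Icc
  exact ((continuous_fourier hE1).norm.continuousOn.integrableOn_compact hK).mono_set
    (Set.pi_mono fun _ _ => Set.Ioc_subset_Icc_self)

/-- The amplitudes of the waves of which the Green function consists. -/
def amplitude (V : Interaction d n) (σ : ℕ) (e : Fin 2) (x : Lattice d) (p p' : Fin n ⊕ Fin n)
    (τ : Torus d) : ℂ :=
  UnitAddTorus.mFourier x τ * conj (modeMat V σ (octantSign e) (angle τ) p p')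

theorem memLp_amplitude (hE1 : CondE1 V) (hE3 : CondE3 V) (hE6 : CondE6 V) {σ : ℕ}
    (hσ : σ < bandCount V) (e : Fin 2) (x : Lattice d) (p p' : Fin n ⊕ Fin n) :
    MemLp (amplitude V σ e x p p') 2 := by
  have hm := aestronglyMeasurable_modeMat hE1 hE3 hE6 hσ (octantSign e) p p'
  have h1 : MemLp (fun τ : Torus d => modeMat V σ (octantSign e) (angle τ) p p') 2 := by
    rw [memLp_two_iff_integrable_sq_norm hm]
    have hb : Integrable fun τ : Torus d =>
        1 + ‖fourier V (angle τ)‖ + ‖(fourier V (angle τ))⁻¹‖ :=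
      ((integrable_const 1).add (integrable_angle_iff.2 hE1.integrable_norm_fourier)).add
        (integrable_angle_iff (F := fun θ => ‖(fourier V θ)⁻¹‖).2 hE6.2)
    refine hb.mono' (hm.norm.pow 2) ?_
    filter_upwards [ae_angle_mem_goodSet hE1 hE3 hE6] with τ hτ
    rw [norm_pow, norm_norm]
    exact hE3.norm_modeMat_sq_le hτ hσ e p p'
  exact MemLp.mFourier_mul h1.star x

theorem memLp_octantWeight_mul (hE1 : CondE1 V) (hE3 : CondE3 V) (hE6 : CondE6 V) {k : ℕ}
    (hk : k ≤ d) {σ : ℕ} (hσ : σ < bandCount V) (e : Fin 2) (ν : Fin k → Fin 2)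
    {p : ℝ≥0∞} {F : Torus d → ℂ} (hF : MemLp F p) :
    MemLp (fun τ => (octantWeight hk V σ e ν (angle τ) : ℂ) * F τ) p := by
  refine hF.of_le (AEStronglyMeasurable.mul ?_ hF.1) (ae_of_all _ fun τ => ?_)
  · exact Complex.continuous_ofReal.comp_aestronglyMeasurable
      (aemeasurable_octantWeight hE1 hE3 hE6 hk hσ e ν).aestronglyMeasurable
  · rw [norm_mul, Complex.norm_real, Real.norm_eq_abs]
    exact mul_le_of_le_one_left (norm_nonneg _) (abs_octantWeight_le hk V σ e ν _)

/-- The phase of a wave. -/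
def phase (V : Interaction d n) (σ : ℕ) (e : Fin 2) (τ : Torus d) : ℝ :=
  octantSign e * band V σ (angle τ)

theorem aestronglyMeasurable_phase_band (hE1 : CondE1 V) (hE3 : CondE3 V) (hE6 : CondE6 V) {σ : ℕ}
    (hσ : σ < bandCount V) (e : Fin 2) : AEStronglyMeasurable (phase V σ e) volume :=
  (aestronglyMeasurable_band hE1 hE3 hE6 hσ).const_mul _

theorem HasDirDeriv.const_mul {Φ : Torus d → ℝ} {j : Fin d} {D : ℝ} {τ : Torus d}
    (h : HasDirDeriv Φ j D τ) (c : ℝ) : HasDirDeriv (fun τ => c * Φ τ) j (c * D) τ :=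
  (Tendsto.const_mul c h).congr fun r => by ring

theorem ae_hasDirDeriv_phase (hE1 : CondE1 V) (hE3 : CondE3 V) (hE6 : CondE6 V) {σ : ℕ}
    (hσ : σ < bandCount V) (e : Fin 2) (j : Fin d) :
    ∀ᵐ τ, HasDirDeriv (phase V σ e) j (octantSign e * bandDeriv V σ j (angle τ)) τ := by
  filter_upwards [ae_angle_mem_goodSet hE1 hE3 hE6] with τ hτ
  exact (hasDirDeriv_angle (band_add_period V σ)
    (analyticAt_band hE1 hE3 hτ hσ).differentiableAt.lineDifferentiableAt).const_mul _

/-- The Green function is absolutely summable, so it consists of the Fourier coefficients of its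
Fourier sum, which the modes give explicitly. -/
theorem CondE1.greenFunction_eq_sum (hE1 : CondE1 V) (hE3 : CondE3 V) (hE6 : CondE6 V) {α : ℝ}
    (hα : α < -(d : ℝ) / 2) (t : ℝ) (x : Lattice d) (p p' : Fin n ⊕ Fin n) (y : Lattice d) :
    (greenFunction V α t x p y p' : ℂ) = ∑ i : Fin (bandCount V) × Fin 2,
      UnitAddTorus.mFourierCoeff (wave (phase V i.1 i.2) t (amplitude V i.1 i.2 x p p')) y := by
  have hs : Summable fun y => ‖(greenFunction V α t x p y p' : ℂ)‖ := by
    simpa only [Complex.norm_real, Real.norm_eq_abs] using summable_greenFunction hα V t x p p'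
  have h1 := mFourierCoeff_of_hasSum hs (G := fun τ => ∑ i : Fin (bandCount V) × Fin 2,
    wave (phase V i.1 i.2) t (amplitude V i.1 i.2 x p p') τ) (by
      filter_upwards [ae_angle_mem_goodSet hE1 hE3 hE6] with τ hτ
      -- The Green function is real; conjugation turns the series in `e^{-i(y,θ)}` into one in
      -- `e^{i(y,θ)}` and the oscillation `e^{-itεω}` into `e^{itεω}`.
      have h2 := Complex.hasSum_conj'.2 (hE1.hasSum_fourier_greenFunction hα (modePropagator_zero hE3 hτ)
        (hasDerivAt_modePropagator hE3 hτ) t x p p')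
      convert h2 using 1
      · funext y
        rw [mFourier_eq_exp, map_mul, ← Complex.exp_conj, map_neg, map_mul, Complex.conj_I,
          Complex.conj_ofReal, Complex.conj_ofReal, neg_mul, neg_neg]
      · rw [map_mul, ← Complex.exp_conj, map_neg, map_mul, Complex.conj_I, Complex.conj_ofReal,
          neg_mul, neg_neg, ← mFourier_eq_exp, modePropagator, Matrix.sum_apply, map_sum,
          Fintype.sum_prod_type, Finset.mul_sum]
        refine Finset.sum_congr rfl fun σ _ => ?_
        rw [Matrix.sum_apply, map_sum, Finset.mul_sum]
        refine Finset.sum_congr rfl fun e _ => ?_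
        rw [Matrix.smul_apply, smul_eq_mul, map_mul, ← Complex.exp_conj, map_neg, map_mul,
          Complex.conj_I, Complex.conj_ofReal, neg_mul, neg_neg, wave, amplitude, phase]
        ring) y
  rw [← h1]
  simp only [UnitAddTorus.mFourierCoeff, Finset.smul_sum]
  refine integral_finsetSum _ fun i _ => ?_
  have h3 : Integrable (wave (phase V i.1 i.2) t (amplitude V i.1 i.2 x p p')) :=
    (MemLp.wave (aestronglyMeasurable_phase_band hE1 hE3 hE6 i.1.2 i.2) t
      (memLp_amplitude hE1 hE3 hE6 i.1.2 i.2 x p p')).integrable (by norm_num)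
  exact memLp_one_iff_integrable.1 (MemLp.mFourier_mul (memLp_one_iff_integrable.2 h3) (-y))

end ModeAmplitudes

/-! ### Convergence of the correlations -/

section Convergence

variable {d n k : ℕ} {V : Interaction d n}

theorem kernelForm_sum {ι κ : Type*} [Fintype ι] [Fintype κ] {f : ι → Lattice d → ℂ}
    {g : κ → Lattice d → ℂ} (hf : ∀ i, Summable fun y => ‖f i y‖ ^ 2)
    (hg : ∀ j, Summable fun y => ‖g j y‖ ^ 2) {Q : Lattice d → Lattice d → ℝ}
    {H : Lattice d → ℝ} (hH : Summable H) (hQ : ∀ y z, |Q (y + z) y| ≤ H z) :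
    kernelForm Q (fun y => ∑ i, f i y) (fun y => ∑ j, g j y) =
      ∑ i, ∑ j, kernelForm Q (f i) (g j) := by
  have hQ' : ∀ y z, ‖(Q (y + z) y : ℂ)‖ ≤ H z := fun y z => by
    rw [Complex.norm_real, Real.norm_eq_abs]; exact hQ y z
  have h1 : ∀ i j z, Summable fun y => conj (f i (y + z)) * (Q (y + z) y : ℂ) * g j y :=
    fun i j z => summable_conj_mul_mul (summable_norm_sq_shift (hf i) z) (hg j) fun y => hQ' y z
  have h2 : ∀ i j, Summable fun z => ∑' y, conj (f i (y + z)) * (Q (y + z) y : ℂ) * g j y :=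
    fun i j => Summable.of_norm_bounded (hH.mul_right _) fun z =>
      norm_tsum_conj_mul_mul_le (hasSum_norm_sq_shift (hf i).hasSum z) (hg j).hasSum
        fun y => hQ' y z
  have h3 : ∀ z, ∑' y, conj (∑ i, f i (y + z)) * (Q (y + z) y : ℂ) * ∑ j, g j y =
      ∑ i, ∑ j, ∑' y, conj (f i (y + z)) * (Q (y + z) y : ℂ) * g j y := by
    intro z
    rw [← (hasSum_sum (s := Finset.univ) fun i _ => hasSum_sum (s := Finset.univ) fun j _ =>
      (h1 i j z).hasSum).tsum_eq]
    refine tsum_congr fun y => ?_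
    rw [map_sum, Finset.sum_mul, Finset.sum_mul_sum]
  unfold kernelForm
  simp only [h3]
  exact (hasSum_sum (s := Finset.univ) fun i _ => hasSum_sum (s := Finset.univ) fun j _ =>
      (h2 i j).hasSum).tsum_eq

/-- Double expansion in modes, of which only the diagonal survives. The octants `κ` split the second
argument alone. -/
theorem tendsto_kernelForm_sum {ι κ : Type*} [Fintype ι] [DecidableEq ι] [Fintype κ]
    {f : ℕ → ι → Lattice d → ℂ} {g : ℕ → ι → κ → Lattice d → ℂ}
    (hf : ∀ m i, Summable fun y => ‖f m i y‖ ^ 2)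
    (hg : ∀ m j ν, Summable fun y => ‖g m j ν y‖ ^ 2) {Q : Lattice d → Lattice d → ℝ}
    {H : Lattice d → ℝ} (hH : Summable H) (hQ : ∀ y z, |Q (y + z) y| ≤ H z)
    {F G : ℕ → Lattice d → ℂ} (hF : ∀ m y, F m y = ∑ i, f m i y)
    (hG : ∀ m y, G m y = ∑ j, ∑ ν, g m j ν y) {L : ι → κ → ℂ}
    (hself : ∀ i ν, Tendsto (fun m => kernelForm Q (f m i) (g m i ν)) atTop (𝓝 (L i ν)))
    (hne : ∀ i j ν, i ≠ j → Tendsto (fun m => kernelForm Q (f m i) (g m j ν)) atTop (𝓝 0)) :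
    Tendsto (fun m => kernelForm Q (F m) (G m)) atTop (𝓝 (∑ i, ∑ ν, L i ν)) := by
  have hexp : ∀ m, kernelForm Q (F m) (G m) =
      ∑ i, ∑ j : ι × κ, kernelForm Q (f m i) (g m j.1 j.2) := by
    intro m
    rw [funext (hF m), funext (hG m), ← kernelForm_sum (hf m) (fun j : ι × κ => hg m j.1 j.2) hH hQ]
    simp only [Fintype.sum_prod_type]
  simp only [hexp, Fintype.sum_prod_type]
  refine tendsto_finsetSum _ fun i _ => ?_
  have h : ∑ ν, L i ν = ∑ j, ∑ ν, if j = i then L i ν else 0 := by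
    rw [Finset.sum_eq_single i]
    · simp only [if_true]
    · intro j _ hj
      simp only [if_neg hj, Finset.sum_const_zero]
    · intro h
      exact absurd (Finset.mem_univ i) h
  rw [h]
  refine tendsto_finsetSum _ fun j _ => tendsto_finsetSum _ fun ν _ => ?_
  by_cases hij : j = i
  · subst hij
    rw [if_pos rfl]
    exact hself j ν
  · rw [if_neg hij]
    exact hne i j ν (Ne.symm hij)

/-- The bounds of the initial correlations pass to their limits in the octants. -/
theorem abs_le_of_octant_limit (hk : k ≤ d) (ν : Fin k → Fin 2) {Q : Lattice d → Lattice d → ℝ}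
    {H : Lattice d → ℝ} (hQ : ∀ y z, |Q (y + z) y| ≤ H z) {q : Lattice d → ℝ}
    (hq : ∀ z, ∀ ε > 0, ∃ N : ℕ, ∀ y : Lattice d,
      (∀ j : Fin k, (N : ℤ) < octantSign (ν j) * y (Fin.castLE hk j)) → |Q (y + z) y - q z| < ε)
    (z : Lattice d) : |q z| ≤ H z := by
  refine le_of_forall_pos_le_add fun ε hε => ?_
  obtain ⟨N, hN⟩ := hq z ε hε
  -- A point just far enough inside the octant; the coordinates beyond the first `k` are
  -- unconstrained.
  let y : Lattice d := fun i => if h : (i : ℕ) < k then octantSign (ν ⟨i, h⟩) * (N + 1) else 0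
  have hy := hN y fun j => by
    have h1 : y (Fin.castLE hk j) = octantSign (ν j) * (N + 1) := dif_pos j.2
    have h2 : octantSign (ν j) * octantSign (ν j) = 1 := by exact_mod_cast octantSign_mul_self (ν j)
    rw [h1, ← mul_assoc, h2]
    omega
  have h3 := abs_sub_abs_le_abs_sub (q z) (Q (y + z) y)
  rw [abs_sub_comm] at h3
  linarith [hQ y z]

/-- The amplitudes of the waves that move into the octant `ν`. -/
def octantAmplitude (hk : k ≤ d) (V : Interaction d n) (σ : ℕ) (e : Fin 2) (ν : Fin k → Fin 2)
    (x : Lattice d) (p p' : Fin n ⊕ Fin n) (τ : Torus d) : ℂ :=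
  (octantWeight hk V σ e ν (angle τ) : ℂ) * amplitude V σ e x p p' τ

theorem memLp_octantAmplitude (hk : k ≤ d) (hE1 : CondE1 V) (hE3 : CondE3 V) (hE6 : CondE6 V)
    {σ : ℕ} (hσ : σ < bandCount V) (e : Fin 2) (ν : Fin k → Fin 2)
    (x : Lattice d) (p p' : Fin n ⊕ Fin n) : MemLp (octantAmplitude hk V σ e ν x p p') 2 :=
  memLp_octantWeight_mul hE1 hE3 hE6 hk hσ e ν (memLp_amplitude hE1 hE3 hE6 hσ e x p p')

theorem mFourierCoeff_wave_amplitude (hk : k ≤ d) (hE1 : CondE1 V) (hE3 : CondE3 V)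
    (hE6 : CondE6 V) {σ : ℕ} (hσ : σ < bandCount V) (e : Fin 2) (t : ℝ)
    (x : Lattice d) (p p' : Fin n ⊕ Fin n) (y : Lattice d) :
    UnitAddTorus.mFourierCoeff (wave (phase V σ e) t (amplitude V σ e x p p')) y =
      ∑ ν, UnitAddTorus.mFourierCoeff
        (wave (phase V σ e) t (octantAmplitude hk V σ e ν x p p')) y := by
  simp only [UnitAddTorus.mFourierCoeff]
  rw [← integral_finsetSum _ fun ν _ => ?_]
  · refine integral_congr_ae (ae_of_all _ fun τ => ?_)
    have h := sum_octantWeight hk V σ e (angle τ)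
    have h' : ∑ ν, (octantWeight hk V σ e ν (angle τ) : ℂ) = 1 := by exact_mod_cast h
    simp only [wave, octantAmplitude]
    rw [← Finset.smul_sum, ← Finset.mul_sum, ← Finset.sum_mul, h', one_mul]
  · have h3 : Integrable (wave (phase V σ e) t (octantAmplitude hk V σ e ν x p p')) :=
      (MemLp.wave (aestronglyMeasurable_phase_band hE1 hE3 hE6 hσ e) t
        (memLp_octantAmplitude hk hE1 hE3 hE6 hσ e ν x p p')).integrable (by norm_num)
    exact memLp_one_iff_integrable.1 (MemLp.mFourier_mul (memLp_one_iff_integrable.2 h3) (-y))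

theorem ae_octantAmplitude_support (hk : k ≤ d) (hE1 : CondE1 V) (hE3 : CondE3 V) (hE4 : CondE4 V)
    (hE6 : CondE6 V) {σ : ℕ} (hσ : σ < bandCount V) (e : Fin 2) (ν : Fin k → Fin 2)
    (x : Lattice d) (p p' : Fin n ⊕ Fin n) :
    ∀ᵐ τ, octantAmplitude hk V σ e ν x p p' τ ≠ 0 → ∀ j : Fin k,
      0 < (octantSign (ν j) : ℝ) * (octantSign e * bandDeriv V σ (Fin.castLE hk j) (angle τ)) := by
  have h : ∀ᵐ τ : Torus d, ∀ l, bandDeriv V σ l (angle τ) ≠ 0 := by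
    rw [ae_all_iff]
    exact fun l => ae_angle (P := fun θ => bandDeriv V σ l θ ≠ 0)
      (ae_bandDeriv_ne_zero hE1 hE3 hE4 hE6 hσ l)
  filter_upwards [h] with τ hτ hne j
  refine pos_of_octantWeight_ne_zero hk hτ (fun h0 => hne ?_) j
  rw [octantAmplitude, h0, Complex.ofReal_zero, zero_mul]

/-- Different modes have different group velocities. -/
theorem ae_exists_velocity_ne (hd : 1 ≤ d) (hE1 : CondE1 V) (hE3 : CondE3 V) (hE4 : CondE4 V)
    (hE5 : CondE5 V) (hE6 : CondE6 V) {i j : Fin (bandCount V) × Fin 2} (hij : i ≠ j) :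
    ∀ᵐ τ : Torus d, ∃ l, (octantSign j.2 : ℝ) * bandDeriv V j.1 l (angle τ) ≠
      octantSign i.2 * bandDeriv V i.1 l (angle τ) := by
  have hsq := octantSign_mul_self i.2
  have hsq' := octantSign_mul_self j.2
  -- Within one band the modes have opposite velocities, and E4 in a single direction suffices,
  -- which exists because `d ≥ 1`. For different bands E5 is used with the relative sign of the two
  -- modes.
  by_cases hσ : i.1 = j.1
  · have he : (octantSign i.2 : ℝ) = -octantSign j.2 := by
      have hne : i.2 ≠ j.2 := fun h => hij (Prod.ext hσ h)
      generalize i.2 = e at hne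
      generalize j.2 = e' at hne
      fin_cases e <;> fin_cases e' <;> simp [octantSign] at hne ⊢
    filter_upwards [ae_angle (P := fun θ => bandDeriv V j.1 ⟨0, hd⟩ θ ≠ 0)
      (ae_bandDeriv_ne_zero hE1 hE3 hE4 hE6 j.1.2 ⟨0, hd⟩)] with τ hτ
    refine ⟨⟨0, hd⟩, fun h => hτ ?_⟩
    rw [hσ, he] at h
    have h1 : (octantSign j.2 : ℝ) * bandDeriv V j.1 ⟨0, hd⟩ (angle τ) = 0 := by linarith
    rcases mul_eq_zero.1 h1 with h0 | h0
    · rw [h0] at hsq'; norm_num at hsq'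
    · exact h0
  · have hne : (j.1 : ℕ) ≠ i.1 := fun h => hσ (Fin.ext h.symm)
    have he : -((octantSign j.2 : ℝ) * octantSign i.2) = 1 ∨
        -((octantSign j.2 : ℝ) * octantSign i.2) = -1 := by
      generalize i.2 = e
      generalize j.2 = e'
      fin_cases e <;> fin_cases e' <;> simp [octantSign]
    filter_upwards [ae_angle (P := fun θ => ∃ l, bandDeriv V j.1 l θ +
      -((octantSign j.2 : ℝ) * octantSign i.2) * bandDeriv V i.1 l θ ≠ 0)
      (ae_exists_bandDeriv_ne hE1 hE3 hE5 hE6 j.1.2 i.1.2 hne he)] with τ hτ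
    obtain ⟨l, hl⟩ := hτ
    refine ⟨l, fun h => hl ?_⟩
    linear_combination (octantSign j.2 : ℝ) * h - bandDeriv V j.1 l (angle τ) * hsq'

theorem tendsto_kernelForm_modes (hk₁ : 1 ≤ k) (hk : k ≤ d) (hE1 : CondE1 V) (hE3 : CondE3 V)
    (hE4 : CondE4 V) (hE5 : CondE5 V) (hE6 : CondE6 V) {Q : Lattice d → Lattice d → ℝ}
    {H : Lattice d → ℝ} (hH : Summable H) (hQ : ∀ y z, |Q (y + z) y| ≤ H z)
    {q : (Fin k → Fin 2) → Lattice d → ℝ}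
    (hq : ∀ ν z, ∀ ε > 0, ∃ N : ℕ, ∀ y : Lattice d,
      (∀ j : Fin k, (N : ℤ) < octantSign (ν j) * y (Fin.castLE hk j)) → |Q (y + z) y - q ν z| < ε)
    {α : ℝ} (hα : α < -(d : ℝ) / 2) {t : ℕ → ℝ} (ht : Tendsto t atTop atTop) (x y : Lattice d)
    (p p' r r' : Fin n ⊕ Fin n) :
    Tendsto (fun m => kernelForm Q (fun x' => (greenFunction V α (t m) x p x' p' : ℂ))
      (fun y' => (greenFunction V α (t m) y r y' r' : ℂ))) atTop
      (𝓝 (∑ i : Fin (bandCount V) × Fin 2, ∑ ν, ∫ τ, conj (amplitude V i.1 i.2 x p p' τ) *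
        (∑' z, UnitAddTorus.mFourier z τ * (q ν z : ℂ)) *
          octantAmplitude hk V i.1 i.2 ν y r r' τ)) := by
  have hphase := fun i : Fin (bandCount V) × Fin 2 =>
    aestronglyMeasurable_phase_band hE1 hE3 hE6 i.1.2 i.2
  have hvm : ∀ (i : Fin (bandCount V) × Fin 2) (l : Fin d), AEMeasurable
      (fun τ => (octantSign i.2 : ℝ) * bandDeriv V i.1 l (angle τ)) (volume : Measure (Torus d)) :=
    fun i l => (aestronglyMeasurable_bandDeriv hE1 hE3 hE6 i.1.2 l).aemeasurable.const_mul _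
  have hv := fun (i : Fin (bandCount V) × Fin 2) (l : Fin d) =>
    ae_hasDirDeriv_phase hE1 hE3 hE6 i.1.2 i.2 l
  have ha := fun i : Fin (bandCount V) × Fin 2 => memLp_amplitude hE1 hE3 hE6 i.1.2 i.2 x p p'
  have hb := fun (i : Fin (bandCount V) × Fin 2) (ν : Fin k → Fin 2) =>
    memLp_octantAmplitude hk hE1 hE3 hE6 i.1.2 i.2 ν y r r'
  have hqH := fun ν => abs_le_of_octant_limit hk ν hQ (hq ν)
  refine tendsto_kernelForm_sum
    (f := fun m i => UnitAddTorus.mFourierCoeff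
      (wave (phase V i.1 i.2) (t m) (amplitude V i.1 i.2 x p p')))
    (g := fun m j ν => UnitAddTorus.mFourierCoeff
      (wave (phase V j.1 j.2) (t m) (octantAmplitude hk V j.1 j.2 ν y r r')))
    ?_ ?_ hH hQ ?_ ?_ ?_ ?_
  · exact fun m i => (hasSum_norm_sq_mFourierCoeff (MemLp.wave (hphase i) (t m) (ha i))).summable
  · exact fun m j ν =>
      (hasSum_norm_sq_mFourierCoeff (MemLp.wave (hphase j) (t m) (hb j ν))).summable
  · exact fun m x' => hE1.greenFunction_eq_sum hE3 hE6 hα (t m) x p p' x'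
  · intro m y'
    refine (hE1.greenFunction_eq_sum hE3 hE6 hα (t m) y r r' y').trans ?_
    exact Finset.sum_congr rfl fun j _ =>
      mFourierCoeff_wave_amplitude hk hE1 hE3 hE6 j.1.2 j.2 (t m) y r r' y'
  · exact fun j ν => tendsto_kernelForm_self hk ν (hphase j) (hvm j) (hv j) ht (ha j) (hb j ν)
      (ae_octantAmplitude_support hk hE1 hE3 hE4 hE6 j.1.2 j.2 ν y r r') hH hQ (hqH ν) (hq ν)
  · exact fun i j ν hij =>
      tendsto_kernelForm_of_ne hk ν (hphase i) (hphase j) (hvm j) (hvm i) (hv j) (hv i)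
        (ae_exists_velocity_ne (hk₁.trans hk) hE1 hE3 hE4 hE5 hE6 hij) ht (ha i) (hb j ν)
        (ae_octantAmplitude_support hk hE1 hE3 hE4 hE6 j.1.2 j.2 ν y r r') hH hQ (hqH ν) (hq ν)

theorem qInfHat_eq_sum (hk : k ≤ d) (hE3 : CondE3 V)
    (q : (Fin k → Fin 2) → Lattice d → BlockMatrix n ℝ) {θ : Fin d → ℝ} (hθ : θ ∈ goodSet V) :
    qInfHat hk V q θ = ∑ i : Fin (bandCount V) × Fin 2, ∑ ν,
      (octantWeight hk V i.1 i.2 ν θ : ℂ) •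
        (modeMat V i.1 (octantSign i.2) θ * fourier (q ν) θ *
          (modeMat V i.1 (octantSign i.2) θ)ᴴ) := by
  rw [Fintype.sum_prod_type, qInfHat, Finset.sum_range]
  refine Finset.sum_congr rfl fun σ _ => ?_
  rw [Finset.sum_comm]
  simp only [sum_octantWeight_modeMat hk hE3 hθ σ.2]
  rw [← Finset.sum_mul, ← Finset.mul_sum, Finset.sum_add_distrib, Mplus, Mminus]
  simp only [Finset.smul_sum]
  rfl

/-- The sums over the components `p'`, `r'` are the matrix products in `M q̂_ν Mᴴ`, and the
exponentials at `x` and `y` combine to `e^{-i(x-y,θ)}`. -/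
theorem conj_amplitude_mul_octantAmplitude (hk : k ≤ d) (hE3 : CondE3 V)
    (q : (Fin k → Fin 2) → Lattice d → BlockMatrix n ℝ) (x y : Lattice d) (p r : Fin n ⊕ Fin n)
    {τ : Torus d} (hτ : angle τ ∈ goodSet V) :
    ∑ p', ∑ r', ∑ i : Fin (bandCount V) × Fin 2, ∑ ν, conj (amplitude V i.1 i.2 x p p' τ) *
      (∑' z, UnitAddTorus.mFourier z τ * (q ν z p' r' : ℂ)) *
        octantAmplitude hk V i.1 i.2 ν y r r' τ =
      UnitAddTorus.mFourier (-(x - y)) τ * qInfHat hk V q (angle τ) p r := by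
  have hF : ∀ ν p' r', ∑' z, UnitAddTorus.mFourier z τ * (q ν z p' r' : ℂ) =
      fourier (q ν) (angle τ) p' r' := fun ν p' r' => by
    simp only [mFourier_eq_exp]
    rfl
  simp only [hF]
  have hxy : UnitAddTorus.mFourier (-(x - y)) τ =
      conj (UnitAddTorus.mFourier x τ) * UnitAddTorus.mFourier y τ := by
    rw [neg_sub, sub_eq_neg_add, UnitAddTorus.mFourier_add, UnitAddTorus.mFourier_neg]
  rw [qInfHat_eq_sum hk hE3 q hτ, hxy, Matrix.sum_apply, Finset.mul_sum]
  simp only [Matrix.sum_apply, Finset.mul_sum]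
  rw [Finset.sum_comm' (t' := Finset.univ) (s' := fun _ => Finset.univ) (by simp)]
  rw [Finset.sum_congr rfl fun r' _ => Finset.sum_comm]
  rw [Finset.sum_comm]
  refine Finset.sum_congr rfl fun i _ => ?_
  rw [Finset.sum_congr rfl fun r' _ => Finset.sum_comm]
  rw [Finset.sum_comm]
  refine Finset.sum_congr rfl fun ν _ => ?_
  rw [Matrix.smul_apply, Matrix.mul_apply, smul_eq_mul, Finset.mul_sum, Finset.mul_sum]
  refine Finset.sum_congr rfl fun r' _ => ?_
  rw [Matrix.mul_apply, Finset.sum_mul, Finset.mul_sum, Finset.mul_sum]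
  refine Finset.sum_congr rfl fun p' _ => ?_
  rw [Matrix.conjTranspose_apply, octantAmplitude, amplitude, amplitude, map_mul, Complex.conj_conj]
  simp only [RCLike.star_def]
  ring

theorem integrable_conj_amplitude_mul (hk : k ≤ d) (hE1 : CondE1 V) (hE3 : CondE3 V)
    (hE6 : CondE6 V) {q : Lattice d → ℝ} {H : Lattice d → ℝ} (hH : Summable H)
    (hqH : ∀ z, |q z| ≤ H z) {σ : ℕ} (hσ : σ < bandCount V) (e : Fin 2) (ν : Fin k → Fin 2)
    (x y : Lattice d) (p p' r r' : Fin n ⊕ Fin n) :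
    Integrable fun τ => conj (amplitude V σ e x p p' τ) *
      (∑' z, UnitAddTorus.mFourier z τ * (q z : ℂ)) * octantAmplitude hk V σ e ν y r r' τ := by
  have hb : ∀ z (τ : Torus d), ‖UnitAddTorus.mFourier z τ * (q z : ℂ)‖ ≤ H z := fun z τ => by
    rw [norm_mul, norm_mFourier_apply, one_mul, Complex.norm_real, Real.norm_eq_abs]
    exact hqH z
  have hc : Continuous fun τ : Torus d => ∑' z, UnitAddTorus.mFourier z τ * (q z : ℂ) :=
    continuous_tsum (fun z => by fun_prop) hH hb
  have ha : MemLp (fun τ => conj (amplitude V σ e x p p' τ)) 2 :=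
    (memLp_amplitude hE1 hE3 hE6 hσ e x p p').star
  have hb2 : MemLp (fun τ => (∑' z, UnitAddTorus.mFourier z τ * (q z : ℂ)) *
      octantAmplitude hk V σ e ν y r r' τ) 2 := by
    have hm := memLp_octantAmplitude hk hE1 hE3 hE6 hσ e ν y r r'
    refine hm.of_le_mul (c := ∑' z, H z) (hc.aestronglyMeasurable.mul hm.1) (ae_of_all _ fun τ => ?_)
    rw [norm_mul]
    exact mul_le_mul_of_nonneg_right (tsum_of_norm_bounded hH.hasSum fun z => hb z τ) (norm_nonneg _)
  exact (MemLp.integrable_mul (p := 2) (q := 2) ha hb2).congr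
    (ae_of_all _ fun τ => (mul_assoc _ _ _).symm)

variable {α : ℝ} {μ₀ : Measure (PhaseSpace d n α)}

/-- Integrability of the limit, and the limit as an integral over the torus. -/
theorem sum_integral_eq (hk : k ≤ d) (hE1 : CondE1 V) (hE3 : CondE3 V) (hE6 : CondE6 V)
    {q : (Fin k → Fin 2) → Lattice d → BlockMatrix n ℝ} {H : Lattice d → ℝ} (hH : Summable H)
    (hqH : ∀ ν z p r, |q ν z p r| ≤ H z) (x y : Lattice d) (p r : Fin n ⊕ Fin n) :
    (Integrable fun τ => UnitAddTorus.mFourier (-(x - y)) τ * qInfHat hk V q (angle τ) p r) ∧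
    ∑ p', ∑ r', ∑ i : Fin (bandCount V) × Fin 2, ∑ ν, ∫ τ, conj (amplitude V i.1 i.2 x p p' τ) *
      (∑' z, UnitAddTorus.mFourier z τ * (q ν z p' r' : ℂ)) *
        octantAmplitude hk V i.1 i.2 ν y r r' τ =
      qInf hk V q (x - y) p r := by
  have hi := fun p' r' (i : Fin (bandCount V) × Fin 2) ν =>
    integrable_conj_amplitude_mul hk hE1 hE3 hE6 hH (fun z => hqH ν z p' r') i.1.2 i.2 ν x y p p' r r'
  have hae : (fun τ => ∑ p', ∑ r', ∑ i : Fin (bandCount V) × Fin 2, ∑ ν,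
      conj (amplitude V i.1 i.2 x p p' τ) *
      (∑' z, UnitAddTorus.mFourier z τ * (q ν z p' r' : ℂ)) *
        octantAmplitude hk V i.1 i.2 ν y r r' τ) =ᵐ[volume]
      fun τ => UnitAddTorus.mFourier (-(x - y)) τ * qInfHat hk V q (angle τ) p r := by
    filter_upwards [ae_angle_mem_goodSet hE1 hE3 hE6] with τ hτ
    exact conj_amplitude_mul_octantAmplitude hk hE3 q x y p r hτ
  have h4 := fun p' r' i => integrable_finsetSum Finset.univ fun ν _ => hi p' r' i ν
  have h3 := fun p' r' => integrable_finsetSum Finset.univ fun i _ => h4 p' r' i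
  have h2 := fun p' => integrable_finsetSum Finset.univ fun r' _ => h3 p' r'
  have h1 := integrable_finsetSum Finset.univ fun p' _ => h2 p'
  refine ⟨h1.congr hae, ?_⟩
  calc _ = ∫ τ, ∑ p', ∑ r', ∑ i : Fin (bandCount V) × Fin 2, ∑ ν,
      conj (amplitude V i.1 i.2 x p p' τ) *
      (∑' z, UnitAddTorus.mFourier z τ * (q ν z p' r' : ℂ)) *
        octantAmplitude hk V i.1 i.2 ν y r r' τ := by
        rw [integral_finsetSum _ fun p' _ => h2 p']
        refine Finset.sum_congr rfl fun p' _ => ?_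
        rw [integral_finsetSum _ fun r' _ => h3 p' r']
        refine Finset.sum_congr rfl fun r' _ => ?_
        rw [integral_finsetSum _ fun i _ => h4 p' r' i]
        refine Finset.sum_congr rfl fun i _ => ?_
        rw [integral_finsetSum _ fun ν _ => hi p' r' i ν]
    _ = ∫ τ, UnitAddTorus.mFourier (-(x - y)) τ * qInfHat hk V q (angle τ) p r :=
        integral_congr_ae hae
    _ = ∫ τ : Torus d, (fun θ => Complex.exp (-(Complex.I * (pairing (x - y) θ : ℝ))) *
          qInfHat hk V q θ p r) (angle τ) := by
        refine integral_congr_ae (ae_of_all _ fun τ => ?_)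
        simp only
        rw [UnitAddTorus.mFourier_neg, mFourier_eq_exp, ← Complex.exp_conj, map_mul, Complex.conj_I,
          Complex.conj_ofReal, neg_mul]
    _ = _ := by
        refine (integral_angle fun θ => Complex.exp (-(Complex.I * (pairing (x - y) θ : ℝ))) *
          qInfHat hk V q θ p r).trans ?_
        rw [qInf, Matrix.of_apply, Complex.real_smul]
        push_cast
        rfl

theorem CondS2.exists_summable_bound (hS2 : CondS2 μ₀) : ∃ H : Lattice d → ℝ, Summable H ∧
    ∀ y z p r, |correlation μ₀ (y + z) y p r| ≤ H z := by
  obtain ⟨-, h, -, hs, hb⟩ := hS2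
  exact ⟨fun z => h (latNorm z), hs, fun y z p r => by simpa using hb (y + z) y p r⟩

theorem integrableOn_qInfHat (hk : k ≤ d) (hE1 : CondE1 V) (hE3 : CondE3 V) (hE6 : CondE6 V)
    {q : (Fin k → Fin 2) → Lattice d → BlockMatrix n ℝ} (hS2 : CondS2 μ₀) (hS3 : CondS3 hk μ₀ q)
    (p r : Fin n ⊕ Fin n) : IntegrableOn (fun θ => qInfHat hk V q θ p r) (torusCell d) := by
  obtain ⟨H, hH, hb⟩ := hS2.exists_summable_bound
  rw [← integrable_angle_iff]
  -- At coinciding points the exponential factor is `1`, which leaves `q̂_∞` itself.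
  have h := (sum_integral_eq hk hE1 hE3 hE6 hH (fun ν z p r => abs_le_of_octant_limit hk ν
    (Q := fun x y => correlation μ₀ x y p r) (q := fun z => q ν z p r) (fun y z => hb y z p r)
    (fun z => hS3.2.1 ν z p r) z) 0 0 p r).1
  refine h.congr (ae_of_all _ fun τ => ?_)
  have h1 : UnitAddTorus.mFourier (-(0 - 0) : Lattice d) τ = 1 := by
    rw [mFourier_eq_exp]
    simp [pairing]
  exact (congrArg (· * qInfHat hk V q (angle τ) p r) h1).trans (one_mul _)

theorem tendsto_correlation (hk₁ : 1 ≤ k) (hk : k ≤ d) (hα : α < -(d : ℝ) / 2) (hE1 : CondE1 V)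
    (hE3 : CondE3 V) (hE4 : CondE4 V) (hE5 : CondE5 V) (hE6 : CondE6 V)
    {q : (Fin k → Fin 2) → Lattice d → BlockMatrix n ℝ} (hS2 : CondS2 μ₀) (hS3 : CondS3 hk μ₀ q)
    (x y : Lattice d) (p r : Fin n ⊕ Fin n) :
    Tendsto (fun t : ℝ => (correlation (evolvedMeasure V μ₀ t) x y p r : ℂ)) atTop
      (𝓝 (qInf hk V q (x - y) p r)) := by
  obtain ⟨H, hH, hb⟩ := hS2.exists_summable_bound
  -- The transport and decorrelation lemmas are stated along sequences of times, which suffices for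
  -- the limit over real times.
  refine tendsto_of_seq_tendsto fun t ht => ?_
  simp only [correlation_eq_sum_kernelForm hE1 hα hS2]
  rw [← (sum_integral_eq hk hE1 hE3 hE6 hH (fun ν z p r => abs_le_of_octant_limit hk ν
    (Q := fun x y => correlation μ₀ x y p r) (q := fun z => q ν z p r) (fun y z => hb y z p r)
    (fun z => hS3.2.1 ν z p r) z) x y p r).2]
  exact tendsto_finsetSum _ fun p' _ => tendsto_finsetSum _ fun r' _ =>
    tendsto_kernelForm_modes hk₁ hk hE1 hE3 hE4 hE5 hE6 hH
      (Q := fun x y => correlation μ₀ x y p' r') (q := fun ν z => q ν z p' r')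
      (fun y z => hb y z p' r') (fun ν z => hS3.2.1 ν z p' r') hα ht x y p p' r r'

end Convergence

end HarmonicCrystal

end

/-! ### Convergence of the covariance -/

open HarmonicCrystal MeasureTheory Filter Topology in
theorem theorem2p6 (d n k : ℕ) (hn : 1 ≤ n) (hk₁ : 1 ≤ k) (hk : k ≤ d)
    (α : ℝ) (hα : α < -(d : ℝ) / 2)
    (V : Interaction d n)
    (hE1 : CondE1 V) (hE2 : CondE2 V) (hE3 : CondE3 V)
    (hE4 : CondE4 V) (hE5 : CondE5 V) (hE6 : CondE6 V)
    (μ₀ : Measure (PhaseSpace d n α)) [IsProbabilityMeasure μ₀]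
    (q : (Fin k → Fin 2) → Lattice d → BlockMatrix n ℝ)
    (hS1 : ZeroMean μ₀) (hS2 : CondS2 μ₀) (hS3 : CondS3 hk μ₀ q) :
    (∀ t, IsProbabilityMeasure (evolvedMeasure V μ₀ t) ∧
      HasSecondMoments (evolvedMeasure V μ₀ t)) ∧
    (∀ a b, IntegrableOn (fun θ => qInfHat hk V q θ a b) (torusCell d)) ∧
    ∀ x y : Lattice d,
      Tendsto (fun t : ℝ => (correlation (evolvedMeasure V μ₀ t) x y).map ((↑) : ℝ → ℂ))
        atTop (𝓝 (qInf hk V q (x - y))) := by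
  refine ⟨fun t => ⟨?_, hasSecondMoments_evolvedMeasure hE1 hα hS2 t⟩,
    fun a b => integrableOn_qInfHat hk hE1 hE3 hE6 hS2 hS3 a b, fun x y => ?_⟩
  · exact Measure.isProbabilityMeasure_map (hE1.measurable_evolution t).aemeasurable
  · refine tendsto_pi_nhds.2 fun p => tendsto_pi_nhds.2 fun r => ?_
    exact tendsto_correlation hk₁ hk hα hE1 hE3 hE4 hE5 hE6 hS2 hS3 x y p r
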